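/- **Terminology.** An *augmented virtual double category* $\mathcal K$ has objects; a category of vertical morphisms $f\colon A\to C$; horizontal morphisms $J\colon A\nrightarrow B$; and cells $\phi\colon \underline J\Rightarrow \underline K$ with a vertical source $f\colon A\to C$, a vertical target $g\colon B\to D$, a horizontal source that is a (possibly empty) path $\underline J=(J_1,\dots,J_n)\colon A\nrightarrow B$ and a horizontal target that is a path $\underline K\colon C\nrightarrow D$ of length $1$ (*unary* cells) or $0$ (*nullary* cells, written $\underline J\Rightarrow C$). Cells have associative and unital vertical composites $\psi\circ(\phi_1,\dots,\phi_n)$, with horizontal identity cells $\mathrm{id}_J\colon J\Rightarrow J$ and vertical identity cells $\mathrm{id}_f$ (with empty horizontal source and target); identity cells $\mathrm{id}_f$ can be inserted in or removed from paths $(\phi_1,\dots,\phi_n)$. Nullary cells $\phi,\psi$ into the same object $X$ that share a vertical boundary have a horizontal composite $\phi\odot\psi=\mathrm{id}_{\mathrm{id}_X}\circ(\phi,\psi)$. A *vertical cell* is a cell with empty horizontal source and target; objects, vertical morphisms and vertical cells form a 2-category $V(\mathcal K)$, and $\cong$ between vertical morphisms means isomorphic through an invertible vertical cell. Functors preserve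 all structure strictly; a transformation $\xi\colon F\Rightarrow G$ consists of a natural transformation of the vertical parts and cells $\xi_J\colon FJ\Rightarrow GJ$ (with vertical source and target the components of $\xi$) natural with respect to all cells. * A cell $\psi\colon\underline J\Rightarrow\underline K$, with $\underline J$ of length at most $1$, vertical source $f$ and vertical target $g$, is *cartesian* if every cell $\underline H\Rightarrow\underline K$ with vertical source of the form $f\circ h$ and vertical target $g\circ k$ factors as $\psi\circ\phi'$ for a unique $\phi'\colon\underline H\Rightarrow\underline J$ with vertical source $h$ and vertical target $k$; then $\underline J$ is the restriction $\underline K(f,g)$. An object $A$ is *unital* if it has a *horizontal unit* $I_A\colon A\nrightarrow A$, with a nullary cartesian cell $I_A\Rightarrow A$ whose vertical source and target are identities. A *companion* of $f\colon A\to B$ is a morphism $f_*\colon A\nrightarrow B$ with a nullary cartesian cell $f_*\Rightarrow B$ with vertical source $f$ and vertical target $\mathrm{id}_B$. $\mathcal K$ *has restrictions on the right* if the unary restriction $K(\mathrm{id},g)$ exists for all $K\colon A\nrightarrow D$ and $g\colon B\to D$; a functor *preserves* these if it preserves the cartesian cells defining them. * A nullary cell $\eta\colon J\Rightarrow M$,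 $J\colon A\nrightarrow B$, with vertical source $d$ and target $l$ is *left Kan* if every nullary cell $(J,H_1,\dots,H_m)\Rightarrow M$ ($m\ge 0$) with vertical source $d$ is $\eta\odot\phi'$ for a unique nullary cell $\phi'$ with vertical source $l$. A vertical morphism $f\colon A\to M$ is *dense* if all nullary cartesian cells $J\Rightarrow M$ with vertical source $f$ are left Kan, and *full and faithful* if $\mathrm{id}_f$ is cartesian. A *Yoneda embedding* $y\colon A\to P$ is a dense, full and faithful morphism such that for every $J\colon A\nrightarrow B$ there is a morphism $J^\lambda\colon B\to P$ (unique up to isomorphism) with a nullary cartesian cell $J\Rightarrow P$ with vertical source $y$ and vertical target $J^\lambda$. * A path of cells $\underline\phi\colon \underline H\Rightarrow\underline J$, with outer vertical source $f$ and target $g$, is *weakly cocartesian* if every cell $\underline H\Rightarrow\underline L$, where $\underline L$ has length at most $1$, with vertical source $h\circ f$ and target $k\circ g$ is $\chi'\circ\underline\phi$ for a unique $\chi'\colon\underline J\Rightarrow\underline L$ with vertical source $h$ and target $k$; it is *right cocartesian* if moreover $(\underline\phi,\mathrm{cart},\mathrm{id}_{K_2},\dots,\mathrm{id}_{K_q})$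 is weakly cocartesian for all paths $(K_1,\dots,K_q)$, $q\ge1$, and all cartesian cells $\mathrm{cart}$ defining a restriction $K_1(g,\mathrm{id})$. A cell $\phi\colon(H_1,\dots,H_n)\Rightarrow J$, $n\ge1$, with identities as vertical source and target is *pointwise right cocartesian*, and $J$ a *pointwise right composite*, if $\phi$ is right cocartesian and, for every $f$ such that $H_n(\mathrm{id},f)$ exists, $J(\mathrm{id},f)$ exists and the cell $\phi'\colon(H_1,\dots,H_n(\mathrm{id},f))\Rightarrow J(\mathrm{id},f)$ determined by $\mathrm{cart}\circ\phi'=\phi\circ(\mathrm{id},\dots,\mathrm{id},\mathrm{cart})$ is right cocartesian. * $\mathcal K$ is *monoidal* if it is equipped with a functor $\otimes\colon\mathcal K\times\mathcal K\to\mathcal K$ (cells of $\mathcal K\times\mathcal K$ being pairs of cells of equal arities), a unit object $I$ with a specified horizontal unit $I_I$, and invertible associator and unitor transformations satisfying the pentagon and triangle identities. For $X$ with horizontal unit $I_X$, the functor $X\otimes-$ sends $J$ to $I_X\otimes J$. * A *weak horizontal dual* of $A$ is an object $A^\circ$, with horizontal unit, and a horizontal morphism $\iota\colon I\nrightarrow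 A^\circ\otimes A$ such that (a) for each $J\colon A\nrightarrow B$ a pointwise right composite $J^\flat=\iota\odot(A^\circ\otimes J)\colon I\nrightarrow A^\circ\otimes B$ of $(\iota,A^\circ\otimes J)$ exists, with defining cell $\mathrm{cocart}$; (b) for all $\underline H$ and $J$ from $A$ to $B$, $\phi\mapsto\mathrm{cocart}\circ(\mathrm{id}_\iota,A^\circ\otimes\phi)$ is a bijection from the cells $\underline H\Rightarrow J$ to the cells $(\iota,A^\circ\otimes\underline H)\Rightarrow J^\flat$, both with identities as vertical source and target. * For a functor $F\colon\mathcal K\to\mathcal L$ and an object $X$ of $\mathcal L$, the category $F/X$ has as objects pairs $(B,f\colon FB\to X)$ and as morphisms $(B,f)\to(C,g)$ pairs of a path $\underline H\colon B\nrightarrow C$ and a nullary cell $F\underline H\Rightarrow X$ with vertical source $f$ and target $g$, composed by $\odot$; $\mathcal K/X$ is $F/X$ for $F=\mathrm{id}_{\mathcal K}$. Given a Yoneda embedding $y\colon I\to PI$ and a weak horizontal dual $A^\circ$ of $A$, a morphism $f\colon A^\circ\otimes B\to PI$ is *$\iota$-small* if $f\cong(J^\flat)^\lambda$ for some $J\colon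 A\nrightarrow B$. A morphism $ev\colon A^\circ\otimes P\to PI$ *defines $P$ as the internal $\iota$-small hom* $[A^\circ,PI]$ if the functor $ev\circ(A^\circ\otimes-)\colon\mathcal K/P\to(A^\circ\otimes-)/PI$ is full and faithful and factors as an equivalence onto the full subcategory of the $\iota$-small morphisms. **Theorem.** Let $(\mathcal K,\otimes,I)$ be a monoidal augmented virtual double category that has restrictions on the right and let $y\colon I\to PI$ be a Yoneda embedding. Let $A$ be a unital object with a weak horizontal dual $A^\circ$, with copairing $\iota\colon I\nrightarrow A^\circ\otimes A$, such that the functor $A^\circ\otimes-\colon\mathcal K\to\mathcal K$ preserves restrictions on the right. 1. Consider any object $P$ with morphisms $y_A\colon A\to P$ and $ev\colon A^\circ\otimes P\to PI$ such that the companion $y_{A*}\colon A\nrightarrow P$ exists. Then the following are equivalent: * (ye) $y_A$ is a Yoneda embedding and there exists a nullary cartesian cell $(y_{A*})^\flat\Rightarrow PI$ with vertical source $y$ and vertical target $ev$; * (ih) $ev$ defines $P$ as the internal $\iota$-small hom $[A^\circ,PI]$ and there exists a nullary cartesian cell $\iota\Rightarrow PI$ with vertical source $y$ and vertical target $ev\circ(A^\circ\otimes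 y_A)$. 2. Consequently, if $y_A\colon A\to PA$ is any Yoneda embedding that admits a companion and $ev\colon A^\circ\otimes Q\to PI$ is any morphism that defines an object $Q=[A^\circ,PI]$ as the internal $\iota$-small hom, then $PA\simeq[A^\circ,PI]$: there are morphisms $PA\to[A^\circ,PI]$ and $[A^\circ,PI]\to PA$ whose composites are isomorphic to identities in $V(\mathcal K)$. -/

import Mathlib

open CategoryTheory

universe u v w x u₁ v₁ w₁ x₁ u₂ v₂ w₂ x₂ u₃ v₃ w₃ x₃

/-- Possibly empty paths `A = A₀ ⇸ A₁ ⇸ ⋯ ⇸ Aₙ = B` of horizontal morphisms. -/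
inductive HPath {O : Type u} (H : O → O → Type w) : O → O → Type (max u w)
  | nil (A : O) : HPath H A A
  | cons {A B C : O} (J : H A B) (P : HPath H B C) : HPath H A C

namespace HPath

variable {O : Type u} {H : O → O → Type w} {O' : Type u₁} {H' : O' → O' → Type w₁}
  {O'' : Type u₂} {H'' : O'' → O'' → Type w₂}

/-- The path consisting of a single horizontal morphism. -/
abbrev single {A B : O} (J : H A B) : HPath H A B := cons J (nil B)

/-- Concatenation of paths. -/
@[reducible] def append : ∀ {A B C : O}, HPath H A B → HPath H B C → HPath H A C
  | _, _, _, nil _, Q => Q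
  | _, _, _, cons J P, Q => cons J (append P Q)

theorem append_nil : ∀ {A B : O} (P : HPath H A B), P.append (nil B) = P
  | _, _, nil _ => rfl
  | _, _, cons J P => congrArg (cons J) (append_nil P)

theorem append_assoc : ∀ {A B C D : O} (P : HPath H A B) (Q : HPath H B C) (R : HPath H C D),
    (P.append Q).append R = P.append (Q.append R)
  | _, _, _, _, nil _, _, _ => rfl
  | _, _, _, _, cons J P, Q, R => congrArg (cons J) (append_assoc P Q R)

/-- The image of a path under an assignment on objects and horizontal morphisms. -/
@[reducible] def map (o : O → O') (h : ∀ {A B : O}, H A B → H' (o A) (o B)) :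
    ∀ {A B : O}, HPath H A B → HPath H' (o A) (o B)
  | _, _, nil A => nil (o A)
  | _, _, cons J P => cons (h J) (map o h P)

theorem map_append (o : O → O') (h : ∀ {A B : O}, H A B → H' (o A) (o B)) :
    ∀ {A B C : O} (P : HPath H A B) (Q : HPath H B C),
      (P.append Q).map o h = (P.map o h).append (Q.map o h)
  | _, _, _, nil _, _ => rfl
  | _, _, _, cons J P, Q => congrArg (cons (h J)) (map_append o h P Q)

theorem map_map (o : O → O') (h : ∀ {A B : O}, H A B → H' (o A) (o B))
    (o' : O' → O'') (h' : ∀ {A B : O'}, H' A B → H'' (o' A) (o' B)) :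
    ∀ {A B : O} (P : HPath H A B),
      (P.map o h).map o' h' = P.map (fun A => o' (o A)) (fun J => h' (h J))
  | _, _, nil _ => rfl
  | _, _, cons J P => congrArg (cons (h' (h J))) (map_map o h o' h' P)

theorem map_id : ∀ {A B : O} (P : HPath H A B), P.map (fun A => A) (fun J => J) = P
  | _, _, nil _ => rfl
  | _, _, cons J P => congrArg (cons J) (map_id P)

end HPath

/-- Paths of length at most one: the possible horizontal targets of cells. -/
inductive HTarget {O : Type u} (H : O → O → Type w) : O → O → Type (max u w)
  | nul (C : O) : HTarget H C C
  | one {D C : O} (K : H C D) : HTarget H C D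

namespace HTarget

variable {O : Type u} {H : O → O → Type w} {O' : Type u₁} {H' : O' → O' → Type w₁}
  {O'' : Type u₂} {H'' : O'' → O'' → Type w₂}

/-- The underlying path, of length zero or one. -/
@[reducible] def path : ∀ {C D : O}, HTarget H C D → HPath H C D
  | _, _, nul C => .nil C
  | _, _, one K => .single K

/-- The image under an assignment on objects and horizontal morphisms. -/
@[reducible] def map (o : O → O') (h : ∀ {A B : O}, H A B → H' (o A) (o B)) :
    ∀ {C D : O}, HTarget H C D → HTarget H' (o C) (o D)
  | _, _, nul C => nul (o C)
  | _, _, one K => one (h K)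

theorem path_map (o : O → O') (h : ∀ {A B : O}, H A B → H' (o A) (o B)) :
    ∀ {C D : O} (T : HTarget H C D), (T.map o h).path = T.path.map o h
  | _, _, nul _ => rfl
  | _, _, one _ => rfl

theorem map_map (o : O → O') (h : ∀ {A B : O}, H A B → H' (o A) (o B))
    (o' : O' → O'') (h' : ∀ {A B : O'}, H' A B → H'' (o' A) (o' B)) :
    ∀ {A B : O} (T : HTarget H A B),
      (T.map o h).map o' h' = T.map (fun A => o' (o A)) (fun J => h' (h J))
  | _, _, nul _ => rfl
  | _, _, one _ => rfl

theorem map_id : ∀ {A B : O} (T : HTarget H A B), T.map (fun A => A) (fun J => J) = T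
  | _, _, nul _ => rfl
  | _, _, one _ => rfl

end HTarget

/-- The objects, vertical category, horizontal morphisms and cells underlying an augmented virtual
double category. -/
structure CellGraph where
  /-- objects -/
  Obj : Type u
  /-- the category of objects and vertical morphisms -/
  [cat : Category.{v} Obj]
  /-- horizontal morphisms `A ⇸ B` -/
  Hor : Obj → Obj → Type w
  /-- cells `J₁, …, Jₙ ⇒ K` with vertical source `f : A ⟶ C`, vertical target `g : B ⟶ D`,
  horizontal source a path `A ⇸ B` and horizontal target a path `C ⇸ D` of length at most one -/
  Cell : ∀ {A B C D : Obj}, (A ⟶ C) → (B ⟶ D) → HPath Hor A B → HTarget Hor C D → Type x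

attribute [instance] CellGraph.cat

namespace CellGraph

/-- Transport of cells along equalities of their boundaries. -/
def cast {G : CellGraph.{u, v, w, x}} {A B C D : G.Obj} {f f' : A ⟶ C} {g g' : B ⟶ D}
    {P P' : HPath G.Hor A B} {T T' : HTarget G.Hor C D} (hf : f = f') (hg : g = g')
    (hP : P = P') (hT : T = T') (φ : G.Cell f g P T) : G.Cell f' g' P' T' :=
  hf ▸ hg ▸ hP ▸ hT ▸ φ

/-- Paths `φ₁, …, φₙ` of horizontally composable cells; the indices record the vertical source
of `φ₁`, the vertical target of `φₙ`, the concatenation of the horizontal sources and that of the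
horizontal targets. The empty path at a vertical morphism `f` is included. -/
inductive CellPath (G : CellGraph.{u, v, w, x}) : ∀ {A B C D : G.Obj}, (A ⟶ C) → (B ⟶ D) →
    HPath G.Hor A B → HPath G.Hor C D → Type (max u v w x)
  | nil {A C : G.Obj} (f : A ⟶ C) : CellPath G f f (.nil A) (.nil C)
  | cons {A₀ A₁ A₂ C₀ C₁ C₂ : G.Obj} {f₀ : A₀ ⟶ C₀} {f₁ : A₁ ⟶ C₁} {f₂ : A₂ ⟶ C₂}
      {J : HPath G.Hor A₀ A₁} {K : HTarget G.Hor C₀ C₁}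
      {P : HPath G.Hor A₁ A₂} {Q : HPath G.Hor C₁ C₂}
      {P' : HPath G.Hor A₀ A₂} {Q' : HPath G.Hor C₀ C₂}
      (φ : G.Cell f₀ f₁ J K) (Φ : CellPath G f₁ f₂ P Q)
      (hP : P' = J.append P) (hQ : Q' = K.path.append Q) : CellPath G f₀ f₂ P' Q'

theorem cast_symm_cast {G : CellGraph.{u, v, w, x}} {A B C D : G.Obj} {f : A ⟶ C} {g : B ⟶ D}
    {P P' : HPath G.Hor A B} {T : HTarget G.Hor C D} (h : P' = P) (φ : G.Cell f g P T) :
    cast rfl rfl h rfl (cast rfl rfl h.symm rfl φ) = φ := by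
  subst h; rfl

namespace CellPath

variable {G : CellGraph.{u, v, w, x}}

/-- The path consisting of a single cell. -/
def single {A B C D : G.Obj} {f : A ⟶ C} {g : B ⟶ D} {P : HPath G.Hor A B}
    {T : HTarget G.Hor C D} (φ : G.Cell f g P T) : CellPath G f g P T.path :=
  cons φ (nil g) P.append_nil.symm T.path.append_nil.symm

/-- Concatenation of paths of cells. -/
def append : ∀ {A₀ A₁ A₂ C₀ C₁ C₂ : G.Obj} {f₀ : A₀ ⟶ C₀} {f₁ : A₁ ⟶ C₁} {f₂ : A₂ ⟶ C₂}
    {P : HPath G.Hor A₀ A₁} {Q : HPath G.Hor C₀ C₁} {P' : HPath G.Hor A₁ A₂}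
    {Q' : HPath G.Hor C₁ C₂}, CellPath G f₀ f₁ P Q → CellPath G f₁ f₂ P' Q' →
      CellPath G f₀ f₂ (P.append P') (Q.append Q')
  | _, _, _, _, _, _, _, _, _, _, _, _, _, nil _, Ψ => Ψ
  | _, _, _, _, _, _, _, _, _, _, _, _, _, cons φ Φ hP hQ, Ψ =>
    cons φ (append Φ Ψ) (by rw [hP, HPath.append_assoc]) (by rw [hQ, HPath.append_assoc])

/-- Transport of paths of cells along equalities of their horizontal boundaries. -/
def cast {A B C D : G.Obj} {f : A ⟶ C} {g : B ⟶ D}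
    {P P' : HPath G.Hor A B} {Q Q' : HPath G.Hor C D}
    (hP : P = P') (hQ : Q = Q') (Φ : CellPath G f g P Q) : CellPath G f g P' Q' :=
  hP ▸ hQ ▸ Φ

end CellPath

/-- Paths of vertically composable pairs `(Φᵢ, ψᵢ)`, where `Φᵢ` is a path of cells and `ψᵢ` is a
cell whose horizontal source is the concatenation of the horizontal targets of `Φᵢ`. -/
inductive CellGrid (G : CellGraph.{u, v, w, x}) : ∀ {A B C D E F : G.Obj}, (A ⟶ C) → (B ⟶ D) →
    (C ⟶ E) → (D ⟶ F) → HPath G.Hor A B → HPath G.Hor C D → HPath G.Hor E F →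
    Type (max u v w x)
  | nil {A C E : G.Obj} (f : A ⟶ C) (g : C ⟶ E) :
      CellGrid G f f g g (.nil A) (.nil C) (.nil E)
  | cons {A₀ A₁ A₂ C₀ C₁ C₂ E₀ E₁ E₂ : G.Obj}
      {f₀ : A₀ ⟶ C₀} {f₁ : A₁ ⟶ C₁} {f₂ : A₂ ⟶ C₂}
      {g₀ : C₀ ⟶ E₀} {g₁ : C₁ ⟶ E₁} {g₂ : C₂ ⟶ E₂}
      {P : HPath G.Hor A₀ A₁} {Q : HPath G.Hor C₀ C₁} {K : HTarget G.Hor E₀ E₁}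
      {P' : HPath G.Hor A₁ A₂} {Q' : HPath G.Hor C₁ C₂} {R' : HPath G.Hor E₁ E₂}
      {P'' : HPath G.Hor A₀ A₂} {Q'' : HPath G.Hor C₀ C₂} {R'' : HPath G.Hor E₀ E₂}
      (Φ : CellPath G f₀ f₁ P Q) (ψ : G.Cell g₀ g₁ Q K) (N : CellGrid G f₁ f₂ g₁ g₂ P' Q' R')
      (hP : P'' = P.append P') (hQ : Q'' = Q.append Q') (hR : R'' = K.path.append R') :
      CellGrid G f₀ f₂ g₀ g₂ P'' Q'' R''

namespace CellGrid

variable {G : CellGraph.{u, v, w, x}}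

/-- The concatenation of the paths `Φᵢ`. -/
def upper : ∀ {A B C D E F : G.Obj} {f : A ⟶ C} {f' : B ⟶ D} {g : C ⟶ E} {g' : D ⟶ F}
    {P : HPath G.Hor A B} {Q : HPath G.Hor C D} {R : HPath G.Hor E F},
      CellGrid G f f' g g' P Q R → CellPath G f f' P Q
  | _, _, _, _, _, _, _, _, _, _, _, _, _, nil f _ => .nil f
  | _, _, _, _, _, _, _, _, _, _, _, _, _, cons Φ _ N hP hQ _ =>
    (Φ.append N.upper).cast hP.symm hQ.symm

/-- The path of the cells `ψᵢ`. -/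
def lower : ∀ {A B C D E F : G.Obj} {f : A ⟶ C} {f' : B ⟶ D} {g : C ⟶ E} {g' : D ⟶ F}
    {P : HPath G.Hor A B} {Q : HPath G.Hor C D} {R : HPath G.Hor E F},
      CellGrid G f f' g g' P Q R → CellPath G g g' Q R
  | _, _, _, _, _, _, _, _, _, _, _, _, _, nil _ g => .nil g
  | _, _, _, _, _, _, _, _, _, _, _, _, _, cons _ ψ N _ hQ hR => .cons ψ N.lower hQ hR

end CellGrid
end CellGraph

/-- The data of an augmented virtual double category: vertical composites `ψ ∘ (φ₁, …, φₙ)` of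
cells, horizontal identity cells and vertical identity cells. In `comp`, the vertical source and
target of the composite are presented up to equality. -/
structure AVDCData extends CellGraph.{u, v, w, x} where
  /-- the composite `ψ ∘ Φ` of a path of cells `Φ` and a cell `ψ` -/
  comp : ∀ {A B C D E F : Obj} {f : A ⟶ C} {g : B ⟶ D} {h : C ⟶ E} {k : D ⟶ F}
    {l : A ⟶ E} {m : B ⟶ F} {P : HPath Hor A B} {Q : HPath Hor C D} {T : HTarget Hor E F},
    toCellGraph.CellPath f g P Q → Cell h k Q T → f ≫ h = l → g ≫ k = m → Cell l m P T
  /-- the horizontal identity cell of `J` -/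
  hid : ∀ {A B : Obj} (J : Hor A B), Cell (𝟙 A) (𝟙 B) (.single J) (.one J)
  vid : ∀ {A C : Obj} (f : A ⟶ C), Cell f f (.nil A) (.nul C)


namespace CellGraph.CellPath

/-- The path of horizontal identity cells of a path of horizontal morphisms. -/
def idPath (K : AVDCData.{u, v, w, x}) : ∀ {A B : K.Obj} (P : HPath K.Hor A B),
    CellPath K.toCellGraph (𝟙 A) (𝟙 B) P P
  | _, _, .nil A => .nil (𝟙 A)
  | _, _, .cons J P => .cons (K.hid J) (idPath K P) rfl rfl

end CellGraph.CellPath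

namespace CellGraph.CellGrid

/-- The path of the vertical composites `ψᵢ ∘ Φᵢ`. -/
def composite (K : AVDCData.{u, v, w, x}) : ∀ {A B C D E F : K.Obj} {f : A ⟶ C} {f' : B ⟶ D}
    {g : C ⟶ E} {g' : D ⟶ F} {P : HPath K.Hor A B} {Q : HPath K.Hor C D} {R : HPath K.Hor E F},
      CellGrid K.toCellGraph f f' g g' P Q R →
        CellPath K.toCellGraph (f ≫ g) (f' ≫ g') P R
  | _, _, _, _, _, _, _, _, _, _, _, _, _, nil f g => .nil (f ≫ g)
  | _, _, _, _, _, _, _, _, _, _, _, _, _, cons Φ ψ N hP _ hR =>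
    .cons (K.comp Φ ψ rfl rfl) (composite K N) hP hR

end CellGraph.CellGrid

open CellGraph

/-- Augmented virtual double categories. -/
structure AVDC extends AVDCData.{u, v, w, x} where
  /-- associativity: `χ ∘ (ψ₁ ∘ Φ₁, …, ψₙ ∘ Φₙ) = (χ ∘ (ψ₁, …, ψₙ)) ∘ (Φ₁, …, Φₙ)` -/
  assoc : ∀ {A B C D E F G H : Obj} {f : A ⟶ C} {f' : B ⟶ D} {g : C ⟶ E} {g' : D ⟶ F}
    {h : E ⟶ G} {h' : F ⟶ H} {l : A ⟶ G} {l' : B ⟶ H} {P : HPath Hor A B} {Q : HPath Hor C D}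
    {R : HPath Hor E F} {T : HTarget Hor G H} (N : CellGrid toCellGraph f f' g g' P Q R)
    (χ : Cell h h' R T) (hl : (f ≫ g) ≫ h = l) (hl' : (f' ≫ g') ≫ h' = l'),
    comp (N.composite toAVDCData) χ hl hl' =
      comp N.upper (comp N.lower χ rfl rfl) ((Category.assoc f g h).symm.trans hl)
        ((Category.assoc f' g' h').symm.trans hl')
  comp_hid : ∀ {A B C D : Obj} {f : A ⟶ C} {g : B ⟶ D} {P : HPath Hor A B} {J : Hor C D}
    (φ : Cell f g P (.one J)),
    comp (CellPath.single φ) (hid J) (Category.comp_id f) (Category.comp_id g) = φ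
  comp_vid : ∀ {A B C : Obj} {f : A ⟶ C} {g : B ⟶ C} {P : HPath Hor A B}
    (φ : Cell f g P (.nul C)),
    comp (CellPath.single φ) (vid (𝟙 C)) (Category.comp_id f) (Category.comp_id g) = φ
  idPath_comp : ∀ {A B C D : Obj} {f : A ⟶ C} {g : B ⟶ D} {P : HPath Hor A B}
    {T : HTarget Hor C D} (φ : Cell f g P T),
    comp (CellPath.idPath toAVDCData P) φ (Category.id_comp f) (Category.id_comp g) = φ
  vid_comp_vid : ∀ {A C E : Obj} (f : A ⟶ C) (g : C ⟶ E),
    comp (CellPath.single (vid f)) (vid g) rfl rfl = vid (f ≫ g)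
  /-- vertical identity cells can be inserted in, and deleted from, paths of cells -/
  comp_insert_vid : ∀ {A₀ A₁ A₂ C₀ C₁ C₂ E F : Obj} {f₀ : A₀ ⟶ C₀} {f₁ : A₁ ⟶ C₁}
    {f₂ : A₂ ⟶ C₂} {h : C₀ ⟶ E} {k : C₂ ⟶ F} {l : A₀ ⟶ E} {m : A₂ ⟶ F}
    {P : HPath Hor A₀ A₁} {Q : HPath Hor C₀ C₁} {P' : HPath Hor A₁ A₂} {Q' : HPath Hor C₁ C₂}
    {T : HTarget Hor E F} (Φ : CellPath toCellGraph f₀ f₁ P Q)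
    (Ψ : CellPath toCellGraph f₁ f₂ P' Q') (χ : Cell h k (Q.append Q') T)
    (hl : f₀ ≫ h = l) (hm : f₂ ≫ k = m),
    comp (Φ.append (.cons (vid f₁) Ψ rfl rfl)) χ hl hm = comp (Φ.append Ψ) χ hl hm


namespace CellGraph.CellPath

variable {G : CellGraph.{u, v, w, x}}

theorem cast_cons {A₀ A₁ A₂ C₀ C₁ C₂ : G.Obj} {f₀ : A₀ ⟶ C₀} {f₁ : A₁ ⟶ C₁} {f₂ : A₂ ⟶ C₂}
    {J : HPath G.Hor A₀ A₁} {K : HTarget G.Hor C₀ C₁}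
    {P : HPath G.Hor A₁ A₂} {Q : HPath G.Hor C₁ C₂}
    {P' P'' : HPath G.Hor A₀ A₂} {Q' Q'' : HPath G.Hor C₀ C₂}
    (φ : G.Cell f₀ f₁ J K) (Φ : CellPath G f₁ f₂ P Q)
    (hP : P' = J.append P) (hQ : Q' = K.path.append Q) (hP' : P' = P'') (hQ' : Q' = Q'') :
    (cons φ Φ hP hQ).cast hP' hQ' = cons φ Φ (hP'.symm.trans hP) (hQ'.symm.trans hQ) := by
  subst hP' hQ'; rfl

theorem cons_cast {A₀ A₁ A₂ C₀ C₁ C₂ : G.Obj} {f₀ : A₀ ⟶ C₀} {f₁ : A₁ ⟶ C₁} {f₂ : A₂ ⟶ C₂}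
    {J : HPath G.Hor A₀ A₁} {K : HTarget G.Hor C₀ C₁}
    {P P₁ : HPath G.Hor A₁ A₂} {Q Q₁ : HPath G.Hor C₁ C₂}
    {P' : HPath G.Hor A₀ A₂} {Q' : HPath G.Hor C₀ C₂}
    (φ : G.Cell f₀ f₁ J K) (Φ : CellPath G f₁ f₂ P Q) (h₁ : P = P₁) (h₂ : Q = Q₁)
    (hP : P' = J.append P₁) (hQ : Q' = K.path.append Q₁) :
    cons φ (Φ.cast h₁ h₂) hP hQ = cons φ Φ (h₁ ▸ hP) (h₂ ▸ hQ) := by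
  subst h₁ h₂; rfl

theorem append_nil : ∀ {A B C D : G.Obj} {f : A ⟶ C} {g : B ⟶ D} {P : HPath G.Hor A B}
    {Q : HPath G.Hor C D} (Φ : CellPath G f g P Q),
    Φ.append (nil g) = Φ.cast P.append_nil.symm Q.append_nil.symm
  | _, _, _, _, _, _, _, _, nil _ => rfl
  | _, _, _, _, _, _, _, _, cons φ Φ hP hQ => by
    simp only [append, append_nil Φ, cons_cast, cast_cons]

theorem cast_cast {A B C D : G.Obj} {f : A ⟶ C} {g : B ⟶ D}
    {P P' P'' : HPath G.Hor A B} {Q Q' Q'' : HPath G.Hor C D}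
    (hP : P = P') (hQ : Q = Q') (hP' : P' = P'') (hQ' : Q' = Q'') (Φ : CellPath G f g P Q) :
    (Φ.cast hP hQ).cast hP' hQ' = Φ.cast (hP.trans hP') (hQ.trans hQ') := by
  subst hP hQ hP' hQ'; rfl

end CellGraph.CellPath

namespace AVDC

variable {K : AVDC.{u, v, w, x}}

theorem comp_cast {A B C D E F : K.Obj} {f : A ⟶ C} {g : B ⟶ D} {h : C ⟶ E} {k : D ⟶ F}
    {l : A ⟶ E} {m : B ⟶ F} {P P' : HPath K.Hor A B} {Q Q' : HPath K.Hor C D}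
    {T : HTarget K.Hor E F} (hP : P = P') (hQ : Q = Q') (Φ : CellPath K.toCellGraph f g P Q)
    (χ : K.Cell h k Q' T) (hl : f ≫ h = l) (hm : g ≫ k = m) :
    K.comp (Φ.cast hP hQ) χ hl hm =
      CellGraph.cast rfl rfl hP rfl
        (K.comp Φ (CellGraph.cast rfl rfl hQ.symm rfl χ) hl hm) := by
  subst hP hQ; rfl

theorem comp_comp {A B C D E F G H : K.Obj} {f : A ⟶ C} {f' : B ⟶ D} {g : C ⟶ E}
    {g' : D ⟶ F} {h : E ⟶ G} {h' : F ⟶ H} {l : A ⟶ G} {l' : B ⟶ H}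
    {m : A ⟶ E} {m' : B ⟶ F} {n : C ⟶ G} {n' : D ⟶ H}
    {P : HPath K.Hor A B} {Q : HPath K.Hor C D}
    {R : HTarget K.Hor E F} {T : HTarget K.Hor G H} (Φ : CellPath K.toCellGraph f f' P Q)
    (ψ : K.Cell g g' Q R) (χ : K.Cell h h' R.path T)
    (hm : f ≫ g = m) (hm' : f' ≫ g' = m') (hn : g ≫ h = n) (hn' : g' ≫ h' = n')
    (hl : m ≫ h = l) (hl' : m' ≫ h' = l') (hl2 : f ≫ n = l) (hl2' : f' ≫ n' = l') :
    K.comp (.single (K.comp Φ ψ hm hm')) χ hl hl' =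
      K.comp Φ (K.comp (.single ψ) χ hn hn') hl2 hl2' := by
  subst hm hm' hn hn'
  have := K.assoc (CellGrid.cons Φ ψ (.nil f' g') P.append_nil.symm Q.append_nil.symm
    R.path.append_nil.symm) χ hl hl'
  refine this.trans ?_
  simp only [CellGrid.upper, CellGrid.lower, CellPath.append_nil, CellPath.cast_cast]
  rfl

theorem comp_comp₂ {A₀ A₁ A₂ C₀ C₁ C₂ E₀ E₁ E₂ X Y : K.Obj}
    {f₀ : A₀ ⟶ C₀} {f₁ : A₁ ⟶ C₁} {f₂ : A₂ ⟶ C₂} {g₀ : C₀ ⟶ E₀} {g₁ : C₁ ⟶ E₁} {g₂ : C₂ ⟶ E₂}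
    {m₀ : A₀ ⟶ E₀} {m₁ : A₁ ⟶ E₁} {m₂ : A₂ ⟶ E₂} {h : E₀ ⟶ X} {k : E₂ ⟶ Y}
    {n : C₀ ⟶ X} {n' : C₂ ⟶ Y} {l : A₀ ⟶ X} {l' : A₂ ⟶ Y}
    {P : HPath K.Hor A₀ A₁} {Q : HPath K.Hor C₀ C₁} {R : HTarget K.Hor E₀ E₁}
    {P' : HPath K.Hor A₁ A₂} {Q' : HPath K.Hor C₁ C₂} {R' : HTarget K.Hor E₁ E₂}
    {P'' : HPath K.Hor A₀ A₂} {S : HPath K.Hor E₀ E₂} {T : HTarget K.Hor X Y}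
    (Φ : CellPath K.toCellGraph f₀ f₁ P Q) (Φ' : CellPath K.toCellGraph f₁ f₂ P' Q')
    (ψ : K.Cell g₀ g₁ Q R) (ψ' : K.Cell g₁ g₂ Q' R') (χ : K.Cell h k S T)
    (h₀ : f₀ ≫ g₀ = m₀) (h₁ : f₁ ≫ g₁ = m₁) (h₁' : f₁ ≫ g₁ = m₁) (h₂ : f₂ ≫ g₂ = m₂)
    (hn : g₀ ≫ h = n) (hn' : g₂ ≫ k = n') (hl : m₀ ≫ h = l) (hl' : m₂ ≫ k = l')
    (hl2 : f₀ ≫ n = l) (hl2' : f₂ ≫ n' = l')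
    (hP : P'' = P.append P') (hS : S = R.path.append R'.path)
    (e₁ : P' = P'.append (.nil _)) (e₂ : R'.path = R'.path.append (.nil _))
    (e₃ : Q' = Q'.append (.nil _)) :
    K.comp (.cons (K.comp Φ ψ h₀ h₁) (.cons (K.comp Φ' ψ' h₁' h₂) (.nil m₂) e₁ e₂) hP hS) χ hl hl'
      = K.comp ((Φ.append Φ').cast hP.symm rfl)
          (K.comp (.cons ψ (.cons ψ' (.nil g₂) e₃ e₂) rfl hS) χ hn hn') hl2 hl2' := by
  subst h₀ h₁ h₂ hn hn' hP
  have := K.assoc (CellGrid.cons Φ ψ (.cons Φ' ψ' (.nil f₂ g₂) e₁ e₃ e₂) rfl rfl hS) χ hl hl'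
  refine this.trans ?_
  simp only [CellGrid.upper, CellGrid.lower, CellPath.append_nil, CellPath.cast_cast]
  rfl

/-- The horizontal composite `φ ⊙ ψ = id_X ∘ (φ, ψ)` of nullary cells; the last argument allows
for presenting the concatenation of the horizontal sources up to equality. -/
def hcomp (K : AVDC.{u, v, w, x}) {A B C X : K.Obj} {f : A ⟶ X} {g : B ⟶ X} {h : C ⟶ X}
    {P : HPath K.Hor A B} {Q : HPath K.Hor B C} {R : HPath K.Hor A C}
    (φ : K.Cell f g P (.nul X)) (ψ : K.Cell g h Q (.nul X)) (hR : R = P.append Q) :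
    K.Cell f h R (.nul X) :=
  K.comp (.cons φ (.single ψ) hR rfl) (K.vid (𝟙 X)) (Category.comp_id f) (Category.comp_id h)

theorem vid_hcomp {A B X : K.Obj} {f : A ⟶ X} {g : B ⟶ X} {P : HPath K.Hor A B}
    (φ : K.Cell f g P (.nul X)) : K.hcomp (K.vid f) φ rfl = φ :=
  (K.comp_insert_vid (.nil f) (.single φ) (K.vid (𝟙 X)) _ _).trans (K.comp_vid φ)


theorem hcomp_eq_cast {A B C X : K.Obj} {f : A ⟶ X} {g : B ⟶ X} {h : C ⟶ X}
    {P : HPath K.Hor A B} {Q : HPath K.Hor B C} {R R' : HPath K.Hor A C}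
    (φ : K.Cell f g P (.nul X)) (ψ : K.Cell g h Q (.nul X)) (hR : R = P.append Q)
    (hR' : R' = P.append Q) (e : R' = R) :
    K.hcomp φ ψ hR = CellGraph.cast rfl rfl e rfl (K.hcomp φ ψ hR') := by
  subst e; rfl

theorem hcomp_vid {A B X : K.Obj} {f : A ⟶ X} {g : B ⟶ X} {P : HPath K.Hor A B}
    (φ : K.Cell f g P (.nul X)) : K.hcomp φ (K.vid g) P.append_nil.symm = φ := by
  have h := K.comp_insert_vid (.single φ) (.nil g) (K.vid (𝟙 X)) (Category.comp_id f)
    (Category.comp_id g)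
  have key : K.hcomp φ (K.vid g) rfl = CellGraph.cast rfl rfl P.append_nil.symm rfl φ := by
    refine h.trans ?_
    rw [CellPath.append_nil, comp_cast]
    exact congrArg _ (K.comp_vid φ)
  rw [hcomp_eq_cast φ _ _ rfl P.append_nil, key]
  exact CellGraph.cast_symm_cast P.append_nil φ

theorem vid_vid_comp {A C X : K.Obj} (f : A ⟶ C) (g : C ⟶ X) {l : A ⟶ X} (h : f ≫ g = l) :
    K.comp (.single (K.vid f)) (K.vid g) h h = K.vid l := by
  subst h; exact K.vid_comp_vid f g

/-- the interchange law for vertical and horizontal composition -/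
theorem comp_hcomp {A B C A' B' C' X : K.Obj} {f : A ⟶ A'} {g : B ⟶ B'} {h : C ⟶ C'}
    {f' : A' ⟶ X} {g' : B' ⟶ X} {h' : C' ⟶ X} {l : A ⟶ X} {m : B ⟶ X} {n : C ⟶ X}
    {P : HPath K.Hor A B} {P' : HPath K.Hor B C} {Q : HPath K.Hor A' B'} {Q' : HPath K.Hor B' C'}
    {R : HPath K.Hor A C}
    (Φ : CellPath K.toCellGraph f g P Q) (Φ' : CellPath K.toCellGraph g h P' Q')
    (ψ : K.Cell f' g' Q (.nul X)) (ψ' : K.Cell g' h' Q' (.nul X))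
    (hl : f ≫ f' = l) (hm : g ≫ g' = m) (hn : h ≫ h' = n) (hR : R = P.append P') :
    K.comp ((Φ.append Φ').cast hR.symm rfl) (K.hcomp ψ ψ' rfl) hl hn =
      K.hcomp (K.comp Φ ψ hl hm) (K.comp Φ' ψ' hm hn) hR :=
  (comp_comp₂ Φ Φ' ψ ψ' (K.vid (𝟙 X)) hl hm hm hn (Category.comp_id _) (Category.comp_id _)
    (Category.comp_id _) (Category.comp_id _) hl hn hR rfl _ _ _).symm

/-- postcomposition with a vertical morphism -/
def post (K : AVDC.{u, v, w, x}) {A B X Y : K.Obj} {f : A ⟶ X} {g : B ⟶ X}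
    {P : HPath K.Hor A B} (φ : K.Cell f g P (.nul X)) (e : X ⟶ Y) :
    K.Cell (f ≫ e) (g ≫ e) P (.nul Y) :=
  K.comp (.single φ) (K.vid e) rfl rfl

theorem hcomp_assoc {A B C D X : K.Obj} {f : A ⟶ X} {g : B ⟶ X} {h : C ⟶ X} {k : D ⟶ X}
    {P : HPath K.Hor A B} {Q : HPath K.Hor B C} {R : HPath K.Hor C D}
    {PQ : HPath K.Hor A C} {QR : HPath K.Hor B D} {PQR : HPath K.Hor A D}
    (φ : K.Cell f g P (.nul X)) (ψ : K.Cell g h Q (.nul X)) (χ : K.Cell h k R (.nul X))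
    (h₁ : PQ = P.append Q) (h₂ : PQR = PQ.append R) (h₃ : QR = Q.append R)
    (h₄ : PQR = P.append QR) :
    K.hcomp (K.hcomp φ ψ h₁) χ h₂ = K.hcomp φ (K.hcomp ψ χ h₃) h₄ := by
  subst h₃
  have e₁ : K.hcomp (K.hcomp φ ψ h₁) χ h₂ = K.comp (((CellPath.cons φ (.single ψ) h₁ rfl).append
      (.single χ)).cast h₂.symm rfl) (K.hcomp (K.vid (𝟙 X)) (K.vid (𝟙 X)) rfl)
        (Category.comp_id f) (Category.comp_id k) := by
    rw [comp_hcomp _ _ _ _ (Category.comp_id f) (Category.comp_id h) (Category.comp_id k)]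
    rw [K.comp_vid]; rfl
  have e₂ : K.hcomp φ (K.hcomp ψ χ rfl) h₄ = K.comp (((CellPath.single φ).append
      (.cons ψ (.single χ) rfl rfl)).cast h₄.symm rfl) (K.hcomp (K.vid (𝟙 X)) (K.vid (𝟙 X)) rfl)
        (Category.comp_id f) (Category.comp_id k) := by
    rw [comp_hcomp _ _ _ _ (Category.comp_id f) (Category.comp_id g) (Category.comp_id k)]
    rw [K.comp_vid]; rfl
  rw [e₁, e₂]
  congr 1
  simp only [CellPath.append, CellPath.single, CellPath.cast_cons]

theorem post_hcomp {A B C X Y : K.Obj} {f : A ⟶ X} {g : B ⟶ X} {h : C ⟶ X}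
    {P : HPath K.Hor A B} {Q : HPath K.Hor B C} {R : HPath K.Hor A C}
    (φ : K.Cell f g P (.nul X)) (ψ : K.Cell g h Q (.nul X)) (hR : R = P.append Q) (e : X ⟶ Y) :
    K.post (K.hcomp φ ψ hR) e = K.hcomp (K.post φ e) (K.post ψ e) hR := by
  unfold post
  rw [← comp_hcomp (.single φ) (.single ψ) (K.vid e) (K.vid e) rfl rfl rfl hR]
  have : K.hcomp (K.vid e) (K.vid e) rfl = K.comp (.single (K.vid (𝟙 X))) (K.vid e)
    (Category.id_comp e) (Category.id_comp e) := by
    rw [vid_hcomp, vid_vid_comp]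
  refine (comp_comp (CellPath.cons φ (.single ψ) hR rfl) (K.vid (𝟙 X)) (K.vid e) _ _
    (Category.id_comp e) (Category.id_comp e) _ _ rfl rfl).trans ?_
  rw [this]
  simp only [CellPath.append, CellPath.single, CellPath.cast_cons]
end AVDC


namespace CellGraph

/-- Assignments on objects, vertical morphisms, horizontal morphisms and cells that preserve
boundaries and are functorial on vertical morphisms. -/
structure Hom (G : CellGraph.{u, v, w, x}) (H : CellGraph.{u₁, v₁, w₁, x₁}) where
  ver : G.Obj ⥤ H.Obj
  hor : ∀ {A B : G.Obj}, G.Hor A B → H.Hor (ver.obj A) (ver.obj B)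
  cell : ∀ {A B C D : G.Obj} {f : A ⟶ C} {g : B ⟶ D} {P : HPath G.Hor A B}
    {T : HTarget G.Hor C D}, G.Cell f g P T →
      H.Cell (ver.map f) (ver.map g) (P.map ver.obj hor) (T.map ver.obj hor)

namespace Hom

variable {G : CellGraph.{u, v, w, x}} {H : CellGraph.{u₁, v₁, w₁, x₁}}

/-- The image of a path of horizontal morphisms. -/
abbrev path (F : Hom G H) {A B : G.Obj} (P : HPath G.Hor A B) :
    HPath H.Hor (F.ver.obj A) (F.ver.obj B) := P.map F.ver.obj F.hor

/-- The image of a path of length at most one. -/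
abbrev target (F : Hom G H) {A B : G.Obj} (T : HTarget G.Hor A B) :
    HTarget H.Hor (F.ver.obj A) (F.ver.obj B) := T.map F.ver.obj F.hor

/-- The image of a path of cells. -/
def cells (F : Hom G H) : ∀ {A B C D : G.Obj} {f : A ⟶ C} {g : B ⟶ D} {P : HPath G.Hor A B}
    {Q : HPath G.Hor C D}, CellPath G f g P Q →
      CellPath H (F.ver.map f) (F.ver.map g) (F.path P) (F.path Q)
  | _, _, _, _, _, _, _, _, .nil f => .nil (F.ver.map f)
  | _, _, _, _, _, _, _, _, .cons φ Φ hP hQ =>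
    .cons (F.cell φ) (F.cells Φ) (by subst hP; exact HPath.map_append _ _ _ _)
      (by subst hQ; rw [HTarget.path_map]; exact HPath.map_append _ _ _ _)

theorem cells_cast (F : Hom G H) {A B C D : G.Obj} {f : A ⟶ C} {g : B ⟶ D}
    {P P' : HPath G.Hor A B} {Q Q' : HPath G.Hor C D} (hP : P = P') (hQ : Q = Q')
    (Φ : CellPath G f g P Q) :
    F.cells (Φ.cast hP hQ) = (F.cells Φ).cast (congrArg _ hP) (congrArg _ hQ) := by
  subst hP hQ; rfl

theorem cells_single (F : Hom G H) {A B C D : G.Obj} {f : A ⟶ C} {g : B ⟶ D}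
    {P : HPath G.Hor A B} {T : HTarget G.Hor C D} (φ : G.Cell f g P T) :
    F.cells (.single φ) = (CellPath.single (F.cell φ)).cast rfl (HTarget.path_map _ _ T) := by
  simp only [CellPath.single, cells, CellPath.cast_cons]

theorem cells_append (F : Hom G H) : ∀ {A₀ A₁ A₂ C₀ C₁ C₂ : G.Obj} {f₀ : A₀ ⟶ C₀}
    {f₁ : A₁ ⟶ C₁} {f₂ : A₂ ⟶ C₂} {P : HPath G.Hor A₀ A₁} {Q : HPath G.Hor C₀ C₁}
    {P' : HPath G.Hor A₁ A₂} {Q' : HPath G.Hor C₁ C₂} (Φ : CellPath G f₀ f₁ P Q)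
    (Ψ : CellPath G f₁ f₂ P' Q'),
    F.cells (Φ.append Ψ) = ((F.cells Φ).append (F.cells Ψ)).cast
      (HPath.map_append _ _ P P').symm (HPath.map_append _ _ Q Q').symm
  | _, _, _, _, _, _, _, _, _, _, _, _, _, .nil _, Ψ => rfl
  | _, _, _, _, _, _, _, _, _, _, _, _, _, .cons φ Φ hP hQ, Ψ => by
    simp only [CellPath.append, cells, cells_append F Φ Ψ, CellPath.cons_cast, CellPath.cast_cons]

/-- The image of a grid of cells. -/
def grid (F : Hom G H) : ∀ {A B C D X Y : G.Obj} {f : A ⟶ C} {f' : B ⟶ D} {g : C ⟶ X}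
    {g' : D ⟶ Y} {P : HPath G.Hor A B} {Q : HPath G.Hor C D} {R : HPath G.Hor X Y},
      CellGrid G f f' g g' P Q R → CellGrid H (F.ver.map f) (F.ver.map f') (F.ver.map g)
        (F.ver.map g') (F.path P) (F.path Q) (F.path R)
  | _, _, _, _, _, _, _, _, _, _, _, _, _, .nil f g => .nil (F.ver.map f) (F.ver.map g)
  | _, _, _, _, _, _, _, _, _, _, _, _, _, .cons Φ ψ N hP hQ hR =>
    .cons (F.cells Φ) (F.cell ψ) (F.grid N) (by subst hP; exact HPath.map_append _ _ _ _)
      (by subst hQ; exact HPath.map_append _ _ _ _)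
      (by subst hR; rw [HTarget.path_map]; exact HPath.map_append _ _ _ _)

theorem cells_upper (F : Hom G H) : ∀ {A B C D X Y : G.Obj} {f : A ⟶ C} {f' : B ⟶ D} {g : C ⟶ X}
    {g' : D ⟶ Y} {P : HPath G.Hor A B} {Q : HPath G.Hor C D} {R : HPath G.Hor X Y}
    (N : CellGrid G f f' g g' P Q R), F.cells N.upper = (F.grid N).upper
  | _, _, _, _, _, _, _, _, _, _, _, _, _, .nil f g => rfl
  | _, _, _, _, _, _, _, _, _, _, _, _, _, .cons Φ ψ N hP hQ hR => by
    simp only [CellGrid.upper, grid, cells_cast, cells_append, cells_upper F N,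
      CellPath.cast_cast]

theorem cells_lower (F : Hom G H) : ∀ {A B C D X Y : G.Obj} {f : A ⟶ C} {f' : B ⟶ D} {g : C ⟶ X}
    {g' : D ⟶ Y} {P : HPath G.Hor A B} {Q : HPath G.Hor C D} {R : HPath G.Hor X Y}
    (N : CellGrid G f f' g g' P Q R), F.cells N.lower = (F.grid N).lower
  | _, _, _, _, _, _, _, _, _, _, _, _, _, .nil f g => rfl
  | _, _, _, _, _, _, _, _, _, _, _, _, _, .cons Φ ψ N hP hQ hR => by
    simp only [CellGrid.lower, grid, cells, cells_lower F N]

end Hom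
end CellGraph


namespace CellGraph

theorem cast_cast {G : CellGraph.{u, v, w, x}} {A B C D : G.Obj} {f f' f'' : A ⟶ C}
    {g g' g'' : B ⟶ D} {P P' P'' : HPath G.Hor A B} {T T' T'' : HTarget G.Hor C D}
    (hf : f = f') (hg : g = g') (hP : P = P') (hT : T = T') (hf' : f' = f'') (hg' : g' = g'')
    (hP' : P' = P'') (hT' : T' = T'') (φ : G.Cell f g P T) :
    cast hf' hg' hP' hT' (cast hf hg hP hT φ) =
      cast (hf.trans hf') (hg.trans hg') (hP.trans hP') (hT.trans hT') φ := by
  subst hf hg hP hT hf' hg' hP' hT'; rfl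

theorem CellPath.cons_cast_cast {G : CellGraph.{u, v, w, x}} {A₀ A₁ A₂ C₀ C₁ C₂ : G.Obj}
    {f₀ : A₀ ⟶ C₀} {f₁ : A₁ ⟶ C₁} {f₂ : A₂ ⟶ C₂}
    {J J' : HPath G.Hor A₀ A₁} {K K' : HTarget G.Hor C₀ C₁}
    {P P₁ : HPath G.Hor A₁ A₂} {Q Q₁ : HPath G.Hor C₁ C₂}
    {P' P'' : HPath G.Hor A₀ A₂} {Q' Q'' : HPath G.Hor C₀ C₂}
    (φ : G.Cell f₀ f₁ J K) (Φ : CellPath G f₁ f₂ P Q) (hJ : J = J') (hK : K = K')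
    (hP : P = P₁) (hQ : Q = Q₁) (h₁ : P'' = J'.append P₁) (h₂ : Q'' = K'.path.append Q₁)
    (e₁ : P' = J.append P) (e₂ : Q' = K.path.append Q) (hP' : P' = P'') (hQ' : Q' = Q'') :
    CellPath.cons (CellGraph.cast rfl rfl hJ hK φ) (Φ.cast hP hQ) h₁ h₂ =
      (CellPath.cons φ Φ e₁ e₂).cast hP' hQ' := by
  subst hJ hK hP hQ hP' hQ'; rfl

/-- The composite of two such assignments. -/
def Hom.comp {G : CellGraph.{u, v, w, x}} {H : CellGraph.{u₁, v₁, w₁, x₁}}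
    {I : CellGraph.{u₂, v₂, w₂, x₂}} (F : Hom G H) (F' : Hom H I) : Hom G I where
  ver := F.ver ⋙ F'.ver
  hor J := F'.hor (F.hor J)
  cell φ := cast rfl rfl (HPath.map_map _ _ _ _ _) (HTarget.map_map _ _ _ _ _)
    (F'.cell (F.cell φ))

theorem Hom.comp_cells {G : CellGraph.{u, v, w, x}} {H : CellGraph.{u₁, v₁, w₁, x₁}}
    {I : CellGraph.{u₂, v₂, w₂, x₂}} (F : Hom G H) (F' : Hom H I) : ∀ {A B C D : G.Obj}
    {f : A ⟶ C} {g : B ⟶ D} {P : HPath G.Hor A B} {Q : HPath G.Hor C D} (Φ : CellPath G f g P Q),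
    (F.comp F').cells Φ = (F'.cells (F.cells Φ)).cast (HPath.map_map _ _ _ _ _)
      (HPath.map_map _ _ _ _ _)
  | _, _, _, _, _, _, _, _, .nil f => rfl
  | _, _, _, _, _, _, _, _, .cons φ Φ hP hQ => by
    simp only [Hom.cells, comp_cells F F' Φ]
    exact CellPath.cons_cast_cast _ _ _ _ _ _ _ _ _ _ _ _

/-- The identity assignment. -/
def Hom.id (G : CellGraph.{u, v, w, x}) : Hom G G where
  ver := 𝟭 G.Obj
  hor J := J
  cell φ := cast rfl rfl (HPath.map_id _).symm (HTarget.map_id _).symm φ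

theorem Hom.id_cells {G : CellGraph.{u, v, w, x}} : ∀ {A B C D : G.Obj}
    {f : A ⟶ C} {g : B ⟶ D} {P : HPath G.Hor A B} {Q : HPath G.Hor C D} (Φ : CellPath G f g P Q),
    (Hom.id G).cells Φ = Φ.cast (HPath.map_id _).symm (HPath.map_id _).symm
  | _, _, _, _, _, _, _, _, .nil f => rfl
  | _, _, _, _, _, _, _, _, .cons φ Φ hP hQ => by
    simp only [Hom.cells, id_cells Φ]
    exact CellPath.cons_cast_cast _ _ _ _ _ _ _ _ _ _ _ _

/-- The product of two `CellGraph`s; a cell is a pair of cells of the same arity. -/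
def prod (G : CellGraph.{u, v, w, x}) (H : CellGraph.{u₁, v₁, w₁, x₁}) :
    CellGraph.{max u u₁, max v v₁, max w w₁, max x x₁} where
  Obj := G.Obj × H.Obj
  Hor A B := G.Hor A.1 B.1 × H.Hor A.2 B.2
  Cell f g P T :=
    G.Cell ((CategoryTheory.Prod.fst G.Obj H.Obj).map f)
      ((CategoryTheory.Prod.fst G.Obj H.Obj).map g)
      (P.map Prod.fst Prod.fst) (T.map Prod.fst Prod.fst) ×
    H.Cell ((CategoryTheory.Prod.snd G.Obj H.Obj).map f)
      ((CategoryTheory.Prod.snd G.Obj H.Obj).map g)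
      (P.map Prod.snd Prod.snd) (T.map Prod.snd Prod.snd)

/-- The first projection. -/
def Hom.fst (G : CellGraph.{u, v, w, x}) (H : CellGraph.{u₁, v₁, w₁, x₁}) :
    Hom (G.prod H) G where
  ver := CategoryTheory.Prod.fst G.Obj H.Obj
  hor J := J.1
  cell φ := φ.1

/-- The second projection. -/
def Hom.snd (G : CellGraph.{u, v, w, x}) (H : CellGraph.{u₁, v₁, w₁, x₁}) :
    Hom (G.prod H) H where
  ver := CategoryTheory.Prod.snd G.Obj H.Obj
  hor J := J.2
  cell φ := φ.2

/-- The assignment into a product induced by its two components. -/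
def Hom.pair {G : CellGraph.{u, v, w, x}} {H : CellGraph.{u₁, v₁, w₁, x₁}}
    {I : CellGraph.{u₂, v₂, w₂, x₂}} (F : Hom G H) (F' : Hom G I) : Hom G (H.prod I) where
  ver := F.ver.prod' F'.ver
  hor J := (F.hor J, F'.hor J)
  cell φ := (cast rfl rfl (HPath.map_map _ _ _ _ _).symm (HTarget.map_map _ _ _ _ _).symm
    (F.cell φ), cast rfl rfl (HPath.map_map _ _ _ _ _).symm (HTarget.map_map _ _ _ _ _).symm
    (F'.cell φ))

theorem Hom.pair_cells_fst {G : CellGraph.{u, v, w, x}} {H : CellGraph.{u₁, v₁, w₁, x₁}}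
    {I : CellGraph.{u₂, v₂, w₂, x₂}} (F : Hom G H) (F' : Hom G I) : ∀ {A B C D : G.Obj}
    {f : A ⟶ C} {g : B ⟶ D} {P : HPath G.Hor A B} {Q : HPath G.Hor C D} (Φ : CellPath G f g P Q),
    (Hom.fst H I).cells ((F.pair F').cells Φ) = (F.cells Φ).cast
      (HPath.map_map _ _ _ _ _).symm (HPath.map_map _ _ _ _ _).symm
  | _, _, _, _, _, _, _, _, .nil f => rfl
  | _, _, _, _, _, _, _, _, .cons φ Φ hP hQ => by
    simp only [Hom.cells, pair_cells_fst F F' Φ]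
    exact CellPath.cons_cast_cast _ _ _ _ _ _ _ _ _ _ _ _

theorem Hom.pair_cells_snd {G : CellGraph.{u, v, w, x}} {H : CellGraph.{u₁, v₁, w₁, x₁}}
    {I : CellGraph.{u₂, v₂, w₂, x₂}} (F : Hom G H) (F' : Hom G I) : ∀ {A B C D : G.Obj}
    {f : A ⟶ C} {g : B ⟶ D} {P : HPath G.Hor A B} {Q : HPath G.Hor C D} (Φ : CellPath G f g P Q),
    (Hom.snd H I).cells ((F.pair F').cells Φ) = (F'.cells Φ).cast
      (HPath.map_map _ _ _ _ _).symm (HPath.map_map _ _ _ _ _).symm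
  | _, _, _, _, _, _, _, _, .nil f => rfl
  | _, _, _, _, _, _, _, _, .cons φ Φ hP hQ => by
    simp only [Hom.cells, pair_cells_snd F F' Φ]
    exact CellPath.cons_cast_cast _ _ _ _ _ _ _ _ _ _ _ _

end CellGraph

theorem AVDCData.comp_cast_cast {K : AVDCData.{u, v, w, x}} {A B C D E F : K.Obj} {f : A ⟶ C}
    {g : B ⟶ D} {h : C ⟶ E} {k : D ⟶ F} {l : A ⟶ E} {m : B ⟶ F} {P P' : HPath K.Hor A B}
    {Q Q' : HPath K.Hor C D} {T T' : HTarget K.Hor E F} (hP : P = P') (hQ : Q = Q') (hT : T = T')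
    (Φ : CellPath K.toCellGraph f g P Q) (χ : K.Cell h k Q T) (hl : f ≫ h = l) (hm : g ≫ k = m) :
    K.comp (Φ.cast hP hQ) (CellGraph.cast rfl rfl hQ hT χ) hl hm =
      CellGraph.cast rfl rfl hP hT (K.comp Φ χ hl hm) := by
  subst hP hQ hT; rfl

theorem AVDCData.comp_congr (K : AVDCData.{u, v, w, x}) {A B C D E F : K.Obj} {f : A ⟶ C}
    {g : B ⟶ D} {h : C ⟶ E} {k : D ⟶ F} {l : A ⟶ E} {m : B ⟶ F} {P : HPath K.Hor A B}
    {Q : HPath K.Hor C D} {T : HTarget K.Hor E F} {Φ Φ' : CellPath K.toCellGraph f g P Q}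
    (e : Φ = Φ') (χ : K.Cell h k Q T) (hl : f ≫ h = l) (hm : g ≫ k = m) :
    K.comp Φ χ hl hm = K.comp Φ' χ hl hm := by
  rw [e]

/-- Functors of augmented virtual double categories. -/
structure AVDCFunctor (K : AVDCData.{u, v, w, x}) (L : AVDCData.{u₁, v₁, w₁, x₁}) extends
    CellGraph.Hom K.toCellGraph L.toCellGraph where
  map_hid : ∀ {A B : K.Obj} (J : K.Hor A B), cell (K.hid J) =
    CellGraph.cast (ver.map_id A).symm (ver.map_id B).symm rfl rfl (L.hid (hor J))
  map_vid : ∀ {A C : K.Obj} (f : A ⟶ C), cell (K.vid f) = L.vid (ver.map f)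
  map_comp : ∀ {A B C D X Y : K.Obj} {f : A ⟶ C} {g : B ⟶ D} {h : C ⟶ X} {k : D ⟶ Y}
    {l : A ⟶ X} {m : B ⟶ Y} {P : HPath K.Hor A B} {Q : HPath K.Hor C D} {T : HTarget K.Hor X Y}
    (Φ : CellPath K.toCellGraph f g P Q) (ψ : K.Cell h k Q T) (hl : f ≫ h = l) (hm : g ≫ k = m),
    cell (K.comp Φ ψ hl hm) = L.comp (toHom.cells Φ) (cell ψ)
      (by rw [← hl, ver.map_comp]) (by rw [← hm, ver.map_comp])

namespace AVDCFunctor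

/-- The identity functor. -/
def id (K : AVDCData.{u, v, w, x}) : AVDCFunctor K K where
  toHom := .id _
  map_hid _ := rfl
  map_vid _ := rfl
  map_comp Φ ψ hl hm := by
    rw [Hom.id_cells]
    exact (AVDCData.comp_cast_cast _ _ _ _ _ _ _).symm

theorem cast_cell {G : CellGraph.{u, v, w, x}} {H : CellGraph.{u₁, v₁, w₁, x₁}} (F : Hom G H)
    {A B C D : G.Obj} {f f' : A ⟶ C} {g g' : B ⟶ D} {P P' : HPath G.Hor A B}
    {T T' : HTarget G.Hor C D} (hf : f = f') (hg : g = g') (hP : P = P') (hT : T = T')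
    (φ : G.Cell f g P T) : F.cell (CellGraph.cast hf hg hP hT φ) =
      CellGraph.cast (congrArg F.ver.map hf) (congrArg F.ver.map hg) (congrArg F.path hP)
        (congrArg F.target hT) (F.cell φ) := by
  subst hf hg hP hT; rfl

/-- Composition of functors. -/
def comp {K : AVDCData.{u, v, w, x}} {L : AVDCData.{u₁, v₁, w₁, x₁}}
    {M : AVDCData.{u₂, v₂, w₂, x₂}} (F : AVDCFunctor K L) (F' : AVDCFunctor L M) :
    AVDCFunctor K M where
  toHom := F.toHom.comp F'.toHom
  map_hid J := by
    simp only [Hom.comp, F.map_hid, cast_cell, F'.map_hid, CellGraph.cast_cast]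
  map_vid f := by
    simp only [Hom.comp, F.map_vid, F'.map_vid]; rfl
  map_comp Φ ψ hl hm := by
    rw [Hom.comp_cells]
    simp only [Hom.comp, F.map_comp, F'.map_comp]
    exact (AVDCData.comp_cast_cast _ _ _ _ _ _ _).symm

end AVDCFunctor

/-- The product of the data of two augmented virtual double categories. -/
def AVDCData.prod (K : AVDCData.{u, v, w, x}) (L : AVDCData.{u₁, v₁, w₁, x₁}) :
    AVDCData.{max u u₁, max v v₁, max w w₁, max x x₁} where
  toCellGraph := K.toCellGraph.prod L.toCellGraph
  comp Φ ψ hl hm :=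
    (K.comp ((Hom.fst _ _).cells Φ) ψ.1 (congrArg Prod.fst hl) (congrArg Prod.fst hm),
      L.comp ((Hom.snd _ _).cells Φ) ψ.2 (congrArg Prod.snd hl) (congrArg Prod.snd hm))
  hid J := (K.hid J.1, L.hid J.2)
  vid f := (K.vid f.1, L.vid f.2)

namespace AVDCFunctor

/-- The first projection. -/
def fst (K : AVDCData.{u, v, w, x}) (L : AVDCData.{u₁, v₁, w₁, x₁}) :
    AVDCFunctor (K.prod L) K where
  toHom := Hom.fst _ _
  map_hid _ := rfl
  map_vid _ := rfl
  map_comp _ _ _ _ := rfl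

/-- The second projection. -/
def snd (K : AVDCData.{u, v, w, x}) (L : AVDCData.{u₁, v₁, w₁, x₁}) :
    AVDCFunctor (K.prod L) L where
  toHom := Hom.snd _ _
  map_hid _ := rfl
  map_vid _ := rfl
  map_comp _ _ _ _ := rfl

theorem pair_cast {G : CellGraph.{u, v, w, x}} {H : CellGraph.{u₁, v₁, w₁, x₁}}
    {A B C D : (G.prod H).Obj} {f f' : A ⟶ C} {g g' : B ⟶ D} {P : HPath (G.prod H).Hor A B}
    {T : HTarget (G.prod H).Hor C D}
    (φ : G.Cell f.1 g.1 (P.map Prod.fst Prod.fst) (T.map Prod.fst Prod.fst))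
    (ψ : H.Cell f.2 g.2 (P.map Prod.snd Prod.snd) (T.map Prod.snd Prod.snd))
    (h₁ : f.1 = f'.1) (h₂ : f.2 = f'.2) (h₃ : g.1 = g'.1) (h₄ : g.2 = g'.2) :
    ((CellGraph.cast h₁ h₃ rfl rfl φ, CellGraph.cast h₂ h₄ rfl rfl ψ) :
      (G.prod H).Cell f' g' P T) =
      CellGraph.cast (G := G.prod H) (Prod.ext h₁ h₂) (Prod.ext h₃ h₄) rfl rfl (φ, ψ) := by
  have e : f = f' := Prod.ext h₁ h₂
  have e' : g = g' := Prod.ext h₃ h₄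
  subst e e'; rfl

/-- The functor into a product induced by its two components. -/
def pair {K : AVDCData.{u, v, w, x}} {L : AVDCData.{u₁, v₁, w₁, x₁}}
    {M : AVDCData.{u₂, v₂, w₂, x₂}} (F : AVDCFunctor K L) (F' : AVDCFunctor K M) :
    AVDCFunctor K (L.prod M) where
  toHom := F.toHom.pair F'.toHom
  map_hid {A B} J := by
    simp only [Hom.pair, F.map_hid, F'.map_hid, CellGraph.cast_cast]
    exact pair_cast (G := L.toCellGraph) (H := M.toCellGraph)
      (A := (F.ver.obj A, F'.ver.obj A)) (B := (F.ver.obj B, F'.ver.obj B))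
      (C := (F.ver.obj A, F'.ver.obj A)) (D := (F.ver.obj B, F'.ver.obj B))
      (f := (𝟙 (F.ver.obj A), 𝟙 (F'.ver.obj A))) (f' := (F.ver.map (𝟙 A), F'.ver.map (𝟙 A)))
      (g := (𝟙 (F.ver.obj B), 𝟙 (F'.ver.obj B))) (g' := (F.ver.map (𝟙 B), F'.ver.map (𝟙 B)))
      (P := .single (F.hor J, F'.hor J)) (T := .one (F.hor J, F'.hor J))
      (L.hid (F.hor J)) (M.hid (F'.hor J)) (F.ver.map_id A).symm (F'.ver.map_id A).symm
      (F.ver.map_id B).symm (F'.ver.map_id B).symm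
  map_vid f := by
    simp only [Hom.pair, F.map_vid, F'.map_vid]; rfl
  map_comp Φ ψ hl hm := by
    apply Prod.ext
    · simp only [AVDCData.prod, Hom.pair_cells_fst]
      simp only [Hom.pair, F.map_comp]
      exact (AVDCData.comp_cast_cast _ _ _ _ _ _ _).symm
    · simp only [AVDCData.prod, Hom.pair_cells_snd]
      simp only [Hom.pair, F'.map_comp]
      exact (AVDCData.comp_cast_cast _ _ _ _ _ _ _).symm

end AVDCFunctor

namespace AVDC

theorem prod_fst_composite {K : AVDCData.{u, v, w, x}} {L : AVDCData.{u₁, v₁, w₁, x₁}} :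
    ∀ {A B C D X Y : (K.prod L).Obj} {f : A ⟶ C} {f' : B ⟶ D}
    {g : C ⟶ X} {g' : D ⟶ Y} {P : HPath (K.prod L).Hor A B} {Q : HPath (K.prod L).Hor C D}
    {R : HPath (K.prod L).Hor X Y} (N : CellGrid (K.prod L).toCellGraph f f' g g' P Q R),
    (Hom.fst K.toCellGraph L.toCellGraph).cells (N.composite (K.prod L)) =
      ((Hom.fst K.toCellGraph L.toCellGraph).grid N).composite K
  | _, _, _, _, _, _, _, _, _, _, _, _, _, .nil f g => rfl
  | _, _, _, _, _, _, _, _, _, _, _, _, _, .cons Φ ψ N hP hQ hR => by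
    simp only [CellGrid.composite, Hom.cells, prod_fst_composite N]; rfl

theorem prod_snd_composite {K : AVDCData.{u, v, w, x}} {L : AVDCData.{u₁, v₁, w₁, x₁}} :
    ∀ {A B C D X Y : (K.prod L).Obj} {f : A ⟶ C} {f' : B ⟶ D}
    {g : C ⟶ X} {g' : D ⟶ Y} {P : HPath (K.prod L).Hor A B} {Q : HPath (K.prod L).Hor C D}
    {R : HPath (K.prod L).Hor X Y} (N : CellGrid (K.prod L).toCellGraph f f' g g' P Q R),
    (Hom.snd K.toCellGraph L.toCellGraph).cells (N.composite (K.prod L)) =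
      ((Hom.snd K.toCellGraph L.toCellGraph).grid N).composite L
  | _, _, _, _, _, _, _, _, _, _, _, _, _, .nil f g => rfl
  | _, _, _, _, _, _, _, _, _, _, _, _, _, .cons Φ ψ N hP hQ hR => by
    simp only [CellGrid.composite, Hom.cells, prod_snd_composite N]; rfl

theorem prod_fst_idPath {K : AVDCData.{u, v, w, x}} {L : AVDCData.{u₁, v₁, w₁, x₁}} :
    ∀ {A B : (K.prod L).Obj} (P : HPath (K.prod L).Hor A B),
    (Hom.fst K.toCellGraph L.toCellGraph).cells (CellPath.idPath (K.prod L) P) =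
      CellPath.idPath K ((Hom.fst K.toCellGraph L.toCellGraph).path P)
  | _, _, .nil _ => rfl
  | _, _, .cons J P => by simp only [CellPath.idPath, Hom.cells, prod_fst_idPath P]; rfl

theorem prod_snd_idPath {K : AVDCData.{u, v, w, x}} {L : AVDCData.{u₁, v₁, w₁, x₁}} :
    ∀ {A B : (K.prod L).Obj} (P : HPath (K.prod L).Hor A B),
    (Hom.snd K.toCellGraph L.toCellGraph).cells (CellPath.idPath (K.prod L) P) =
      CellPath.idPath L ((Hom.snd K.toCellGraph L.toCellGraph).path P)
  | _, _, .nil _ => rfl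
  | _, _, .cons J P => by simp only [CellPath.idPath, Hom.cells, prod_snd_idPath P]; rfl

/-- The product of augmented virtual double categories. -/
def prod (K : AVDC.{u, v, w, x}) (L : AVDC.{u₁, v₁, w₁, x₁}) :
    AVDC.{max u u₁, max v v₁, max w w₁, max x x₁} where
  toAVDCData := K.toAVDCData.prod L.toAVDCData
  assoc N χ hl hl' := Prod.ext
    ((K.comp_congr (prod_fst_composite N) χ.1 _ _).trans <| (K.assoc _ χ.1 _ _).trans <|
      (K.comp_congr (Hom.cells_upper (Hom.fst _ _) N).symm _ _ _).trans <|
      congrArg (fun ξ => K.comp _ ξ _ _)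
        (K.comp_congr (Hom.cells_lower (Hom.fst _ _) N).symm χ.1 rfl rfl))
    ((L.comp_congr (prod_snd_composite N) χ.2 _ _).trans <| (L.assoc _ χ.2 _ _).trans <|
      (L.comp_congr (Hom.cells_upper (Hom.snd _ _) N).symm _ _ _).trans <|
      congrArg (fun ξ => L.comp _ ξ _ _)
        (L.comp_congr (Hom.cells_lower (Hom.snd _ _) N).symm χ.2 rfl rfl))
  comp_hid φ := Prod.ext (K.comp_hid φ.1) (L.comp_hid φ.2)
  comp_vid φ := Prod.ext (K.comp_vid φ.1) (L.comp_vid φ.2)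
  idPath_comp φ := Prod.ext
    ((K.comp_congr (prod_fst_idPath _) φ.1 _ _).trans (K.idPath_comp φ.1))
    ((L.comp_congr (prod_snd_idPath _) φ.2 _ _).trans (L.idPath_comp φ.2))
  vid_comp_vid f g := Prod.ext (K.vid_comp_vid f.1 g.1) (L.vid_comp_vid f.2 g.2)
  comp_insert_vid Φ Ψ χ hl hm := Prod.ext
    (((K.comp_congr (Hom.cells_append (Hom.fst _ _) Φ _) χ.1 _ _).trans
      (comp_cast _ _ _ _ _ _)).trans <|
      (congrArg (CellGraph.cast (G := K.toCellGraph) rfl rfl _ rfl)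
        (K.comp_insert_vid _ _ _ _ _)).trans <|
      ((K.comp_congr (Hom.cells_append (Hom.fst _ _) Φ Ψ) χ.1 _ _).trans
        (comp_cast _ _ _ _ _ _)).symm)
    (((L.comp_congr (Hom.cells_append (Hom.snd _ _) Φ _) χ.2 _ _).trans
      (comp_cast _ _ _ _ _ _)).trans <|
      (congrArg (CellGraph.cast (G := L.toCellGraph) rfl rfl _ rfl)
        (L.comp_insert_vid _ _ _ _ _)).trans <|
      ((L.comp_congr (Hom.cells_append (Hom.snd _ _) Φ Ψ) χ.2 _ _).trans
        (comp_cast _ _ _ _ _ _)).symm)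

end AVDC

namespace AVDCData

variable (K : AVDCData.{u, v, w, x})

/-- A cell `ψ : J ⇒ K`, with horizontal source and target both of length at most one, is cartesian
if every cell `χ : H₁, …, Hₙ ⇒ K` with vertical source `h ≫ f` and vertical target `k ≫ g`
factors uniquely through `ψ`. -/
def IsCartesian {A B C D : K.Obj} {f : A ⟶ C} {g : B ⟶ D} (S : HTarget K.Hor A B)
    {T : HTarget K.Hor C D} (ψ : K.Cell f g S.path T) : Prop :=
  ∀ ⦃X Y : K.Obj⦄ (h : X ⟶ A) (k : Y ⟶ B) ⦃l : X ⟶ C⦄ ⦃m : Y ⟶ D⦄ (hl : h ≫ f = l)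
    (hm : k ≫ g = m) (H : HPath K.Hor X Y) (χ : K.Cell l m H T),
    ∃! φ : K.Cell h k H S, K.comp (.single φ) ψ hl hm = χ

/-- A horizontal unit of `A`: a horizontal morphism `A ⇸ A` with a nullary cartesian cell whose
vertical source and target are identities. -/
structure HUnit (A : K.Obj) where
  hor : K.Hor A A
  cell : K.Cell (𝟙 A) (𝟙 A) (.single hor) (.nul A)
  cart : K.IsCartesian (.one hor) cell

end AVDCData

namespace AVDC

theorem hcomp_cast_left {K : AVDC.{u, v, w, x}} {A B C X : K.Obj} {f : A ⟶ X} {g : B ⟶ X}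
    {h : C ⟶ X} {P P' : HPath K.Hor A B} {Q : HPath K.Hor B C} {R : HPath K.Hor A C}
    (φ : K.Cell f g P (.nul X)) (ψ : K.Cell g h Q (.nul X))
    (e : P = P') (hR' : R = P.append Q) (hR : R = P'.append Q) :
    K.hcomp (CellGraph.cast rfl rfl e rfl φ) ψ hR = K.hcomp φ ψ hR' := by
  subst e; rfl

theorem comp_cons_hcomp {K : AVDC.{u, v, w, x}} {A B C A' B' C' X : K.Obj} {f : A ⟶ A'}
    {g : B ⟶ B'} {h : C ⟶ C'} {f' : A' ⟶ X} {g' : B' ⟶ X} {h' : C' ⟶ X} {l : A ⟶ X} {m : B ⟶ X}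
    {n : C ⟶ X} {P : HPath K.Hor A B} {P' : HPath K.Hor B C} {T : HTarget K.Hor A' B'}
    {Q : HPath K.Hor B' C'} {R : HPath K.Hor A C} {S : HPath K.Hor A' C'}
    (φ : K.Cell f g P T) (Φ : CellPath K.toCellGraph g h P' Q)
    (ψ : K.Cell f' g' T.path (.nul X)) (ψ' : K.Cell g' h' Q (.nul X))
    (hl : f ≫ f' = l) (hm : g ≫ g' = m) (hn : h ≫ h' = n) (hR : R = P.append P')
    (hS : S = T.path.append Q) :
    K.comp (.cons φ Φ hR hS) (K.hcomp ψ ψ' hS) hl hn =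
      K.hcomp (K.comp (.single φ) ψ hl hm) (K.comp Φ ψ' hm hn) hR := by
  subst hS
  rw [← comp_hcomp (.single φ) Φ ψ ψ' hl hm hn hR]
  simp only [CellPath.append, CellPath.single, CellPath.cast_cons]

namespace HUnit

variable {K : AVDC.{u, v, w, x}} {L : AVDC.{u₁, v₁, w₁, x₁}} {X : K.Obj}
  (U : AVDCData.HUnit K.toAVDCData X)

/-- the path `(I_X, …, I_X)` -/
abbrev unitPath {A B : L.Obj} (P : HPath L.Hor A B) : HPath K.Hor X X :=
  P.map (fun _ => X) (fun _ => U.hor)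

/-- The horizontal composite of copies of the cartesian cell of a horizontal unit. -/
def collapse : ∀ {A B : L.Obj} (P : HPath L.Hor A B),
    K.Cell (𝟙 X) (𝟙 X) (unitPath U P) (.nul X)
  | _, _, .nil _ => K.vid (𝟙 X)
  | _, _, .cons _ P => K.hcomp U.cell (collapse P) rfl

theorem collapse_append : ∀ {A B C : L.Obj} (P : HPath L.Hor A B) (Q : HPath L.Hor B C),
    collapse U (P.append Q) = K.hcomp (collapse U P) (collapse U Q) (HPath.map_append _ _ P Q)
  | _, _, _, .nil _, Q => (vid_hcomp _).symm
  | _, _, _, .cons J P, Q => by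
    have h := collapse_append P Q
    simp only [HPath.append, collapse, h]
    exact (hcomp_assoc _ _ _ _ _ _ _).symm

/-- The cell `collapse` of a path of length at most one. -/
def collapseTarget {C D : L.Obj} (T : HTarget L.Hor C D) :
    K.Cell (𝟙 X) (𝟙 X) (T.map (fun _ => X) (fun _ => U.hor)).path (.nul X) :=
  CellGraph.cast rfl rfl (HTarget.path_map _ _ T).symm rfl (collapse U T.path)

theorem exists_constCell {A B C D : L.Obj} (P : HPath L.Hor A B) (T : HTarget L.Hor C D) :
    ∃! χ : K.Cell (𝟙 X) (𝟙 X) (unitPath U P) (T.map (fun _ => X) (fun _ => U.hor)),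
      K.comp (.single χ) (collapseTarget U T) (Category.comp_id _) (Category.comp_id _) = collapse U P := by
  cases T with
  | nul C =>
    exact ⟨collapse U P, K.comp_vid _, fun y hy => (K.comp_vid y).symm.trans hy⟩
  | one J =>
    have h := U.cart (𝟙 X) (𝟙 X) (Category.comp_id _) (Category.comp_id _) (unitPath U P)
      (collapse U P)
    have e : collapseTarget U (HTarget.one J) = U.cell := hcomp_vid U.cell
    rw [e]
    exact h

/-- The cells `(I_X, …, I_X) ⇒ I_X` and `(I_X, …, I_X) ⇒ X` induced by a horizontal unit. -/
noncomputable def constCell {A B C D : L.Obj} (P : HPath L.Hor A B) (T : HTarget L.Hor C D) :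
    K.Cell (𝟙 X) (𝟙 X) (unitPath U P) (T.map (fun _ => X) (fun _ => U.hor)) :=
  (exists_constCell U P T).choose

theorem constCell_spec {A B C D : L.Obj} (P : HPath L.Hor A B) (T : HTarget L.Hor C D) :
    K.comp (.single (constCell U P T)) (collapseTarget U T) (Category.comp_id _) (Category.comp_id _) = collapse U P :=
  (exists_constCell U P T).choose_spec.1

theorem constCell_unique {A B C D : L.Obj} (P : HPath L.Hor A B) (T : HTarget L.Hor C D)
    (χ : K.Cell (𝟙 X) (𝟙 X) (unitPath U P) (T.map (fun _ => X) (fun _ => U.hor)))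
    (h : K.comp (.single χ) (collapseTarget U T) (Category.comp_id _) (Category.comp_id _) = collapse U P) :
    χ = constCell U P T :=
  (exists_constCell U P T).unique h (constCell_spec U P T)

/-- The constant assignment at an object with a horizontal unit. -/
noncomputable def constHom : CellGraph.Hom L.toCellGraph K.toCellGraph where
  ver := (CategoryTheory.Functor.const L.Obj).obj X
  hor _ := U.hor
  cell {_ _ _ _ _ _ P T} _ := constCell U P T

theorem collapse_comp : ∀ {A B C D : L.Obj} {f : A ⟶ C} {g : B ⟶ D} {P : HPath L.Hor A B}
    {Q : HPath L.Hor C D} (Φ : CellPath L.toCellGraph f g P Q),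
    K.comp ((constHom U).cells Φ) (collapse U Q) (Category.comp_id _) (Category.comp_id _) =
      collapse U P
  | _, _, _, _, _, _, _, _, .nil f => K.idPath_comp (K.vid (𝟙 X))
  | _, _, _, _, _, _, _, _, .cons (K := T) (J := J) (P := P) (Q := Q) φ Φ hP hQ => by
    subst hP hQ
    have e₁ : unitPath U (J.append P) = (unitPath U J).append (unitPath U P) :=
      HPath.map_append _ _ J P
    have e₂ : unitPath U (T.path.append Q) =
        (T.map (fun _ => X) (fun _ => U.hor)).path.append (unitPath U Q) := by
      rw [HTarget.path_map]; exact HPath.map_append _ _ _ Q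
    have h₁ := comp_cons_hcomp (constCell U J T) ((constHom U).cells Φ)
      (collapseTarget U T)
      (collapse U Q) (Category.comp_id _) (Category.comp_id _) (Category.comp_id _)
      e₁ e₂
    have h₂ : collapse U (T.path.append Q) = K.hcomp (collapseTarget U T) (collapse U Q) e₂ := by
      refine (collapse_append U T.path Q).trans (Eq.symm ?_)
      exact hcomp_cast_left (K := K) (collapse U T.path) (collapse U Q)
        (HTarget.path_map _ _ T).symm (HPath.map_append _ _ T.path Q) e₂
    refine (congrArg (fun ξ => K.comp (CellPath.cons (constCell U J T) ((constHom U).cells Φ) e₁ e₂)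
      ξ (Category.comp_id _) (Category.comp_id _)) h₂).trans (h₁.trans ?_)
    exact (congrArg₂ (fun a b => K.hcomp a b e₁) (constCell_spec U J T) (collapse_comp Φ)).trans
      (collapse_append U J P).symm

/-- The constant functor. -/
noncomputable def const : AVDCFunctor L.toAVDCData K.toAVDCData where
  toHom := constHom U
  map_hid J := (constCell_unique U (.single J) (.one J) _ (K.idPath_comp _)).symm
  map_vid f := (constCell_unique U _ (.nul _) _ (K.comp_vid _)).symm
  map_comp {_ _ _ _ _ _ _ _ _ _ _ _ P Q T} Φ ψ hl hm := by
    refine (constCell_unique U P T _ ?_).symm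
    refine (comp_comp _ _ _ (Category.comp_id _) (Category.comp_id _) (Category.comp_id _)
      (Category.comp_id _) (Category.comp_id _) (Category.comp_id _) (Category.comp_id _)
      (Category.comp_id _)).trans ?_
    refine (congrArg (fun ξ => K.comp _ ξ (Category.comp_id _) (Category.comp_id _))
      (constCell_spec U Q T)).trans ?_
    exact collapse_comp U Φ

end HUnit
end AVDC

namespace AVDCTrans

variable {K : AVDCData.{u, v, w, x}} {L : AVDCData.{u₁, v₁, w₁, x₁}} {F G : AVDCFunctor K L}
  (t : F.ver ⟶ G.ver) (c : ∀ {A B : K.Obj} (J : K.Hor A B),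
    L.Cell (t.app A) (t.app B) (.single (F.hor J)) (.one (G.hor J)))

/-- The path of components at a path of horizontal morphisms. -/
def pathCells : ∀ {A B : K.Obj} (P : HPath K.Hor A B),
    CellPath L.toCellGraph (t.app A) (t.app B) (F.path P) (G.path P)
  | _, _, .nil A => .nil (t.app A)
  | _, _, .cons J P => .cons (c J) (pathCells P) rfl rfl

/-- The component at a path of length at most one. -/
def targetCell : ∀ {A B : K.Obj} (T : HTarget K.Hor A B),
    L.Cell (t.app A) (t.app B) (F.target T).path (G.target T)
  | _, _, .nul A => L.vid (t.app A)
  | _, _, .one J => c J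

end AVDCTrans

/-- Transformations `F ⇒ G` of functors of augmented virtual double categories. -/
structure AVDCTrans {K : AVDCData.{u, v, w, x}} {L : AVDCData.{u₁, v₁, w₁, x₁}}
    (F G : AVDCFunctor K L) where
  ver : F.ver ⟶ G.ver
  cell : ∀ {A B : K.Obj} (J : K.Hor A B),
    L.Cell (ver.app A) (ver.app B) (.single (F.hor J)) (.one (G.hor J))
  naturality : ∀ {A B C D : K.Obj} {f : A ⟶ C} {g : B ⟶ D} {P : HPath K.Hor A B}
    {T : HTarget K.Hor C D} (φ : K.Cell f g P T),
    L.comp (AVDCTrans.pathCells ver cell P) (G.cell φ) (ver.naturality f).symm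
      (ver.naturality g).symm = L.comp (.single (F.cell φ)) (AVDCTrans.targetCell ver cell T) rfl rfl

/-- Invertible transformations. -/
structure AVDCIso {K : AVDCData.{u, v, w, x}} {L : AVDCData.{u₁, v₁, w₁, x₁}}
    (F G : AVDCFunctor K L) where
  hom : AVDCTrans F G
  inv : AVDCTrans G F
  hom_inv : ∀ A : K.Obj, hom.ver.app A ≫ inv.ver.app A = 𝟙 (F.ver.obj A)
  inv_hom : ∀ A : K.Obj, inv.ver.app A ≫ hom.ver.app A = 𝟙 (G.ver.obj A)
  hom_inv_cell : ∀ {A B : K.Obj} (J : K.Hor A B),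
    L.comp (.single (hom.cell J)) (inv.cell J) (hom_inv A) (hom_inv B) = L.hid (F.hor J)
  inv_hom_cell : ∀ {A B : K.Obj} (J : K.Hor A B),
    L.comp (.single (inv.cell J)) (hom.cell J) (inv_hom A) (inv_hom B) = L.hid (G.hor J)

namespace AVDC

variable (K : AVDC.{u, v, w, x})

/-- For `t` a functor `K × K ⟶ K`, written `⊗`, the functor `(A, B, C) ↦ (A ⊗ B) ⊗ C`. -/
def tensorLeftNested (t : AVDCFunctor (K.prod K).toAVDCData K.toAVDCData) :
    AVDCFunctor ((K.prod K).prod K).toAVDCData K.toAVDCData :=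
  (((AVDCFunctor.fst (K.prod K).toAVDCData K.toAVDCData).comp t).pair
    (AVDCFunctor.snd (K.prod K).toAVDCData K.toAVDCData)).comp t

/-- The functor `(A, B, C) ↦ A ⊗ (B ⊗ C)`. -/
def tensorRightNested (t : AVDCFunctor (K.prod K).toAVDCData K.toAVDCData) :
    AVDCFunctor ((K.prod K).prod K).toAVDCData K.toAVDCData :=
  (((AVDCFunctor.fst (K.prod K).toAVDCData K.toAVDCData).comp
      (AVDCFunctor.fst K.toAVDCData K.toAVDCData)).pair
    ((((AVDCFunctor.fst (K.prod K).toAVDCData K.toAVDCData).comp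
      (AVDCFunctor.snd K.toAVDCData K.toAVDCData)).pair
        (AVDCFunctor.snd (K.prod K).toAVDCData K.toAVDCData)).comp t)).comp t

variable {K} in
/-- The functor `X ⊗ –`, on horizontal morphisms given by `J ↦ I_X ⊗ J`. -/
noncomputable def tensorObjLeft (t : AVDCFunctor (K.prod K).toAVDCData K.toAVDCData) {X : K.Obj}
    (U : AVDCData.HUnit K.toAVDCData X) : AVDCFunctor K.toAVDCData K.toAVDCData :=
  ((HUnit.const U).pair (.id K.toAVDCData)).comp t

variable {K} in
/-- The functor `– ⊗ X`, on horizontal morphisms given by `J ↦ J ⊗ I_X`. -/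
noncomputable def tensorObjRight (t : AVDCFunctor (K.prod K).toAVDCData K.toAVDCData) {X : K.Obj}
    (U : AVDCData.HUnit K.toAVDCData X) : AVDCFunctor K.toAVDCData K.toAVDCData :=
  ((AVDCFunctor.id K.toAVDCData).pair (HUnit.const U)).comp t

variable {K} in
/-- `f ⊗ f'` for vertical morphisms -/
def tensorHom (t : AVDCFunctor (K.prod K).toAVDCData K.toAVDCData) {A A' B B' : K.Obj}
    (f : A ⟶ B) (f' : A' ⟶ B') : t.ver.obj (A, A') ⟶ t.ver.obj (B, B') :=
  t.ver.map (X := (A, A')) (Y := (B, B')) (f, f')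

variable {K} in
/-- `φ ⊗ φ'` for `(1,1)`-ary cells -/
def tensorCell (t : AVDCFunctor (K.prod K).toAVDCData K.toAVDCData)
    {A B C D A' B' C' D' : K.Obj} {f : A ⟶ C} {g : B ⟶ D} {f' : A' ⟶ C'} {g' : B' ⟶ D'}
    {J : K.Hor A B} {L : K.Hor C D} {J' : K.Hor A' B'} {L' : K.Hor C' D'}
    (φ : K.Cell f g (.single J) (.one L)) (φ' : K.Cell f' g' (.single J') (.one L')) :
    K.Cell (tensorHom t f f') (tensorHom t g g') (.single (t.hor (J, J')))
      (.one (t.hor (L, L'))) :=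
  t.cell (A := (A, A')) (B := (B, B')) (C := (C, C')) (D := (D, D')) (f := (f, f')) (g := (g, g'))
    (P := .single (J, J')) (T := .one (L, L')) (φ, φ')

/-- Monoidal structures on augmented virtual double categories: pseudomonoids in the 2-category of
augmented virtual double categories, functors and transformations. -/
structure Monoidal where
  tensor : AVDCFunctor (K.prod K).toAVDCData K.toAVDCData
  unit : K.Obj
  /-- the specified horizontal unit `I_I` of the monoidal unit `I` -/
  hunit : AVDCData.HUnit K.toAVDCData unit
  assoc : AVDCIso (K.tensorLeftNested tensor) (K.tensorRightNested tensor)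
  leftUnitor : AVDCIso (tensorObjLeft tensor hunit) (.id K.toAVDCData)
  rightUnitor : AVDCIso (tensorObjRight tensor hunit) (.id K.toAVDCData)
  /-- the pentagon identity on vertical morphisms -/
  pentagon : ∀ A B C D : K.Obj,
    tensorHom tensor (assoc.hom.ver.app ((A, B), C)) (𝟙 D) ≫
        assoc.hom.ver.app ((A, tensor.ver.obj (B, C)), D) ≫
        tensorHom tensor (𝟙 A) (assoc.hom.ver.app ((B, C), D)) =
      assoc.hom.ver.app ((tensor.ver.obj (A, B), C), D) ≫
        assoc.hom.ver.app ((A, B), tensor.ver.obj (C, D))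
  /-- the pentagon identity on cells -/
  pentagon_cell : ∀ {A B C D A' B' C' D' : K.Obj} (J₁ : K.Hor A A') (J₂ : K.Hor B B')
    (J₃ : K.Hor C C') (J₄ : K.Hor D D'),
    K.comp (.single (tensorCell tensor (assoc.hom.cell (A := ((A, B), C)) (B := ((A', B'), C'))
          ((J₁, J₂), J₃)) (K.hid J₄)))
        (K.comp (.single (assoc.hom.cell (A := ((A, tensor.ver.obj (B, C)), D))
            (B := ((A', tensor.ver.obj (B', C')), D')) ((J₁, tensor.hor (J₂, J₃)), J₄)))
          (tensorCell tensor (K.hid J₁) (assoc.hom.cell (A := ((B, C), D)) (B := ((B', C'), D'))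
            ((J₂, J₃), J₄))) rfl rfl) (pentagon A B C D) (pentagon A' B' C' D') =
      K.comp (.single (assoc.hom.cell (A := ((tensor.ver.obj (A, B), C), D))
          (B := ((tensor.ver.obj (A', B'), C'), D')) ((tensor.hor (J₁, J₂), J₃), J₄)))
        (assoc.hom.cell (A := ((A, B), tensor.ver.obj (C, D)))
          (B := ((A', B'), tensor.ver.obj (C', D'))) ((J₁, J₂), tensor.hor (J₃, J₄))) rfl rfl
  /-- the triangle identity on vertical morphisms -/
  triangle : ∀ A B : K.Obj,
    assoc.hom.ver.app ((A, unit), B) ≫ tensorHom tensor (𝟙 A) (leftUnitor.hom.ver.app B) =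
      tensorHom tensor (rightUnitor.hom.ver.app A) (𝟙 B)
  /-- the triangle identity on cells -/
  triangle_cell : ∀ {A B A' B' : K.Obj} (J₁ : K.Hor A A') (J₂ : K.Hor B B'),
    K.comp (.single (assoc.hom.cell (A := ((A, unit), B)) (B := ((A', unit), B'))
        ((J₁, hunit.hor), J₂))) (tensorCell tensor (K.hid J₁) (leftUnitor.hom.cell J₂))
        (triangle A B) (triangle A' B') =
      tensorCell tensor (rightUnitor.hom.cell J₁) (K.hid J₂)

end AVDC

/-- The objects of the category `F / X`: pairs of an object `A` and a vertical morphism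
`F A ⟶ X`. -/
structure AVDCSlice {K : AVDC.{u, v, w, x}} {L : AVDC.{u₁, v₁, w₁, x₁}}
    (F : AVDCFunctor K.toAVDCData L.toAVDCData) (X : L.Obj) where
  obj : K.Obj
  mor : F.ver.obj obj ⟶ X

namespace AVDCSlice

variable {K : AVDC.{u, v, w, x}} {L : AVDC.{u₁, v₁, w₁, x₁}}
  {F : AVDCFunctor K.toAVDCData L.toAVDCData} {X : L.Obj}

/-- The morphisms of `F / X`: pairs of a path `H : A ⇸ C` and a nullary cell `F H ⇒ X`. -/
structure Hom (a b : AVDCSlice F X) where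
  path : HPath K.Hor a.obj b.obj
  cell : L.Cell a.mor b.mor (F.path path) (.nul X)

theorem Hom.ext_cast {a b : AVDCSlice F X} {m n : Hom a b} (h : m.path = n.path)
    (hc : CellGraph.cast rfl rfl (congrArg F.path h) rfl m.cell = n.cell) : m = n := by
  obtain ⟨P, c⟩ := m
  obtain ⟨Q, d⟩ := n
  obtain rfl : P = Q := h
  obtain rfl : c = d := hc
  rfl

/-- Composition in `F / X` is horizontal composition. -/
instance : Category (AVDCSlice F X) where
  Hom := Hom
  id a := ⟨.nil a.obj, L.vid a.mor⟩
  comp m n := ⟨m.path.append n.path, L.hcomp m.cell n.cell (HPath.map_append _ _ _ _)⟩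
  id_comp m := Hom.ext_cast rfl (AVDC.vid_hcomp m.cell)
  comp_id m := Hom.ext_cast (HPath.append_nil m.path) (by
    refine (AVDC.hcomp_eq_cast m.cell _ _ _ _).symm.trans (AVDC.hcomp_vid m.cell))
  assoc m n p := Hom.ext_cast (HPath.append_assoc _ _ _) (by
    refine (AVDC.hcomp_eq_cast _ _ ((congrArg F.path (HPath.append_assoc m.path n.path
      p.path)).symm.trans (HPath.map_append _ _ _ _)) _ _).symm.trans
        (AVDC.hcomp_assoc _ _ _ _ _ _ _))

end AVDCSlice

namespace AVDC

theorem comp_vid_eq {L : AVDC.{u, v, w, x}} {A B X : L.Obj} {f : A ⟶ X} {g : B ⟶ X}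
    {l : A ⟶ X} {m : B ⟶ X} {P : HPath L.Hor A B} (Φ : CellPath L.toCellGraph f g P (.nil X))
    {e e' : X ⟶ X} (h : e = e') (hl : f ≫ e = l) (hm : g ≫ e = m) (hl' : f ≫ e' = l)
    (hm' : g ≫ e' = m) :
    L.comp Φ (L.vid e) hl hm = L.comp Φ (L.vid e') hl' hm' := by
  subst h; rfl

theorem map_hcomp {K : AVDC.{u, v, w, x}} {L : AVDC.{u₁, v₁, w₁, x₁}}
    (F : AVDCFunctor K.toAVDCData L.toAVDCData) {A B C X : K.Obj} {f : A ⟶ X} {g : B ⟶ X}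
    {h : C ⟶ X} {P : HPath K.Hor A B} {Q : HPath K.Hor B C} {R : HPath K.Hor A C}
    (φ : K.Cell f g P (.nul X)) (ψ : K.Cell g h Q (.nul X)) (hR : R = P.append Q)
    (hR' : F.path R = (F.path P).append (F.path Q)) :
    F.cell (K.hcomp φ ψ hR) = L.hcomp (F.cell φ) (F.cell ψ) hR' := by
  unfold hcomp
  rw [F.map_comp, F.map_vid]
  exact comp_vid_eq _ (F.ver.map_id X) _ _ _ _

theorem hcomp_cast {K : AVDC.{u, v, w, x}} {A B C X : K.Obj} {f : A ⟶ X} {g : B ⟶ X}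
    {h : C ⟶ X} {P P' : HPath K.Hor A B} {Q Q' : HPath K.Hor B C} {R R' : HPath K.Hor A C}
    (φ : K.Cell f g P (.nul X)) (ψ : K.Cell g h Q (.nul X)) (hP : P = P') (hQ : Q = Q')
    (hR : R = P.append Q) (hR' : R' = P'.append Q') (e : R = R') :
    CellGraph.cast rfl rfl e rfl (K.hcomp φ ψ hR) =
      K.hcomp (CellGraph.cast rfl rfl hP rfl φ) (CellGraph.cast rfl rfl hQ rfl ψ) hR' := by
  subst hP hQ e; rfl

/-- For `e : F C' ⟶ C`, the functor `e ∘ F – : K / C' ⥤ F / C`. -/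
def sliceFunctor {K : AVDC.{u, v, w, x}} {L : AVDC.{u₁, v₁, w₁, x₁}}
    (F : AVDCFunctor K.toAVDCData L.toAVDCData) {C' : K.Obj} {C : L.Obj}
    (e : F.ver.obj C' ⟶ C) :
    AVDCSlice (AVDCFunctor.id K.toAVDCData) C' ⥤ AVDCSlice F C where
  obj a := ⟨a.obj, F.ver.map a.mor ≫ e⟩
  map m := ⟨m.path, L.post (CellGraph.cast rfl rfl (congrArg F.path (HPath.map_id m.path)) rfl
    (F.cell m.cell)) e⟩
  map_id a := AVDCSlice.Hom.ext_cast rfl (by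
    refine (congrArg (fun c => L.post (P := .nil _) c e) (F.map_vid a.mor)).trans ?_
    exact L.vid_comp_vid _ _)
  map_comp m n := AVDCSlice.Hom.ext_cast rfl (by
    refine (congrArg (fun c => L.post c e) ((congrArg (CellGraph.cast rfl rfl _ rfl)
      (map_hcomp F m.cell n.cell _ ((congrArg F.path (HPath.map_append _ _ m.path n.path)).trans
        (HPath.map_append _ _ _ _)))).trans
      (hcomp_cast (F.cell m.cell) (F.cell n.cell) (congrArg F.path (HPath.map_id m.path))
        (congrArg F.path (HPath.map_id n.path)) _ (HPath.map_append _ _ _ _) _))).trans ?_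
    exact post_hcomp _ _ _ _)

end AVDC

namespace AVDC

variable (K : AVDC.{u, v, w, x})

/-- An object is unital if it has a horizontal unit. -/
def IsUnital (A : K.Obj) : Prop := Nonempty (AVDCData.HUnit K.toAVDCData A)

/-- A companion of `f : A ⟶ B`: a horizontal morphism `f_* : A ⇸ B` with a nullary cartesian cell
`f_* ⇒ B` with vertical source `f` and vertical target the identity. -/
structure Companion {A B : K.Obj} (f : A ⟶ B) where
  hor : K.Hor A B
  cell : K.Cell f (𝟙 B) (.single hor) (.nul B)
  cart : K.IsCartesian (.one hor) cell

/-- All unary restrictions `H(id, g)` exist. -/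
def HasRightRestrictions : Prop :=
  ∀ ⦃A B D : K.Obj⦄ (H : K.Hor A D) (g : B ⟶ D), ∃ (J : K.Hor A B)
    (ψ : K.Cell (𝟙 A) g (.single J) (.one H)), K.IsCartesian (.one J) ψ

variable {K} in
/-- The functor `F` preserves unary restrictions on the right. -/
def PreservesRightRestrictions {L : AVDC.{u₁, v₁, w₁, x₁}}
    (F : AVDCFunctor K.toAVDCData L.toAVDCData) : Prop :=
  ∀ ⦃A B D : K.Obj⦄ (H : K.Hor A D) (g : B ⟶ D) (J : K.Hor A B)
    (ψ : K.Cell (𝟙 A) g (.single J) (.one H)), K.IsCartesian (.one J) ψ →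
      L.IsCartesian (.one (F.hor J)) (F.cell ψ)

/-- The nullary cell `η` defines `l` as the left Kan extension of `d` along `J`. -/
def IsLeftKan {A B M : K.Obj} {d : A ⟶ M} {l : B ⟶ M} {J : K.Hor A B}
    (η : K.Cell d l (.single J) (.nul M)) : Prop :=
  ∀ ⦃C : K.Obj⦄ (k : C ⟶ M) (H : HPath K.Hor B C) (φ : K.Cell d k (.cons J H) (.nul M)),
    ∃! φ' : K.Cell l k H (.nul M), K.hcomp η φ' rfl = φ

/-- A vertical morphism `f : A ⟶ M` is dense if all nullary cartesian cells `J ⇒ M` with vertical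
source `f` are left Kan. -/
def IsDense {A M : K.Obj} (f : A ⟶ M) : Prop :=
  ∀ ⦃B : K.Obj⦄ (l : B ⟶ M) (J : K.Hor A B) (η : K.Cell f l (.single J) (.nul M)),
    K.IsCartesian (.one J) η → K.IsLeftKan η

/-- A vertical morphism is full and faithful if its identity cell is cartesian. -/
def IsFullyFaithful {A M : K.Obj} (f : A ⟶ M) : Prop :=
  K.IsCartesian (.nul A) (K.vid f)

/-- Yoneda embeddings: dense, full and faithful morphisms satisfying the Yoneda axiom. -/
structure IsYonedaEmbedding {A P : K.Obj} (y : A ⟶ P) : Prop where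
  dense : K.IsDense y
  yoneda : ∀ ⦃B : K.Obj⦄ (J : K.Hor A B), ∃ (l : B ⟶ P) (c : K.Cell y l (.single J) (.nul P)),
    K.IsCartesian (.one J) c
  fullyFaithful : K.IsFullyFaithful y

variable {K} in
/-- A path of cells is weakly cocartesian if every (nullary or unary) cell whose vertical source
and target factor accordingly factors uniquely through it. -/
def IsWeaklyCocartesian {A B C D : K.Obj} {f : A ⟶ C} {g : B ⟶ D} {P : HPath K.Hor A B}
    {Q : HPath K.Hor C D} (Φ : CellPath K.toCellGraph f g P Q) : Prop :=
  ∀ ⦃X Y : K.Obj⦄ (h : C ⟶ X) (k : D ⟶ Y) ⦃l : A ⟶ X⦄ ⦃m : B ⟶ Y⦄ (hl : f ≫ h = l)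
    (hm : g ≫ k = m) (T : HTarget K.Hor X Y) (χ : K.Cell l m P T),
    ∃! χ' : K.Cell h k Q T, K.comp Φ χ' hl hm = χ

variable {K} in
/-- A path `Φ` of cells is right cocartesian if it is weakly cocartesian and so are its
concatenations `(Φ, cart, id, …, id)` where `cart` defines a restriction `H(g, id)`. -/
def IsRightCocartesian {A B C D : K.Obj} {f : A ⟶ C} {g : B ⟶ D} {P : HPath K.Hor A B}
    {Q : HPath K.Hor C D} (Φ : CellPath K.toCellGraph f g P Q) : Prop :=
  IsWeaklyCocartesian Φ ∧
  ∀ ⦃Y Z : K.Obj⦄ (H : K.Hor D Y) (H' : K.Hor B Y)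
    (c : K.Cell g (𝟙 Y) (.single H') (.one H)), K.IsCartesian (.one H') c →
      ∀ R : HPath K.Hor Y Z,
        IsWeaklyCocartesian (Φ.append (.cons c (CellPath.idPath K.toAVDCData R) rfl rfl))

variable {K} in
/-- A horizontal cell `φ : (P, H) ⇒ J`, where `H` is a single horizontal morphism, is pointwise
right cocartesian if it is right cocartesian and, for every `g` such that the restriction
`H(id, g)` exists, the restriction `J(id, g)` exists too and the induced cell
`(P, H(id, g)) ⇒ J(id, g)` is right cocartesian. -/
def IsPointwiseRightCocartesian {A B C : K.Obj} {P : HPath K.Hor A B} {H : K.Hor B C}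
    {J : K.Hor A C} (φ : K.Cell (𝟙 A) (𝟙 C) (P.append (.single H)) (.one J)) : Prop :=
  IsRightCocartesian (.single φ) ∧
  ∀ ⦃Y : K.Obj⦄ (g : Y ⟶ C) (H' : K.Hor B Y) (c : K.Cell (𝟙 B) g (.single H') (.one H)),
    K.IsCartesian (.one H') c →
      (∃ (J' : K.Hor A Y) (d : K.Cell (𝟙 A) g (.single J') (.one J)), K.IsCartesian (.one J') d) ∧
      ∀ (J' : K.Hor A Y) (d : K.Cell (𝟙 A) g (.single J') (.one J)), K.IsCartesian (.one J') d →
        ∀ φ' : K.Cell (𝟙 A) (𝟙 Y) (P.append (.single H')) (.one J'),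
          K.comp (.single φ') d (Category.comp_id _) (Category.id_comp _) =
            K.comp ((CellPath.idPath K.toAVDCData P).append (.single c)) φ (Category.comp_id _)
              (Category.comp_id _) →
          IsRightCocartesian (.single φ')

variable {K}

/-- Weak horizontal (right) duals `A°` of an object `A`, with copairing `ι : I ⇸ A° ⊗ A` and, for
every `J : A ⇸ B`, a chosen adjunct `J♭ = ι ⊙ (A° ⊗ J) : I ⇸ A° ⊗ B`. -/
structure WeakHorizontalDual (M : K.Monoidal) (A : K.Obj) where
  dual : K.Obj
  hunit : AVDCData.HUnit K.toAVDCData dual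
  copairing : K.Hor M.unit ((tensorObjLeft M.tensor hunit).ver.obj A)
  adjunct : ∀ {B : K.Obj}, K.Hor A B → K.Hor M.unit ((tensorObjLeft M.tensor hunit).ver.obj B)
  /-- the cell defining the adjunct as a pointwise right composite -/
  cocart : ∀ {B : K.Obj} (J : K.Hor A B), K.Cell (𝟙 _) (𝟙 _)
    ((HPath.single copairing).append (.single ((tensorObjLeft M.tensor hunit).hor J)))
    (.one (adjunct J))
  pointwise : ∀ {B : K.Obj} (J : K.Hor A B), IsPointwiseRightCocartesian (cocart J)
  /-- the assignment `φ ↦ cocart ∘ (id_ι, A° ⊗ φ)` is bijective -/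
  bijective : ∀ {B : K.Obj} (H : HPath K.Hor A B) (J : K.Hor A B), Function.Bijective
    fun φ : K.Cell (𝟙 A) (𝟙 B) H (.one J) =>
      (K.comp (.cons (K.hid copairing) (.single (CellGraph.cast
            ((tensorObjLeft M.tensor hunit).ver.map_id A)
            ((tensorObjLeft M.tensor hunit).ver.map_id B) rfl rfl
            ((tensorObjLeft M.tensor hunit).cell φ))) rfl rfl) (cocart J)
          (Category.comp_id _) (Category.comp_id _) :
        K.Cell (𝟙 _) (𝟙 _) (.cons copairing ((tensorObjLeft M.tensor hunit).path H))
          (.one (adjunct J)))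

/-- Isomorphism of vertical morphisms, through an invertible vertical cell. -/
def VertIso {A C : K.Obj} (f g : A ⟶ C) : Prop :=
  ∃ (α : K.Cell f g (.nil A) (.nul C)) (β : K.Cell g f (.nil A) (.nul C)),
    K.hcomp α β rfl = K.vid f ∧ K.hcomp β α rfl = K.vid g

/-- Equivalence of objects in the 2-category of objects, vertical morphisms and vertical cells. -/
def VertEquiv (A B : K.Obj) : Prop :=
  ∃ (e : A ⟶ B) (e' : B ⟶ A), VertIso (e ≫ e') (𝟙 A) ∧ VertIso (e' ≫ e) (𝟙 B)

/-- The morphism `e : F C' ⟶ C` is universal from `F` to `C` relative to the full subcategory of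
`F / C` of the objects satisfying `S`. -/
def IsUniversalRelative {L : AVDC.{u₁, v₁, w₁, x₁}}
    (F : AVDCFunctor K.toAVDCData L.toAVDCData) {C' : K.Obj} {C : L.Obj}
    (S : ObjectProperty (AVDCSlice F C)) (e : F.ver.obj C' ⟶ C) : Prop :=
  ((sliceFunctor F e).Full ∧ (sliceFunctor F e).Faithful) ∧
  ∃ h : ∀ a, S ((sliceFunctor F e).obj a), (S.lift (sliceFunctor F e) h).IsEquivalence

namespace WeakHorizontalDual

variable {M : K.Monoidal} {A : K.Obj} (D : WeakHorizontalDual M A)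

/-- The functor `A° ⊗ –`. -/
noncomputable abbrev functor : AVDCFunctor K.toAVDCData K.toAVDCData :=
  tensorObjLeft M.tensor D.hunit

/-- For `y : I ⟶ PI`, a morphism `f : A° ⊗ B ⟶ PI` is `ι`-small if it is isomorphic to a morphism
`l` for which there is a cartesian cell `J♭ ⇒ PI` with vertical source `y` and vertical target `l`,
for some `J : A ⇸ B`. -/
def IsSmall {PI : K.Obj} (y : M.unit ⟶ PI) {B : K.Obj} (f : D.functor.ver.obj B ⟶ PI) : Prop :=
  ∃ (J : K.Hor A B) (l : D.functor.ver.obj B ⟶ PI)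
    (c : K.Cell y l (.single (D.adjunct J)) (.nul PI)),
    K.IsCartesian (.one (D.adjunct J)) c ∧ VertIso f l

/-- The morphism `ev : A° ⊗ P ⟶ PI` defines `P` as the internal `ι`-small hom `[A°, PI]`. -/
def IsInternalHom {PI : K.Obj} (y : M.unit ⟶ PI) {P : K.Obj}
    (ev : D.functor.ver.obj P ⟶ PI) : Prop :=
  IsUniversalRelative D.functor (fun a => D.IsSmall y a.mor) ev

end WeakHorizontalDual

end AVDC

/-! Write `F` for `A° ⊗ –`, `X` for `PI` and `J♭` for `ι ⊙ F J`. The defining bijection of the dual,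
combined with restrictions on the right and their preservation by `F`, says that a nullary cartesian
cell `J♭ ⇒ X` makes cells `H ⇒ J` with vertical source the identity and vertical target any `g` the
same as nullary cells `(ι, F H) ⇒ X` with the corresponding boundary
(`existsUnique_whisker_unfold`). Take `J = yA_*`, represented by a cell `χ : (yA_*)♭ ⇒ X` with
target `ev`. Cells into `yA_*` are nullary cells into `P` with vertical source `yA`, so these too
correspond to cells `(ι, F H) ⇒ X`. The correspondence is `theta`, namely `φ ↦ ξ ⊙ (ev ∘ F φ)`,
where `ξ : ι ⇒ X` matches `χ` (`IsMatching`); for one direction `ξ` is obtained from `χ` through the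
unit of the companion (`exists_isMatching`).

Under this correspondence each condition on `yA` becomes one on `ev` or `ξ`.

Density against full faithfulness of `ev ∘ F –`: for `η : J' ⇒ P` cartesian with boundary `yA`, `f`,
the maps `η ⊙ –` and `ev ∘ F –` are two sides of a commutative square. The other two sides are
`theta` and composition with a cell corresponding to a cartesian `J'♭ ⇒ X`, both bijective, the
latter because `y` is dense. Hence one of the first two maps is bijective exactly when the other is
(`IsMatching.bijective_hcomp_iff`).

The Yoneda axiom against essential surjectivity: if `J'` is the restriction of `P` along `yA` and
`f`, then `J'♭` is the restriction of `X` along `y` and `ev ∘ F f`; so every `J` is such a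
restriction exactly when every small morphism is isomorphic to some `ev ∘ F f`.

Full faithfulness of `yA` against cartesianness of `ξ`: `ι` is the adjunct of the horizontal unit of
`A`, and `theta` takes the cell from the unit to `P` induced by `yA` to the cell corresponding to
`ξ` (`exists_adjunct_unit`, `theta_unit`).

When starting from the internal hom, `χ` has to be found. The morphism `ev` is small, being the
image of an identity, so it represents some `J₀♭`; both `yA_*` and `J₀` represent the cells `(ι, F
H) ⇒ X` with target `ev`, hence they are isomorphic and `χ` is transported from `J₀♭`. Finally, a
Yoneda embedding with a companion always has an evaluation, by the Yoneda axiom of `y` at `(yA_*)♭`,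
and objects with the same universal property are equivalent. -/

namespace AVDC

/-! ### Calculus of cells and isomorphisms of vertical morphisms -/

section Cells

variable {K : AVDC.{u, v, w, x}}

theorem comp_cons_single_cast {A₀ A₁ A₂ C₀ C₁ C₂ X Y : K.Obj} {f₀ : A₀ ⟶ C₀} {f₁ : A₁ ⟶ C₁}
    {f₂ f₂' : A₂ ⟶ C₂} {h : C₀ ⟶ X} {k : C₂ ⟶ Y} {l : A₀ ⟶ X} {m : A₂ ⟶ Y}
    {P : HPath K.Hor A₀ A₁} {T : HTarget K.Hor C₀ C₁} {Q : HPath K.Hor A₁ A₂}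
    {T' : HTarget K.Hor C₁ C₂} {R : HPath K.Hor A₀ A₂} {S : HPath K.Hor C₀ C₂}
    {U : HTarget K.Hor X Y} (φ : K.Cell f₀ f₁ P T) (ψ : K.Cell f₁ f₂ Q T') (e : f₂ = f₂')
    (hR : R = P.append Q) (hS : S = T.path.append T'.path) (χ : K.Cell h k S U)
    (hl : f₀ ≫ h = l) (hm : f₂' ≫ k = m) (hm' : f₂ ≫ k = m) :
    K.comp (.cons φ (.single (CellGraph.cast rfl e rfl rfl ψ)) hR hS) χ hl hm =
      K.comp (.cons φ (.single ψ) hR hS) χ hl hm' := by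
  subst e; rfl

theorem comp_single_cast {A B C D X Y : K.Obj} {f f' : A ⟶ C} {g g' : B ⟶ D} {h : C ⟶ X}
    {k : D ⟶ Y} {l : A ⟶ X} {m : B ⟶ Y} {P : HPath K.Hor A B} {T : HTarget K.Hor C D}
    {U : HTarget K.Hor X Y} (φ : K.Cell f g P T) (e : f = f') (e' : g = g')
    (χ : K.Cell h k T.path U) (hl : f' ≫ h = l) (hm : g' ≫ k = m)
    (hl' : f ≫ h = l) (hm' : g ≫ k = m) :
    K.comp (.single (CellGraph.cast e e' rfl rfl φ)) χ hl hm = K.comp (.single φ) χ hl' hm' := by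
  subst e e'; rfl

theorem hid_comp {A B C D : K.Obj} {f : A ⟶ C} {g : B ⟶ D} {J : K.Hor A B}
    {T : HTarget K.Hor C D} (φ : K.Cell f g (.single J) T) :
    K.comp (.single (K.hid J)) φ (Category.id_comp f) (Category.id_comp g) = φ :=
  K.idPath_comp φ

theorem hcomp_comp_right {A B C C' X : K.Obj} {ι : K.Hor A B} {d : A ⟶ X} {e : B ⟶ X}
    {g : C ⟶ C'} {k : C' ⟶ X} {n : C ⟶ X} {P : HPath K.Hor B C} {Q : HPath K.Hor B C'}
    (ξ : K.Cell d e (.single ι) (.nul X)) (Φ : CellPath K.toCellGraph (𝟙 B) g P Q)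
    (ψ : K.Cell e k Q (.nul X)) (he : 𝟙 B ≫ e = e) (hk : g ≫ k = n) :
    K.hcomp ξ (K.comp Φ ψ he hk) rfl =
      K.comp (.cons (K.hid ι) Φ rfl rfl) (K.hcomp ξ ψ rfl) (Category.id_comp d) hk := by
  refine Eq.trans ?_ (comp_cons_hcomp (K.hid ι) Φ ξ ψ (Category.id_comp d) he hk rfl rfl).symm
  rw [hid_comp]

/-- Precomposition of a vertical cell with a vertical morphism. -/
def pre {A B X : K.Obj} (k : A ⟶ B) {l m : B ⟶ X} (α : K.Cell l m (.nil B) (.nul X)) :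
    K.Cell (k ≫ l) (k ≫ m) (.nil A) (.nul X) :=
  K.comp (.nil k) α rfl rfl

theorem pre_hcomp {A B X : K.Obj} (k : A ⟶ B) {l m n : B ⟶ X}
    (α : K.Cell l m (.nil B) (.nul X)) (β : K.Cell m n (.nil B) (.nul X)) :
    pre k (K.hcomp α β rfl) = K.hcomp (pre k α) (pre k β) rfl :=
  comp_hcomp (.nil k) (.nil k) α β rfl rfl rfl rfl

theorem pre_vid {A B X : K.Obj} (k : A ⟶ B) (l : B ⟶ X) :
    pre k (K.vid l) = K.vid (k ≫ l) :=
  (K.comp_insert_vid (.nil k) (.nil k) (K.vid l) rfl rfl).symm.trans (K.vid_comp_vid k l)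

theorem VertIso.refl {A X : K.Obj} (f : A ⟶ X) : VertIso f f :=
  ⟨K.vid f, K.vid f, vid_hcomp _, vid_hcomp _⟩

theorem VertIso.symm {A X : K.Obj} {f g : A ⟶ X} : VertIso f g → VertIso g f
  | ⟨α, β, h, h'⟩ => ⟨β, α, h', h⟩

theorem VertIso.trans {A X : K.Obj} {f g h : A ⟶ X} : VertIso f g → VertIso g h → VertIso f h
  | ⟨α, β, h₁, h₂⟩, ⟨α', β', h₁', h₂'⟩ => by
    refine ⟨K.hcomp α α' rfl, K.hcomp β' β rfl, ?_, ?_⟩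
    · rw [hcomp_assoc α α' _ rfl rfl rfl rfl, ← hcomp_assoc α' β' β rfl rfl rfl rfl, h₁',
        vid_hcomp, h₁]
    · rw [hcomp_assoc β' β _ rfl rfl rfl rfl, ← hcomp_assoc β α α' rfl rfl rfl rfl, h₂,
        vid_hcomp, h₂']

theorem VertIso.pre {A B X : K.Obj} (k : A ⟶ B) {f g : B ⟶ X} :
    VertIso f g → VertIso (k ≫ f) (k ≫ g)
  | ⟨α, β, h, h'⟩ => ⟨AVDC.pre k α, AVDC.pre k β,
      (pre_hcomp k α β).symm.trans ((congrArg _ h).trans (pre_vid k f)),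
      (pre_hcomp k β α).symm.trans ((congrArg _ h').trans (pre_vid k g))⟩

end Cells

/-! ### Cartesian, invertible and cocartesian cells -/

section Cartesian

variable {K : AVDC.{u, v, w, x}}

theorem isCartesian_comp {A B C D E G : K.Obj} {f : A ⟶ C} {g : B ⟶ D} {h : C ⟶ E} {k : D ⟶ G}
    {l : A ⟶ E} {m : B ⟶ G} {S : HTarget K.Hor A B} {S' : HTarget K.Hor C D}
    {T : HTarget K.Hor E G} {φ : K.Cell f g S.path S'} {ψ : K.Cell h k S'.path T}
    (hφ : K.IsCartesian S φ) (hψ : K.IsCartesian S' ψ) (hl : f ≫ h = l) (hm : g ≫ k = m) :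
    K.IsCartesian S (K.comp (.single φ) ψ hl hm) := by
  subst hl hm
  intro X Y p q l' m' hl' hm' H χ
  obtain ⟨α, hα, uα⟩ := hψ (p ≫ f) (q ≫ g) ((Category.assoc _ _ _).trans hl')
    ((Category.assoc _ _ _).trans hm') H χ
  obtain ⟨β, hβ, uβ⟩ := hφ p q rfl rfl H α
  have key : ∀ y : K.Cell p q H S, K.comp (.single y) (K.comp (.single φ) ψ rfl rfl) hl' hm' =
      K.comp (.single (K.comp (.single y) φ rfl rfl)) ψ ((Category.assoc _ _ _).trans hl')
        ((Category.assoc _ _ _).trans hm') := fun y => (comp_comp _ _ _ _ _ _ _ _ _ _ _).symm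
  refine ⟨β, ?_, fun y hy => uβ y (uα _ ?_)⟩
  · dsimp only
    rw [key, hβ, hα]
  · exact (key y).symm.trans hy

theorem isCartesian_of_comp {A B C D E G : K.Obj} {f : A ⟶ C} {g : B ⟶ D} {h : C ⟶ E} {k : D ⟶ G}
    {l : A ⟶ E} {m : B ⟶ G} {S : HTarget K.Hor A B} {S' : HTarget K.Hor C D}
    {T : HTarget K.Hor E G} {φ : K.Cell f g S.path S'} {ψ : K.Cell h k S'.path T}
    (hψ : K.IsCartesian S' ψ) (hl : f ≫ h = l) (hm : g ≫ k = m)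
    (hφ : K.IsCartesian S (K.comp (.single φ) ψ hl hm)) : K.IsCartesian S φ := by
  subst hl hm
  intro X Y p q l' m' hl' hm' H χ
  subst hl' hm'
  obtain ⟨β, hβ, uβ⟩ := hφ p q (Category.assoc _ _ _).symm (Category.assoc _ _ _).symm H
    (K.comp (.single χ) ψ rfl rfl)
  have key : ∀ y : K.Cell p q H S, K.comp (.single y) (K.comp (.single φ) ψ rfl rfl)
      (Category.assoc _ _ _).symm (Category.assoc _ _ _).symm =
      K.comp (.single (K.comp (.single y) φ rfl rfl)) ψ rfl rfl :=
    fun y => (comp_comp _ _ _ _ _ _ _ _ _ _ _).symm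
  refine ⟨β, (hψ (p ≫ f) (q ≫ g) rfl rfl H _).unique ((key β).symm.trans hβ) rfl,
    fun y hy => uβ y ?_⟩
  dsimp only at hy ⊢
  rw [key, hy]

/-- Invertible cells between horizontal morphisms. -/
def IsInvertible {A B : K.Obj} {J J' : K.Hor A B}
    (φ : K.Cell (𝟙 A) (𝟙 B) (.single J) (.one J')) : Prop :=
  ∃ ψ : K.Cell (𝟙 A) (𝟙 B) (.single J') (.one J),
    K.comp (.single φ) ψ (Category.comp_id _) (Category.comp_id _) = K.hid J ∧
      K.comp (.single ψ) φ (Category.comp_id _) (Category.comp_id _) = K.hid J'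

theorem IsInvertible.isCartesian {A B : K.Obj} {J J' : K.Hor A B}
    {φ : K.Cell (𝟙 A) (𝟙 B) (.single J) (.one J')} (hφ : IsInvertible φ) :
    K.IsCartesian (.one J) φ := by
  obtain ⟨ψ, h₁, h₂⟩ := hφ
  intro X Y p q l m hl hm H χ
  obtain rfl : p = l := (Category.comp_id p).symm.trans hl
  obtain rfl : q = m := (Category.comp_id q).symm.trans hm
  refine ⟨K.comp (.single χ) ψ hl hm, ?_, fun y hy => ?_⟩
  · refine (comp_comp _ ψ φ hl hm (Category.comp_id _) (Category.comp_id _) hl hm hl hm).trans ?_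
    rw [h₂, K.comp_hid]
  · rw [← hy]
    refine Eq.symm ((comp_comp _ φ ψ hl hm (Category.comp_id _) (Category.comp_id _) hl hm hl
      hm).trans ?_)
    rw [h₁, K.comp_hid]

theorem isCartesian_hid {A B : K.Obj} (J : K.Hor A B) : K.IsCartesian (.one J) (K.hid J) :=
  IsInvertible.isCartesian ⟨K.hid J, K.comp_hid _, K.comp_hid _⟩

/-- Uniqueness of composites: each cell factors through the other, and both round trips agree with
the identity after composition with a weakly cocartesian cell. -/
theorem isInvertible_of_isWeaklyCocartesian {A B : K.Obj} {P : HPath K.Hor A B} {J J' : K.Hor A B}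
    {φ : K.Cell (𝟙 A) (𝟙 B) P (.one J)} {φ' : K.Cell (𝟙 A) (𝟙 B) P (.one J')}
    (h : IsWeaklyCocartesian (.single φ)) (h' : IsWeaklyCocartesian (.single φ')) :
    ∃ χ : K.Cell (𝟙 A) (𝟙 B) (.single J) (.one J'), IsInvertible χ ∧
      K.comp (.single φ) χ (Category.comp_id _) (Category.comp_id _) = φ' := by
  obtain ⟨χ, hχ, -⟩ := h (𝟙 A) (𝟙 B) (Category.comp_id _) (Category.comp_id _) _ φ'
  obtain ⟨χ', hχ', -⟩ := h' (𝟙 A) (𝟙 B) (Category.comp_id _) (Category.comp_id _) _ φ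
  refine ⟨χ, ⟨χ', (h (𝟙 A) (𝟙 B) (Category.comp_id _) (Category.comp_id _) _ φ).unique ?_
    (K.comp_hid φ), (h' (𝟙 A) (𝟙 B) (Category.comp_id _) (Category.comp_id _) _ φ').unique ?_
    (K.comp_hid φ')⟩, hχ⟩
  · refine (comp_comp _ χ χ' (Category.comp_id _) (Category.comp_id _) _ _ (Category.comp_id _)
      (Category.comp_id _) _ _).symm.trans ?_
    rw [hχ, hχ']
  · refine (comp_comp _ χ' χ (Category.comp_id _) (Category.comp_id _) _ _ (Category.comp_id _)
      (Category.comp_id _) _ _).symm.trans ?_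
    rw [hχ', hχ]

theorem IsWeaklyCocartesian.cast {A B C D : K.Obj} {f : A ⟶ C} {g : B ⟶ D} {P P' : HPath K.Hor A B}
    {Q Q' : HPath K.Hor C D} {Φ : CellPath K.toCellGraph f g P Q} (hΦ : IsWeaklyCocartesian Φ)
    (hP : P = P') (hQ : Q = Q') : IsWeaklyCocartesian (Φ.cast hP hQ) := by
  subst hP hQ; exact hΦ

/-- When the vertical target is an identity, the first morphism of a non-empty `R` is its own
restriction, defined by its identity cell, so right cocartesianness applies directly. The empty path
is weak cocartesianness itself. -/
theorem IsRightCocartesian.append_idPath {A C D E : K.Obj} {f : A ⟶ C} {P : HPath K.Hor A D}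
    {Q : HPath K.Hor C D} {Φ : CellPath K.toCellGraph f (𝟙 D) P Q} (hΦ : IsRightCocartesian Φ)
    (R : HPath K.Hor D E) :
    IsWeaklyCocartesian (Φ.append (CellPath.idPath K.toAVDCData R)) := by
  cases R with
  | nil =>
    have h := hΦ.1.cast P.append_nil.symm Q.append_nil.symm
    rw [← Φ.append_nil] at h
    exact h
  | cons J R => exact hΦ.2 J J (K.hid J) (isCartesian_hid J) R

end Cartesian

/-! ### Left Kan extensions and change of vertical target -/

section Kan

variable {K : AVDC.{u, v, w, x}}

/-- Density makes both `c` and `c'` left Kan extensions of `y` along `J`; their factorisations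
through each other are mutually inverse. This is the uniqueness of the morphism representing `J`. -/
theorem IsDense.vertIso {A B M : K.Obj} {y : A ⟶ M} (hy : K.IsDense y) {J : K.Hor A B}
    {l l' : B ⟶ M} {c : K.Cell y l (.single J) (.nul M)} {c' : K.Cell y l' (.single J) (.nul M)}
    (hc : K.IsCartesian (.one J) c) (hc' : K.IsCartesian (.one J) c') : VertIso l l' := by
  have k := hy l J c hc
  have k' := hy l' J c' hc'
  obtain ⟨α, hα, -⟩ := k l' (.nil B) c'
  obtain ⟨β, hβ, -⟩ := k' l (.nil B) c
  refine ⟨α, β, (k l (.nil B) c).unique ?_ (hcomp_vid c),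
    (k' l' (.nil B) c').unique ?_ (hcomp_vid c')⟩
  · refine (hcomp_assoc c α β rfl rfl rfl rfl).symm.trans ?_
    exact (congrArg (fun z => K.hcomp z β rfl) hα).trans hβ
  · refine (hcomp_assoc c' β α rfl rfl rfl rfl).symm.trans ?_
    exact (congrArg (fun z => K.hcomp z α rfl) hβ).trans hα

/-- The target of a nullary cartesian cell can be replaced by an isomorphic morphism. -/
theorem exists_isCartesian_of_vertIso {A B M : K.Obj} {y : A ⟶ M} {J : K.Hor A B} {l l' : B ⟶ M}
    (hl : VertIso l l') {c : K.Cell y l (.single J) (.nul M)} (hc : K.IsCartesian (.one J) c) :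
    ∃ c' : K.Cell y l' (.single J) (.nul M), K.IsCartesian (.one J) c' := by
  obtain ⟨α, β, h₁, h₂⟩ := hl
  refine ⟨K.hcomp c α rfl, ?_⟩
  intro X Y p q s t hs ht H χ
  subst hs ht
  have key : ∀ φ : K.Cell p q H (.one J), K.comp (.single φ) (K.hcomp c α rfl) rfl rfl =
      K.hcomp (K.comp (.single φ) c rfl rfl) (pre q α) H.append_nil.symm := fun φ =>
    comp_cons_hcomp φ (.nil q) c α rfl rfl rfl H.append_nil.symm rfl
  have h₁' : K.hcomp (pre q α) (pre q β) rfl = K.vid (q ≫ l) := by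
    rw [← pre_hcomp, h₁, pre_vid]
  have h₂' : K.hcomp (pre q β) (pre q α) rfl = K.vid (q ≫ l') := by
    rw [← pre_hcomp, h₂, pre_vid]
  -- The isomorphism is undone first: `χ` is composed with `β`, factored through `c`, and `α` is
  -- then restored.
  obtain ⟨φ, hφ, uφ⟩ := hc p q rfl rfl H (K.hcomp χ (pre q β) H.append_nil.symm)
  dsimp only at hφ uφ
  refine ⟨φ, ?_, fun z hz => uφ z ?_⟩
  · dsimp only
    rw [key, hφ, hcomp_assoc χ _ _ _ _ rfl H.append_nil.symm, h₂', hcomp_vid]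
  · dsimp only at hz
    rw [← hz, key, hcomp_assoc _ _ _ _ _ rfl H.append_nil.symm, h₁', hcomp_vid]

end Kan

end AVDC

/-! ### Copairings: the dual abstracted to a functor `F` and composites `ι ⊙ F J` -/

namespace AVDC

/-- A horizontal morphism `ι : I ⇸ F A` together with, for every `J : A ⇸ B`, a pointwise right
composite `J♭ = ι ⊙ F J` such that cells into `J` correspond to cells into `J♭`. -/
structure Copairing {K : AVDC.{u, v, w, x}} {L : AVDC.{u₁, v₁, w₁, x₁}}
    (F : AVDCFunctor K.toAVDCData L.toAVDCData) (I : L.Obj) (A : K.Obj) where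
  hor : L.Hor I (F.ver.obj A)
  adjunct : ∀ {B : K.Obj}, K.Hor A B → L.Hor I (F.ver.obj B)
  cocart : ∀ {B : K.Obj} (J : K.Hor A B), L.Cell (𝟙 _) (𝟙 _)
    ((HPath.single hor).append (.single (F.hor J))) (.one (adjunct J))
  pointwise : ∀ {B : K.Obj} (J : K.Hor A B), IsPointwiseRightCocartesian (cocart J)
  bijective : ∀ {B : K.Obj} (H : HPath K.Hor A B) (J : K.Hor A B), Function.Bijective
    fun φ : K.Cell (𝟙 A) (𝟙 B) H (.one J) =>
      (L.comp (.cons (L.hid hor) (.single (CellGraph.cast (F.ver.map_id A) (F.ver.map_id B) rfl rfl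
            (F.cell φ))) rfl rfl) (cocart J) (Category.comp_id _) (Category.comp_id _) :
        L.Cell (𝟙 _) (𝟙 _) (.cons hor (F.path H)) (.one (adjunct J)))

/-! ### Images of composites and transport along vertical boundaries -/

section Functor

variable {K : AVDC.{u, v, w, x}} {L : AVDC.{u₁, v₁, w₁, x₁}}
  (F : AVDCFunctor K.toAVDCData L.toAVDCData)

theorem map_comp_single {A B C D X Y : K.Obj} {f : A ⟶ C} {g : B ⟶ D} {h : C ⟶ X} {k : D ⟶ Y}
    {l : A ⟶ X} {m : B ⟶ Y} {P : HPath K.Hor A B} {J : K.Hor C D} {T : HTarget K.Hor X Y}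
    (φ : K.Cell f g P (.one J)) (ψ : K.Cell h k (.single J) T) (hl : f ≫ h = l) (hm : g ≫ k = m)
    (hl' : F.ver.map f ≫ F.ver.map h = F.ver.map l)
    (hm' : F.ver.map g ≫ F.ver.map k = F.ver.map m) :
    F.cell (K.comp (.single φ) ψ hl hm) = L.comp (.single (F.cell φ)) (F.cell ψ) hl' hm' := by
  rw [F.map_comp]
  exact L.comp_congr (F.cells_single φ) _ _ _

theorem cast_comp {A B C D E G : K.Obj} {f : A ⟶ C} {g : B ⟶ D} {h : C ⟶ E} {k : D ⟶ G}
    {l l' : A ⟶ E} {m m' : B ⟶ G} {P : HPath K.Hor A B} {Q : HPath K.Hor C D}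
    {T : HTarget K.Hor E G} (Φ : CellPath K.toCellGraph f g P Q) (ψ : K.Cell h k Q T)
    (hl : f ≫ h = l) (hm : g ≫ k = m) (e : l = l') (e' : m = m') :
    CellGraph.cast e e' rfl rfl (K.comp Φ ψ hl hm) = K.comp Φ ψ (hl.trans e) (hm.trans e') := by
  subst e e'; rfl

theorem isCartesian_cast {A B C D : K.Obj} {f f' : A ⟶ C} {g g' : B ⟶ D} {S : HTarget K.Hor A B}
    {T : HTarget K.Hor C D} {ψ : K.Cell f g S.path T} (hψ : K.IsCartesian S ψ) (e : f = f')
    (e' : g = g') : K.IsCartesian S (CellGraph.cast e e' rfl rfl ψ) := by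
  subst e e'; exact hψ

theorem comp_cast_right {A B C D E G : K.Obj} {f : A ⟶ C} {g : B ⟶ D} {h h' : C ⟶ E}
    {k k' : D ⟶ G} {l : A ⟶ E} {m : B ⟶ G} {P : HPath K.Hor A B} {Q : HPath K.Hor C D}
    {T : HTarget K.Hor E G} (Φ : CellPath K.toCellGraph f g P Q) (ψ : K.Cell h k Q T) (e : h = h')
    (e' : k = k') (hl : f ≫ h' = l) (hm : g ≫ k' = m) (hl' : f ≫ h = l) (hm' : g ≫ k = m) :
    K.comp Φ (CellGraph.cast e e' rfl rfl ψ) hl hm = K.comp Φ ψ hl' hm' := by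
  subst e e'; rfl

end Functor

/-! ### Representing cells `(ι, F H) ⇒ X` by cells into a horizontal morphism -/

namespace Copairing

variable {K : AVDC.{u, v, w, x}} {L : AVDC.{u₁, v₁, w₁, x₁}}
  {F : AVDCFunctor K.toAVDCData L.toAVDCData} {I : L.Obj} {A : K.Obj} (D : Copairing F I A)

/-- The composite `Γ ∘ (id_ι, F φ)`. -/
def whisker {B C : K.Obj} {g : B ⟶ C} {H : HPath K.Hor A B} {J : HTarget K.Hor A C}
    {X Y : L.Obj} {T : HTarget L.Hor X Y} {d : I ⟶ X} {m : F.ver.obj C ⟶ Y} {n : F.ver.obj B ⟶ Y}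
    (φ : K.Cell (𝟙 A) g H J) (Γ : L.Cell d m (.cons D.hor (F.target J).path) T)
    (hn : F.ver.map g ≫ m = n) : L.Cell d n (.cons D.hor (F.path H)) T :=
  L.comp (.cons (L.hid D.hor) (.single (CellGraph.cast (F.ver.map_id A) rfl rfl rfl (F.cell φ)))
    rfl rfl) Γ (Category.id_comp d) hn

theorem whisker_comp {B C : K.Obj} {g : B ⟶ C} {H : HPath K.Hor A B} {J : HTarget K.Hor A C}
    {X Y Z W : L.Obj} {T : HTarget L.Hor X Y} {U : HTarget L.Hor Z W} {d : I ⟶ X}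
    {m : F.ver.obj C ⟶ Y} {n : F.ver.obj B ⟶ Y} {p : X ⟶ Z} {q : Y ⟶ W} {d' : I ⟶ Z}
    {m' : F.ver.obj C ⟶ W} {n' : F.ver.obj B ⟶ W}
    (φ : K.Cell (𝟙 A) g H J) (Γ : L.Cell d m (.cons D.hor (F.target J).path) T)
    (γ : L.Cell p q T.path U) (hn : F.ver.map g ≫ m = n) (hd : d ≫ p = d') (hm : m ≫ q = m')
    (hn' : F.ver.map g ≫ m' = n') (hq : n ≫ q = n') :
    D.whisker φ (L.comp (.single Γ) γ hd hm) hn' = L.comp (.single (D.whisker φ Γ hn)) γ hd hq :=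
  (comp_comp _ Γ γ _ _ _ _ _ _ _ _).symm

/-- Interchange together with functoriality of `F`. The transports occur because `F` applied to the
vertical identity of `A` equals an identity without being one definitionally. -/
theorem whisker_whisker {B C E : K.Obj} {g : B ⟶ C} {h : C ⟶ E} {k : B ⟶ E} {H : HPath K.Hor A B}
    {J : K.Hor A C} {J' : HTarget K.Hor A E} {X Y : L.Obj} {T : HTarget L.Hor X Y} {d : I ⟶ X}
    {m : F.ver.obj E ⟶ Y} {n : F.ver.obj C ⟶ Y} {p : F.ver.obj B ⟶ Y}
    (ψ : K.Cell (𝟙 A) g H (.one J)) (φ : K.Cell (𝟙 A) h (.single J) J')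
    (Γ : L.Cell d m (.cons D.hor (F.target J').path) T) (hn : F.ver.map h ≫ m = n)
    (hp : F.ver.map g ≫ n = p) (hk : g ≫ h = k) (hl : 𝟙 A ≫ 𝟙 A = 𝟙 A)
    (hp' : F.ver.map k ≫ m = p) :
    D.whisker ψ (D.whisker φ Γ hn) hp = D.whisker (K.comp (.single ψ) φ hl hk) Γ hp' := by
  subst hk
  unfold whisker
  have e := comp_comp₂ (K := L) (.single (L.hid D.hor))
    (.single (CellGraph.cast (F.ver.map_id A) rfl rfl rfl (F.cell ψ))) (L.hid D.hor)
    (CellGraph.cast (F.ver.map_id A) rfl rfl rfl (F.cell φ)) Γ (Category.comp_id _)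
    (Category.comp_id _) (Category.comp_id _) (F.ver.map_comp g h).symm (Category.id_comp d) hn
    (Category.id_comp d) hp' (Category.id_comp d) hp rfl rfl (HPath.append_nil _).symm
    (HPath.append_nil _).symm rfl
  refine e.symm.trans ?_
  have hl' : F.ver.map (𝟙 A) ≫ F.ver.map (𝟙 A) = F.ver.map (𝟙 A) := by
    rw [← F.ver.map_comp, hl]
  have e₁ : L.comp (.single (CellGraph.cast (F.ver.map_id A) rfl rfl rfl (F.cell ψ)))
      (CellGraph.cast (F.ver.map_id A) rfl rfl rfl (F.cell φ)) (Category.comp_id _)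
      (F.ver.map_comp g h).symm = CellGraph.cast (F.ver.map_id A) rfl rfl rfl
        (F.cell (K.comp (.single ψ) φ hl rfl)) := by
    rw [map_comp_single F ψ φ hl rfl hl' (F.ver.map_comp g h).symm, cast_comp]
    refine (comp_cast_right _ (F.cell φ) (F.ver.map_id A) rfl _ _
      (by rw [F.ver.map_id, Category.comp_id]) (F.ver.map_comp g h).symm).trans ?_
    exact comp_single_cast (F.cell ψ) (F.ver.map_id A) rfl (F.cell φ) _ _ _ _
  rw [L.comp_hid, e₁]
  rfl

theorem whisker_hid {B : K.Obj} {J : K.Hor A B} {X Y : L.Obj} {T : HTarget L.Hor X Y} {d : I ⟶ X}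
    {m : F.ver.obj B ⟶ Y} (Γ : L.Cell d m (.cons D.hor (.single (F.hor J))) T)
    (hm : F.ver.map (𝟙 B) ≫ m = m) :
    D.whisker (K.hid J) Γ hm = Γ := by
  unfold whisker
  rw [F.map_hid, CellGraph.cast_cast]
  refine (comp_cons_single_cast (L.hid D.hor) (L.hid (F.hor J)) (F.ver.map_id B).symm rfl rfl Γ
    (Category.id_comp d) hm (Category.id_comp m)).trans ?_
  exact L.idPath_comp Γ

/-- The bijectivity axiom in terms of `whisker`. The axiom transports both vertical boundaries of `F
φ`, whereas `whisker` transports only the source and leaves the target as the image of an identity,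
as is needed for general vertical targets. -/
theorem existsUnique_whisker_cocart {B : K.Obj} (H : HPath K.Hor A B) (J : K.Hor A B)
    (hm : F.ver.map (𝟙 B) ≫ 𝟙 _ = 𝟙 _)
    (χ : L.Cell (𝟙 I) (𝟙 (F.ver.obj B)) (.cons D.hor (F.path H)) (.one (D.adjunct J))) :
    ∃! φ : K.Cell (𝟙 A) (𝟙 B) H (.one J), D.whisker φ (D.cocart J) hm = χ := by
  have key : ∀ φ : K.Cell (𝟙 A) (𝟙 B) H (.one J), D.whisker φ (D.cocart J) hm =
      L.comp (.cons (L.hid D.hor) (.single (CellGraph.cast (F.ver.map_id A) (F.ver.map_id B)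
        rfl rfl (F.cell φ))) rfl rfl) (D.cocart J) (Category.comp_id _) (Category.comp_id _) := by
    intro φ
    have e : CellGraph.cast (F.ver.map_id A) (F.ver.map_id B) rfl rfl (F.cell φ) =
        CellGraph.cast rfl (F.ver.map_id B) rfl rfl
          (CellGraph.cast (F.ver.map_id A) rfl rfl rfl (F.cell φ)) := by
      rw [CellGraph.cast_cast]
    rw [e]
    exact (comp_cons_single_cast _ _ _ rfl rfl _ _ _ _).symm
  obtain ⟨φ, hφ⟩ := (D.bijective H J).2 χ
  exact ⟨φ, (key φ).trans hφ, fun ψ hψ =>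
    (D.bijective H J).1 (((key ψ).symm.trans hψ).trans hφ.symm)⟩

/-- The nullary cell `(ι, F J) ⇒ X` corresponding to a nullary cell `J♭ ⇒ X`. -/
def unfold {B : K.Obj} {J : K.Hor A B} {X : L.Obj} {d : I ⟶ X} {m : F.ver.obj B ⟶ X}
    (γ : L.Cell d m (.single (D.adjunct J)) (.nul X)) :
    L.Cell d m (.cons D.hor (.single (F.hor J))) (.nul X) :=
  L.comp (.single (D.cocart J)) γ (Category.id_comp d) (Category.id_comp m)

/-- Restricting a nullary cartesian cell `J♭ ⇒ X`. -/
theorem exists_isCartesian_restriction (hF : PreservesRightRestrictions F) {B C : K.Obj}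
    {J : K.Hor A C} {J' : K.Hor A B} {g : B ⟶ C} {r : K.Cell (𝟙 A) g (.single J') (.one J)}
    (hr : K.IsCartesian (.one J') r) {X : L.Obj} {d : I ⟶ X} {m : F.ver.obj C ⟶ X}
    {n : F.ver.obj B ⟶ X} {γ : L.Cell d m (.single (D.adjunct J)) (.nul X)}
    (hγ : L.IsCartesian (.one (D.adjunct J)) γ) (hn : F.ver.map g ≫ m = n) :
    ∃ γ' : L.Cell d n (.single (D.adjunct J')) (.nul X),
      L.IsCartesian (.one (D.adjunct J')) γ' ∧ D.unfold γ' = D.whisker r (D.unfold γ) hn := by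
  subst hn
  -- As `F` preserves restrictions on the right, `F r` exhibits `F J'` as the restriction of `F J`
  -- along `F g`. Pointwiseness of `J♭` then provides its restriction `N` along `F g` and makes `N`
  -- a composite of `ι` and `F J'`.
  obtain ⟨⟨N, e, he⟩, hN⟩ := (D.pointwise J).2 (F.ver.map g) (F.hor J')
    (CellGraph.cast (F.ver.map_id A) rfl rfl rfl (F.cell r)) (isCartesian_cast (hF J g J' r hr) _ _)
  obtain ⟨φ, hφ, -⟩ := he (𝟙 I) (𝟙 _) (Category.comp_id _) (Category.id_comp _) _
    (D.whisker r (D.cocart J) (Category.comp_id _))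
  have hφ' := hN N e he φ hφ
  -- Both `J'♭` and `N` are composites of `(ι, F J')`, so `w` identifies them; the required cell is
  -- `J'♭ ≅ N ⇒ J♭ ⇒ X`.
  obtain ⟨w, hw, hw'⟩ := isInvertible_of_isWeaklyCocartesian (D.pointwise J').1.1 hφ'.1
  have h₁ := isCartesian_comp he hγ (Category.id_comp d) rfl
  refine ⟨_, isCartesian_comp hw.isCartesian h₁ (Category.id_comp d) (Category.id_comp _), ?_⟩
  unfold Copairing.unfold
  refine (comp_comp (.single (D.cocart J')) w _ (Category.comp_id _) (Category.comp_id _)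
    (Category.id_comp d) (Category.id_comp _) (Category.id_comp _) (Category.id_comp _) _
    _).symm.trans ?_
  rw [hw']
  refine (comp_comp (.single φ) e γ (Category.comp_id _) (Category.id_comp _)
    (Category.id_comp d) rfl (Category.id_comp d) rfl _ _).symm.trans ?_
  rw [hφ]
  exact (D.whisker_comp r (D.cocart J) γ _ _ _ _ _).symm

/-- Cells into `J` correspond to nullary cells under a nullary cartesian cell `J♭ ⇒ X`. -/
theorem existsUnique_whisker_unfold (hK : K.HasRightRestrictions)
    (hF : PreservesRightRestrictions F) {B C : K.Obj} {J : K.Hor A C} {X : L.Obj} {d : I ⟶ X}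
    {m : F.ver.obj C ⟶ X} {γ : L.Cell d m (.single (D.adjunct J)) (.nul X)}
    (hγ : L.IsCartesian (.one (D.adjunct J)) γ) (H : HPath K.Hor A B) (g : B ⟶ C)
    {n : F.ver.obj B ⟶ X} (hn : F.ver.map g ≫ m = n)
    (χ : L.Cell d n (.cons D.hor (F.path H)) (.nul X)) :
    ∃! φ : K.Cell (𝟙 A) g H (.one J), D.whisker φ (D.unfold γ) hn = χ := by
  obtain ⟨J', r, hr⟩ := hK J g
  obtain ⟨γ', hγ', e⟩ := D.exists_isCartesian_restriction hF hr hγ hn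
  have hB : F.ver.map (𝟙 B) ≫ n = n := by rw [F.ver.map_id, Category.id_comp]
  have hB' : F.ver.map (𝟙 B) ≫ 𝟙 _ = 𝟙 _ := by rw [F.ver.map_id, Category.id_comp]
  -- Restricting `J` along `g` reduces to identity vertical boundaries, where duality applies. The
  -- correspondence becomes a chain of unique factorisations: through `γ'`, then by duality into
  -- `J'`, then through `r`.
  have key : ∀ φ : K.Cell (𝟙 A) (𝟙 B) H (.one J'),
      D.whisker (K.comp (.single φ) r (Category.comp_id _) (Category.id_comp _)) (D.unfold γ) hn =
        L.comp (.single (D.whisker φ (D.cocart J') hB')) γ' (Category.id_comp d)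
          (Category.id_comp n) := by
    intro φ
    rw [← D.whisker_whisker φ r (D.unfold γ) hn hB (Category.id_comp g) (Category.comp_id _) hn,
      ← e]
    exact D.whisker_comp φ (D.cocart J') γ' hB' _ _ _ _
  obtain ⟨α, hα, uα⟩ := hγ' (𝟙 I) (𝟙 _) (Category.id_comp d) (Category.id_comp n) _ χ
  obtain ⟨φ, hφ, uφ⟩ := D.existsUnique_whisker_cocart H J' hB' α
  refine ⟨K.comp (.single φ) r (Category.comp_id _) (Category.id_comp _), ?_, fun ψ hψ => ?_⟩
  · dsimp only at hφ hα ⊢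
    rw [key, hφ, hα]
  · obtain ⟨φ', hφ', -⟩ := hr (𝟙 A) (𝟙 B) (Category.comp_id _) (Category.id_comp g) H ψ
    rw [← hφ'] at hψ ⊢
    rw [uφ φ' (uα _ ((key φ').symm.trans hψ))]

end Copairing

end AVDC

namespace AVDC

/-! ### Horizontal units and companions -/

section Unit

variable {K : AVDC.{u, v, w, x}}

theorem isCartesian_vid_id (A : K.Obj) : K.IsCartesian (.nul A) (K.vid (𝟙 A)) := by
  intro X Y p q l m hl hm H χ
  obtain rfl : p = l := (Category.comp_id p).symm.trans hl
  obtain rfl : q = m := (Category.comp_id q).symm.trans hm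
  exact ⟨χ, K.comp_vid χ, fun z hz => (K.comp_vid z).symm.trans hz⟩

/-- The inverse of the cartesian cell of a horizontal unit. -/
theorem exists_unit_inverse {A : K.Obj} (U : AVDCData.HUnit K.toAVDCData A) :
    ∃ η : K.Cell (𝟙 A) (𝟙 A) (.nil A) (.one U.hor), K.IsCartesian (.nul A) η ∧
      K.comp (.single η) U.cell (Category.comp_id _) (Category.comp_id _) = K.vid (𝟙 A) ∧
      K.comp (.single U.cell) η (Category.comp_id _) (Category.comp_id _) = K.hid U.hor := by
  obtain ⟨η, hη, -⟩ := U.cart (𝟙 A) (𝟙 A) (Category.comp_id _) (Category.comp_id _) _ (K.vid (𝟙 A))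
  refine ⟨η, ?_, hη, ?_⟩
  -- Cancellation: the composite of `η` with the cartesian cell of the unit is a vertical identity,
  -- which is cartesian.
  · refine isCartesian_of_comp U.cart (Category.comp_id _) (Category.comp_id _) ?_
    rw [hη]
    exact isCartesian_vid_id A
  · refine (U.cart (𝟙 A) (𝟙 A) (Category.comp_id _) (Category.comp_id _) _ U.cell).unique ?_
      (hid_comp _)
    refine (comp_comp (.single U.cell) η U.cell _ _ (Category.comp_id _) (Category.comp_id _) _ _
      (Category.comp_id _) (Category.comp_id _)).trans ?_
    refine (congrArg (fun z => K.comp (.single U.cell) z _ _) hη).trans ?_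
    exact K.comp_vid _

/-- The companion identities. -/
theorem exists_companion_unit {A P : K.Obj} {f : A ⟶ P} (J : K.Companion f) :
    ∃ e : K.Cell (𝟙 A) f (.nil A) (.one J.hor),
      K.comp (.single e) J.cell (Category.id_comp f) (Category.comp_id f) = K.vid f ∧
      K.comp (.cons e (.single J.cell) rfl rfl) (K.hid J.hor) (Category.comp_id _)
        (Category.comp_id _) = K.hid J.hor := by
  obtain ⟨e, he, -⟩ := J.cart (𝟙 A) f (Category.id_comp f) (Category.comp_id f) _ (K.vid f)
  -- The second identity may be checked after composing with the cartesian cell of the companion;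
  -- there it follows from the first identity by interchange.
  refine ⟨e, he, (J.cart (𝟙 A) (𝟙 P) (Category.id_comp _) (Category.comp_id _) _ J.cell).unique ?_
      (hid_comp _)⟩
  refine (comp_comp (.cons e (.single J.cell) rfl rfl) (K.hid J.hor) J.cell _ _
    (Category.id_comp _) (Category.id_comp _) _ _ (Category.id_comp _)
    (Category.comp_id _)).trans ?_
  rw [hid_comp]
  have h := comp_cons_hcomp e (.single J.cell) J.cell (K.vid (𝟙 P)) (Category.id_comp f)
    (Category.comp_id f) (Category.comp_id (𝟙 P)) rfl rfl
  rw [hcomp_vid, K.comp_vid] at h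
  refine h.trans ?_
  refine (congrArg (fun z => K.hcomp z J.cell _) he).trans ?_
  exact vid_hcomp J.cell

end Unit

/-! ### The adjunct of a unit, representing cells, and the assignment `theta` -/

namespace Copairing

variable {K : AVDC.{u, v, w, x}} {L : AVDC.{u₁, v₁, w₁, x₁}}
  {F : AVDCFunctor K.toAVDCData L.toAVDCData} {I : L.Obj} {A : K.Obj} (D : Copairing F I A)

/-- The counterpart of `whisker_whisker` with an empty path between the two cells; it serves the
comparison of `ι` with the adjunct of a horizontal unit. -/
theorem whisker_whisker_nul {B E : K.Obj} {g : B ⟶ A} {h : A ⟶ E} {k : B ⟶ E}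
    {H : HPath K.Hor A B} {J' : HTarget K.Hor A E} {X Y : L.Obj} {T : HTarget L.Hor X Y} {d : I ⟶ X}
    {m : F.ver.obj E ⟶ Y} {n : F.ver.obj A ⟶ Y} {p : F.ver.obj B ⟶ Y}
    (ψ : K.Cell (𝟙 A) g H (.nul A)) (φ : K.Cell (𝟙 A) h (.nil A) J')
    (Γ : L.Cell d m (.cons D.hor (F.target J').path) T) (hn : F.ver.map h ≫ m = n)
    (hp : F.ver.map g ≫ n = p) (hk : g ≫ h = k) (hl : 𝟙 A ≫ 𝟙 A = 𝟙 A)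
    (hp' : F.ver.map k ≫ m = p) :
    D.whisker (J := .nul A) ψ (D.whisker φ Γ hn) hp =
      D.whisker (K.comp (.single ψ) φ hl hk) Γ hp' := by
  subst hk
  unfold whisker
  have e := comp_comp₂ (K := L) (.single (L.hid D.hor))
    (.single (CellGraph.cast (F.ver.map_id A) rfl rfl rfl (F.cell ψ))) (L.hid D.hor)
    (CellGraph.cast (F.ver.map_id A) rfl rfl rfl (F.cell φ)) Γ (Category.comp_id _)
    (Category.comp_id _) (Category.comp_id _) (F.ver.map_comp g h).symm (Category.id_comp d) hn
    (Category.id_comp d) hp' (Category.id_comp d) hp rfl rfl (HPath.append_nil _).symm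
    (HPath.append_nil _).symm rfl
  refine e.symm.trans ?_
  have hl' : F.ver.map (𝟙 A) ≫ F.ver.map (𝟙 A) = F.ver.map (𝟙 A) := by
    rw [← F.ver.map_comp, hl]
  have e₁ : L.comp (.single (CellGraph.cast (F.ver.map_id A) rfl rfl rfl (F.cell ψ)))
      (CellGraph.cast (F.ver.map_id A) rfl rfl rfl (F.cell φ)) (Category.comp_id _)
      (F.ver.map_comp g h).symm = CellGraph.cast (F.ver.map_id A) rfl rfl rfl
        (F.cell (K.comp (.single ψ) φ hl rfl)) := by
    rw [F.map_comp, cast_comp]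
    refine (comp_cast_right _ (F.cell φ) (F.ver.map_id A) rfl _ _
      (by rw [F.ver.map_id, Category.comp_id]) (F.ver.map_comp g h).symm).trans ?_
    refine (comp_single_cast (F.cell ψ) (F.ver.map_id A) rfl (F.cell φ) _ _
      (hl'.trans (F.ver.map_id A)) (F.ver.map_comp g h).symm).trans ?_
    exact (L.comp_congr (F.cells_single ψ) _ _ _).symm
  rw [L.comp_hid, e₁]
  rfl

theorem whisker_vid {X Y : L.Obj} {T : HTarget L.Hor X Y} {d : I ⟶ X} {m : F.ver.obj A ⟶ Y}
    (Γ : L.Cell d m (.single D.hor) T) (hm : F.ver.map (𝟙 A) ≫ m = m) :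
    D.whisker (J := .nul A) (K.vid (𝟙 A)) Γ hm = Γ := by
  unfold whisker
  rw [F.map_vid]
  have e : ∀ {f : F.ver.obj A ⟶ F.ver.obj A} (h : f = 𝟙 _) (hm : f ≫ m = m),
      L.comp (.cons (L.hid D.hor) (.single (CellGraph.cast h rfl rfl rfl (L.vid f))) rfl rfl) Γ
        (Category.id_comp d) hm = Γ := by
    intro f h hm
    subst h
    exact (L.comp_insert_vid (.single (L.hid D.hor)) (.nil _) Γ _ _).trans (hid_comp Γ)
  exact e (F.ver.map_id A) hm

/-- The pointwise composite of `ι` and the image of a horizontal unit is `ι`. -/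
theorem exists_adjunct_unit (U : AVDCData.HUnit K.toAVDCData A) :
    ∃ κ : L.Cell (𝟙 I) (𝟙 _) (.single (D.adjunct U.hor)) (.one D.hor), IsInvertible κ ∧
      ∀ {X : L.Obj} {d : I ⟶ X} {m : F.ver.obj A ⟶ X} (ξ : L.Cell d m (.single D.hor) (.nul X))
        (hm : F.ver.map (𝟙 A) ≫ m = m),
        D.unfold (L.comp (.single κ) ξ (Category.id_comp d) (Category.id_comp m)) =
          D.whisker (J := .nul A) U.cell ξ hm := by
  obtain ⟨η, -, h₁, h₂⟩ := exists_unit_inverse U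
  have hF : ∀ {Y : L.Obj} (m : F.ver.obj A ⟶ Y), F.ver.map (𝟙 A) ≫ m = m := fun m => by
    rw [F.ver.map_id, Category.id_comp]
  have key : ∀ {X Y : L.Obj} {T : HTarget L.Hor X Y} {d : I ⟶ X} {m : F.ver.obj A ⟶ Y}
      (ξ : L.Cell d m (.single D.hor) T),
      L.comp (.single (D.whisker (J := .nul A) U.cell (L.hid D.hor) (hF _))) ξ
        (Category.id_comp d) (Category.id_comp m) = D.whisker (J := .nul A) U.cell ξ (hF m) := by
    intro X Y T d m ξ
    refine (D.whisker_comp (J := .nul A) U.cell (L.hid D.hor) ξ (hF _) _ (Category.id_comp m)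
      (hF m) _).symm.trans ?_
    rw [hid_comp]
  -- Whiskering with the inverse `η` of the unit cell is inverse to whiskering with the unit cell,
  -- so `ι` is itself a composite of `ι` and the image of the unit.
  have hwc : IsWeaklyCocartesian
      (CellPath.single (D.whisker (J := .nul A) U.cell (L.hid D.hor) (hF _))) := by
    intro X Y d m d' m' hd hm T χ
    obtain rfl : d = d' := (Category.id_comp d).symm.trans hd
    obtain rfl : m = m' := (Category.id_comp m).symm.trans hm
    refine ⟨D.whisker (J := .one U.hor) η χ (hF m), (key _).trans ?_, fun z hz => ?_⟩
    · rw [D.whisker_whisker_nul U.cell η (J' := .one U.hor) χ (hF m) (hF m) (Category.comp_id _)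
        (Category.comp_id _) (hF m), h₂, D.whisker_hid]
    · rw [← (key z).symm.trans hz]
      rw [D.whisker_whisker η U.cell (J' := .nul A) z (hF m) (hF m) (Category.comp_id _)
        (Category.comp_id _) (hF m), h₁, D.whisker_vid]
  -- Two weakly cocartesian cells with the same horizontal source `(ι, F U.hor)` have isomorphic
  -- targets.
  obtain ⟨κ, hκ, e⟩ := isInvertible_of_isWeaklyCocartesian (D.pointwise U.hor).1.1 hwc
  refine ⟨κ, hκ, fun {X d m} ξ hm => ?_⟩
  rw [← key ξ]
  unfold Copairing.unfold
  refine (comp_comp (.single (D.cocart U.hor)) κ ξ (Category.comp_id _) (Category.comp_id _)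
    (Category.id_comp d) (Category.id_comp m) (Category.id_comp d) (Category.id_comp m) _
    _).symm.trans ?_
  rw [e]

/-- `Γ` represents the cells `(ι, F H) ⇒ X` for `H : A ⇸ B`. -/
def Represents {B : K.Obj} {J : K.Hor A B} {X : L.Obj} {d : I ⟶ X} {m : F.ver.obj B ⟶ X}
    (Γ : L.Cell d m (.cons D.hor (.single (F.hor J))) (.nul X)) : Prop :=
  ∀ (H : K.Hor A B) (hm : F.ver.map (𝟙 B) ≫ m = m)
    (χ : L.Cell d m (.cons D.hor (.single (F.hor H))) (.nul X)),
    ∃! φ : K.Cell (𝟙 A) (𝟙 B) (.single H) (.one J), D.whisker (J := .one J) φ Γ hm = χ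

/-- The usual uniqueness of representing objects: `Γ'` factors back through `Γ`, and both composites
fix a universal element. -/
theorem Represents.isInvertible {B : K.Obj} {H J : K.Hor A B} {X : L.Obj} {d : I ⟶ X}
    {m : F.ver.obj B ⟶ X} {Γ : L.Cell d m (.cons D.hor (.single (F.hor H))) (.nul X)}
    {Γ' : L.Cell d m (.cons D.hor (.single (F.hor J))) (.nul X)} (h : D.Represents Γ)
    (h' : D.Represents Γ') {φ : K.Cell (𝟙 A) (𝟙 B) (.single H) (.one J)}
    (hm : F.ver.map (𝟙 B) ≫ m = m) (hφ : D.whisker (J := .one J) φ Γ' hm = Γ) :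
    IsInvertible φ := by
  obtain ⟨ψ, hψ, -⟩ := h J hm Γ'
  refine ⟨ψ, (h H hm Γ).unique ?_ (D.whisker_hid Γ hm), (h' J hm Γ').unique ?_
    (D.whisker_hid Γ' hm)⟩
  · rw [← D.whisker_whisker φ ψ (J' := .one H) Γ hm hm _ _ hm, hψ, hφ]
  · rw [← D.whisker_whisker ψ φ (J' := .one J) Γ' hm hm _ _ hm, hφ, hψ]

theorem represents_unfold (hK : K.HasRightRestrictions) (hF : PreservesRightRestrictions F)
    {B : K.Obj} {J : K.Hor A B} {X : L.Obj} {d : I ⟶ X} {m : F.ver.obj B ⟶ X}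
    {γ : L.Cell d m (.single (D.adjunct J)) (.nul X)}
    (hγ : L.IsCartesian (.one (D.adjunct J)) γ) : D.Represents (D.unfold γ) :=
  fun H hm χ => D.existsUnique_whisker_unfold hK hF hγ (.single H) (𝟙 B) hm χ

/-- The cell `ξ ⊙ (e ∘ F φ)`. -/
def theta {P B : K.Obj} {f : A ⟶ P} {g : B ⟶ P} {X : L.Obj} {ev : F.ver.obj P ⟶ X} {d : I ⟶ X}
    {n : F.ver.obj B ⟶ X} {H : HPath K.Hor A B}
    (ξ : L.Cell d (F.ver.map f ≫ ev) (.single D.hor) (.nul X)) (φ : K.Cell f g H (.nul P))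
    (hn : F.ver.map g ≫ ev = n) : L.Cell d n (.cons D.hor (F.path H)) (.nul X) :=
  L.hcomp ξ (L.comp (.single (F.cell φ)) (L.vid ev) rfl hn) rfl

/-! ### Naturality of `theta` -/

section Theta

variable {P : K.Obj} {f : A ⟶ P} {X : L.Obj} {ev : F.ver.obj P ⟶ X} {d : I ⟶ X}
  (ξ : L.Cell d (F.ver.map f ≫ ev) (.single D.hor) (.nul X))

/-- The common core of `theta_comp` and `theta_comp_nul`, which differ in whether the intermediate
horizontal target has length one or zero. Here `Φ` has the image of an identity as vertical source
and `Φ'` the identity itself; the hypothesis `e` says that this difference is invisible after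
composition. -/
theorem theta_eq_of_comp {B C : K.Obj} {g : B ⟶ C} {h : C ⟶ P} {k : B ⟶ P} {H : HPath K.Hor A B}
    {Q : HPath L.Hor (F.ver.obj A) (F.ver.obj C)} {n : F.ver.obj C ⟶ X} {p : F.ver.obj B ⟶ X}
    {Φ : CellPath L.toCellGraph (F.ver.map (𝟙 A)) (F.ver.map g) (F.path H) Q}
    {Φ' : CellPath L.toCellGraph (𝟙 (F.ver.obj A)) (F.ver.map g) (F.path H) Q}
    {η : L.Cell (F.ver.map f) (F.ver.map h) Q (.nul (F.ver.obj P))}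
    (e : ∀ (hf : F.ver.map (𝟙 A) ≫ F.ver.map f ≫ ev = F.ver.map f ≫ ev),
      L.comp Φ (L.comp (.single η) (L.vid ev) rfl rfl) hf rfl =
      L.comp Φ' (L.comp (.single η) (L.vid ev) rfl rfl) (Category.id_comp _) rfl)
    {φ : K.Cell f k H (.nul P)} (hl : F.ver.map (𝟙 A) ≫ F.ver.map f = F.ver.map f)
    (hk : F.ver.map g ≫ F.ver.map h = F.ver.map k) (hφ : F.cell φ = L.comp Φ η hl hk)
    (hn : F.ver.map h ≫ ev = n) (hp : F.ver.map g ≫ n = p) (hp' : F.ver.map k ≫ ev = p) :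
    D.theta ξ φ hp' = L.comp (.cons (L.hid D.hor) Φ' rfl rfl)
      (L.hcomp ξ (L.comp (.single η) (L.vid ev) rfl hn) rfl) (Category.id_comp d) hp := by
  subst hn hp
  unfold theta
  rw [hφ]
  have hf : F.ver.map (𝟙 A) ≫ F.ver.map f ≫ ev = F.ver.map f ≫ ev := by
    rw [← Category.assoc, hl]
  have e₁ := comp_comp Φ η (L.vid ev) hl hk rfl rfl rfl hp' hf rfl
  refine (congrArg (fun z => L.hcomp ξ z rfl) (e₁.trans (e hf))).trans ?_
  exact hcomp_comp_right ξ Φ' _ _ _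

/-- Naturality in the Yoneda sense: on cells factoring through `η`, `theta` is determined by its
value at `η`. With `η` the cell of a companion this compares `theta` with `whisker`. -/
theorem theta_comp {B C : K.Obj} {g : B ⟶ C} {h : C ⟶ P} {k : B ⟶ P} {H : HPath K.Hor A B}
    {J : K.Hor A C} {n : F.ver.obj C ⟶ X} {p : F.ver.obj B ⟶ X}
    (φ : K.Cell (𝟙 A) g H (.one J)) (η : K.Cell f h (.single J) (.nul P))
    (hl : 𝟙 A ≫ f = f) (hk : g ≫ h = k) (hn : F.ver.map h ≫ ev = n) (hp : F.ver.map g ≫ n = p)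
    (hp' : F.ver.map k ≫ ev = p) :
    D.theta ξ (K.comp (.single φ) η hl hk) hp' =
      D.whisker (J := .one J) φ (D.theta ξ η hn) hp := by
  subst hk
  refine D.theta_eq_of_comp ξ (fun hf => ?_) (by rw [← F.ver.map_comp, hl])
    (F.ver.map_comp g h).symm (map_comp_single F φ η hl rfl _ _) hn hp hp'
  exact (comp_single_cast (F.cell φ) (F.ver.map_id A) rfl _ _ _ hf rfl).symm

theorem theta_comp_nul {B : K.Obj} {g : B ⟶ A} {h : A ⟶ P} {k : B ⟶ P} {H : HPath K.Hor A B}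
    {n : F.ver.obj A ⟶ X} {p : F.ver.obj B ⟶ X}
    (φ : K.Cell (𝟙 A) g H (.nul A)) (η : K.Cell f h (.nil A) (.nul P))
    (hl : 𝟙 A ≫ f = f) (hk : g ≫ h = k) (hn : F.ver.map h ≫ ev = n) (hp : F.ver.map g ≫ n = p)
    (hp' : F.ver.map k ≫ ev = p) :
    D.theta ξ (K.comp (.single φ) η hl hk) hp' =
      D.whisker (J := .nul A) φ (D.theta ξ η hn) hp := by
  subst hk
  refine D.theta_eq_of_comp ξ (fun hf => ?_) (by rw [← F.ver.map_comp, hl])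
    (F.ver.map_comp g h).symm ((F.map_comp _ η hl rfl).trans
      (L.comp_congr (F.cells_single φ) _ _ _)) hn hp hp'
  exact (comp_single_cast (F.cell φ) (F.ver.map_id A) rfl _ _ _ hf rfl).symm

/-- The universal element of `theta` is its value at the vertical identity of `f`, which is `ξ`. -/
theorem theta_vid (hn : F.ver.map f ≫ ev = F.ver.map f ≫ ev) :
    D.theta ξ (K.vid f) hn = ξ := by
  unfold theta
  rw [F.map_vid]
  refine (congrArg (fun z => L.hcomp ξ z rfl) (vid_vid_comp (F.ver.map f) ev rfl)).trans ?_
  exact hcomp_vid ξ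

/-- Both `F` and postcomposition with `ev` preserve `⊙`, so this is associativity of `⊙`. It
supplies the commutative square that relates density of `yA` to full faithfulness of `ev ∘ F –`. -/
theorem theta_hcomp {B C : K.Obj} {g : B ⟶ P} {h : C ⟶ P} {J : K.Hor A B} {H : HPath K.Hor B C}
    (η : K.Cell f g (.single J) (.nul P)) (φ : K.Cell g h H (.nul P)) :
    D.theta (ev := ev) ξ (K.hcomp η φ rfl) rfl =
      L.hcomp (D.theta ξ η rfl) (L.post (F.cell φ) ev) rfl := by
  unfold theta
  have e : L.comp (.single (F.cell (K.hcomp η φ rfl))) (L.vid ev) rfl rfl =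
      L.hcomp (L.post (F.cell η) ev) (L.post (F.cell φ) ev) rfl := by
    rw [map_hcomp F η φ rfl rfl]
    exact post_hcomp _ _ rfl ev
  refine (congrArg (fun z => L.hcomp ξ z rfl) e).trans ?_
  exact (hcomp_assoc _ _ _ _ _ _ _).symm

end Theta

end Copairing

end AVDC

/-! ### Matching cells, and density versus full faithfulness -/

namespace AVDC.Copairing

variable {K : AVDC.{u, v, w, x}} {L : AVDC.{u₁, v₁, w₁, x₁}}
  {F : AVDCFunctor K.toAVDCData L.toAVDCData} {I : L.Obj} {A : K.Obj} (D : Copairing F I A)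
  {P : K.Obj} {yA : A ⟶ P} {X : L.Obj} {y : I ⟶ X} {ev : F.ver.obj P ⟶ X}

/-- The two universal cells `ξ : ι ⇒ X` and `χ : (yA_*)♭ ⇒ X` correspond to each other. -/
structure IsMatching (J : K.Companion yA)
    (ξ : L.Cell y (F.ver.map yA ≫ ev) (.single D.hor) (.nul X))
    (χ : L.Cell y ev (.single (D.adjunct J.hor)) (.nul X)) : Prop where
  cart : L.IsCartesian (.one (D.adjunct J.hor)) χ
  theta_eq : ∀ h : F.ver.map (𝟙 P) ≫ ev = ev, D.theta ξ J.cell h = D.unfold χ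

namespace IsMatching

variable {D} {J : K.Companion yA} {ξ : L.Cell y (F.ver.map yA ≫ ev) (.single D.hor) (.nul X)}
    {χ : L.Cell y ev (.single (D.adjunct J.hor)) (.nul X)}

theorem map_id_comp (ev : F.ver.obj P ⟶ X) : F.ver.map (𝟙 P) ≫ ev = ev := by
  rw [F.ver.map_id, Category.id_comp]

/-- Nullary cells into `P` under `yA` are cells into the companion of `yA`, and these correspond to
cells `(ι, F H) ⇒ X` because `χ` is cartesian. The matching condition says that this composite
correspondence is `theta`. -/
theorem existsUnique_theta (h : D.IsMatching J ξ χ) (hK : K.HasRightRestrictions)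
    (hF : PreservesRightRestrictions F) {B : K.Obj} (H : HPath K.Hor A B) (g : B ⟶ P)
    {n : F.ver.obj B ⟶ X} (hn : F.ver.map g ≫ ev = n)
    (ψ : L.Cell y n (.cons D.hor (F.path H)) (.nul X)) :
    ∃! φ : K.Cell yA g H (.nul P), D.theta ξ φ hn = ψ := by
  have key : ∀ φ : K.Cell (𝟙 A) g H (.one J.hor),
      D.theta ξ (K.comp (.single φ) J.cell (Category.id_comp _) (Category.comp_id _)) hn =
        D.whisker (J := .one J.hor) φ (D.unfold χ) hn := fun φ => by
    rw [← h.theta_eq (map_id_comp ev)]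
    exact D.theta_comp ξ φ J.cell _ _ _ _ _
  obtain ⟨φ, hφ, uφ⟩ := D.existsUnique_whisker_unfold hK hF h.cart H g hn ψ
  refine ⟨_, (key φ).trans hφ, fun z hz => ?_⟩
  obtain ⟨φ', rfl, -⟩ := J.cart (𝟙 A) g (Category.id_comp _) (Category.comp_id _) H z
  rw [uφ φ' ((key φ').symm.trans hz)]

/-- Nullary restrictions of `P` along `yA` give nullary restrictions of `X` along `y`. -/
theorem exists_isCartesian_unfold (h : D.IsMatching J ξ χ) (hF : PreservesRightRestrictions F)
    {B : K.Obj} {J' : K.Hor A B} {g : B ⟶ P} {η : K.Cell yA g (.single J') (.nul P)}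
    (hη : K.IsCartesian (.one J') η) {n : F.ver.obj B ⟶ X} (hn : F.ver.map g ≫ ev = n) :
    ∃ γ : L.Cell y n (.single (D.adjunct J')) (.nul X),
      L.IsCartesian (.one (D.adjunct J')) γ ∧ D.unfold γ = D.theta ξ η hn := by
  -- The factor `r` of `η` through the companion is cartesian by cancellation, so `J'` is the right
  -- restriction of `yA_*` along `g`.
  obtain ⟨r, rfl, -⟩ := J.cart (𝟙 A) g (Category.id_comp _) (Category.comp_id _) _ η
  have hr := isCartesian_of_comp J.cart _ _ hη
  obtain ⟨γ, hγ, e⟩ := D.exists_isCartesian_restriction hF hr h.cart hn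
  refine ⟨γ, hγ, e.trans ?_⟩
  rw [← h.theta_eq (map_id_comp ev)]
  exact (D.theta_comp ξ r J.cell _ _ _ _ _).symm

end IsMatching

/-- Two universal properties in succession: right cocartesianness replaces `(ι, F J, H)` by `(J♭,
H)`, and density of `y` makes the cartesian cell `γ` left Kan. Thus the cell corresponding to `γ`
behaves as a left Kan extension along the path `(ι, F J)`. -/
theorem existsUnique_unfold_hcomp (hy : L.IsDense y) {B C : K.Obj} {J : K.Hor A B}
    {m : F.ver.obj B ⟶ X} {n : F.ver.obj C ⟶ X}
    {γ : L.Cell y m (.single (D.adjunct J)) (.nul X)}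
    (hγ : L.IsCartesian (.one (D.adjunct J)) γ) (H : HPath L.Hor (F.ver.obj B) (F.ver.obj C))
    (ψ : L.Cell y n (.cons D.hor (.cons (F.hor J) H)) (.nul X)) :
    ∃! β : L.Cell m n H (.nul X), L.hcomp (D.unfold γ) β rfl = ψ := by
  have key : ∀ β : L.Cell m n H (.nul X), L.hcomp (D.unfold γ) β rfl =
      L.comp ((CellPath.single (D.cocart J)).append (CellPath.idPath L.toAVDCData H))
        (L.hcomp γ β rfl) (Category.id_comp y) (Category.id_comp n) := by
    intro β
    have e := comp_hcomp (.single (D.cocart J)) (CellPath.idPath L.toAVDCData H) γ β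
      (Category.id_comp y) (Category.id_comp m) (Category.id_comp n) rfl
    rw [L.idPath_comp] at e
    exact e.symm
  obtain ⟨α, hα, uα⟩ := (D.pointwise J).1.append_idPath H y n (Category.id_comp y)
    (Category.id_comp n) _ ψ
  obtain ⟨β, hβ, uβ⟩ := hy m _ γ hγ n H α
  refine ⟨β, (key β).trans ?_, fun z hz => uβ z (uα _ ((key z).symm.trans hz))⟩
  exact (congrArg (fun z => L.comp _ z _ _) hβ).trans hα

variable {D} in
-- In the square of `theta_hcomp`, the bijection `h₁` is `theta` at `(J', H)` and the bijection `h₂`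
-- is composition with the cell corresponding to `γ : J'♭ ⇒ X`. The two remaining sides are
-- therefore bijective together.
theorem IsMatching.bijective_hcomp_iff {J : K.Companion yA}
    {ξ : L.Cell y (F.ver.map yA ≫ ev) (.single D.hor) (.nul X)}
    {χ : L.Cell y ev (.single (D.adjunct J.hor)) (.nul X)} (h : D.IsMatching J ξ χ)
    (hK : K.HasRightRestrictions) (hF : PreservesRightRestrictions F) (hy : L.IsDense y)
    {B C : K.Obj} {J' : K.Hor A B} {f : B ⟶ P} {η : K.Cell yA f (.single J') (.nul P)}
    (hη : K.IsCartesian (.one J') η) (g : C ⟶ P) (H : HPath K.Hor B C) :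
    (Function.Bijective fun φ : K.Cell f g H (.nul P) =>
        (K.hcomp η φ rfl : K.Cell yA g (.cons J' H) (.nul P))) ↔
      Function.Bijective fun φ : K.Cell f g H (.nul P) => L.post (F.cell φ) ev := by
  obtain ⟨γ, hγ, e⟩ := h.exists_isCartesian_unfold hF hη rfl
  have h₁ : Function.Bijective fun φ : K.Cell yA g (.cons J' H) (.nul P) => D.theta ξ φ rfl :=
    Function.bijective_iff_existsUnique _ |>.2
      fun ψ => h.existsUnique_theta hK hF (.cons J' H) g rfl ψ
  have h₂ : Function.Bijective fun β : L.Cell (F.ver.map f ≫ ev) (F.ver.map g ≫ ev) (F.path H)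
      (.nul X) => (L.hcomp (D.unfold γ) β rfl :
        L.Cell y _ (.cons D.hor (.cons (F.hor J') (F.path H))) (.nul X)) :=
    Function.bijective_iff_existsUnique _ |>.2
      fun ψ => D.existsUnique_unfold_hcomp hy hγ (F.path H) ψ
  rw [← Function.Bijective.of_comp_iff' h₁, ← Function.Bijective.of_comp_iff' h₂]
  refine iff_of_eq (congrArg _ (funext fun φ => ?_))
  refine (D.theta_hcomp ξ η φ).trans ?_
  rw [← e]
  rfl

/-- The unit of the companion turns `χ : (yA_*)♭ ⇒ X` into a cell `ι ⇒ X`. -/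
theorem exists_isMatching (J : K.Companion yA)
    {χ : L.Cell y ev (.single (D.adjunct J.hor)) (.nul X)}
    (hχ : L.IsCartesian (.one (D.adjunct J.hor)) χ) :
    ∃ ξ : L.Cell y (F.ver.map yA ≫ ev) (.single D.hor) (.nul X), D.IsMatching J ξ χ := by
  obtain ⟨e, -, he⟩ := exists_companion_unit J
  -- With this `ξ`, interchange turns `theta` at the companion cell into the unfolded `χ` composed
  -- with the images of `e` and the companion cell. The second companion identity says that `e` and
  -- that cell compose to the identity of `yA_*`.
  refine ⟨D.whisker (J := .one J.hor) e (D.unfold χ) rfl, hχ, fun h => ?_⟩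
  have e₁ := comp_hcomp (K := L) (.cons (L.hid D.hor) (.single (CellGraph.cast (F.ver.map_id A)
    rfl rfl rfl (F.cell e))) rfl rfl) (.single (F.cell J.cell)) (D.unfold χ) (L.vid ev)
    (Category.id_comp y) rfl h rfl
  rw [hcomp_vid] at e₁
  refine Eq.trans e₁.symm ?_
  refine Eq.trans ?_ (D.whisker_hid (D.unfold χ) h)
  rw [← he]
  have e₂ : CellGraph.cast (F.ver.map_id A) rfl rfl rfl
      (F.cell (K.comp (.cons e (.single J.cell) rfl rfl) (K.hid J.hor) (Category.comp_id _)
        (Category.comp_id _))) =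
      L.comp (.cons (CellGraph.cast (F.ver.map_id A) rfl rfl rfl (F.cell e))
        (.single (F.cell J.cell)) rfl rfl) (L.hid (F.hor J.hor)) (Category.comp_id _)
        (Category.comp_id _) := by
    rw [F.map_comp, F.map_hid, cast_comp]
    refine (comp_cast_right _ (L.hid (F.hor J.hor)) (F.ver.map_id A).symm (F.ver.map_id P).symm _ _
      ((Category.comp_id _).trans (F.ver.map_id A)) (Category.comp_id _)).trans ?_
    -- Replacing the image of the identity by a variable `f` lets the transport be eliminated by
    -- substitution.
    have e₃ : ∀ {f : F.ver.obj A ⟶ F.ver.obj A} (hf : f = 𝟙 _)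
        (φ : L.Cell f (F.ver.map yA) (.nil _) (.one (F.hor J.hor))) (h₁ : f ≫ 𝟙 _ = 𝟙 _)
        (h₂ : F.ver.map (𝟙 P) ≫ 𝟙 _ = F.ver.map (𝟙 P)),
        L.comp (.cons φ (.single (F.cell J.cell)) rfl rfl) (L.hid (F.hor J.hor)) h₁ h₂ =
        L.comp (.cons (CellGraph.cast hf rfl rfl rfl φ) (.single (F.cell J.cell)) rfl rfl)
          (L.hid (F.hor J.hor)) (Category.comp_id _) (Category.comp_id _) := by
      intro f hf φ h₁ h₂
      subst hf
      rfl
    exact e₃ (F.ver.map_id A) (F.cell e) _ _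
  have e₄ := comp_comp₂ (K := L) (.single (L.hid D.hor))
    (.cons (CellGraph.cast (F.ver.map_id A) rfl rfl rfl (F.cell e)) (.single (F.cell J.cell))
      rfl rfl) (L.hid D.hor) (L.hid (F.hor J.hor)) (D.unfold χ) (Category.comp_id _)
    (Category.comp_id _) (Category.comp_id _) (Category.comp_id _) (Category.id_comp y)
    (Category.id_comp ev) (Category.id_comp y) h (Category.id_comp y) h rfl rfl rfl rfl rfl
  have e₅ := L.idPath_comp (D.unfold χ)
  refine Eq.symm ?_
  unfold whisker
  refine (congrArg (fun z => L.comp (.cons (L.hid D.hor) (.single z) rfl rfl) (D.unfold χ)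
    (Category.id_comp y) h) e₂).trans ?_
  rw [L.comp_hid] at e₄
  refine e₄.trans ?_
  exact congrArg (fun z => L.comp _ z _ _) e₅

end AVDC.Copairing

namespace AVDC

/-! ### The slice categories and universal morphisms in terms of cells -/

section Slice

variable {K : AVDC.{u, v, w, x}} {L : AVDC.{u₁, v₁, w₁, x₁}}
  {F : AVDCFunctor K.toAVDCData L.toAVDCData} {X : L.Obj}

/-- Composition concatenates the underlying paths, so an isomorphism and its inverse carry empty
paths; the underlying objects then coincide and the cells are mutually inverse vertical cells. -/
theorem AVDCSlice.vertIso_of_iso {B : K.Obj} {l : F.ver.obj B ⟶ X} :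
    ∀ {a : AVDCSlice F X}, (a ≅ (⟨B, l⟩ : AVDCSlice F X)) →
      ∃ l' : F.ver.obj B ⟶ X, a = ⟨B, l'⟩ ∧ VertIso l' l := by
  rintro ⟨C, l'⟩ ⟨⟨P, α⟩, ⟨Q, β⟩, h₁, h₂⟩
  have e₁ : P.append Q = .nil C := congrArg AVDCSlice.Hom.path h₁
  dsimp only at P α Q β
  cases P with
  | cons J P => exact nomatch e₁
  | nil =>
    obtain rfl : Q = .nil _ := e₁
    refine ⟨l', rfl, α, β, ?_, ?_⟩
    · exact eq_of_heq (AVDCSlice.Hom.mk.inj h₁).2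
    · exact eq_of_heq (AVDCSlice.Hom.mk.inj h₂).2

theorem AVDCSlice.nonempty_iso_of_vertIso {B : K.Obj} {l l' : F.ver.obj B ⟶ X} :
    VertIso l l' → Nonempty ((⟨B, l⟩ : AVDCSlice F X) ≅ ⟨B, l'⟩)
  | ⟨α, β, h, h'⟩ => ⟨{
      hom := ⟨.nil B, α⟩
      inv := ⟨.nil B, β⟩
      hom_inv_id := AVDCSlice.Hom.ext_cast rfl h
      inv_hom_id := AVDCSlice.Hom.ext_cast rfl h' }⟩

/-- The functor keeps the underlying path, so full faithfulness can be tested on cells over one path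
at a time. Isomorphisms of the slice are invertible vertical cells, so essential surjectivity
becomes a condition on vertical morphisms. -/
theorem isUniversalRelative_iff {P : K.Obj} (S : ObjectProperty (AVDCSlice F X))
    (e : F.ver.obj P ⟶ X) :
    IsUniversalRelative F S e ↔
      (∀ ⦃B C : K.Obj⦄ (f : B ⟶ P) (g : C ⟶ P) (H : HPath K.Hor B C),
        Function.Bijective fun φ : K.Cell f g H (.nul P) => L.post (F.cell φ) e) ∧
      (∀ ⦃B : K.Obj⦄ (f : B ⟶ P), S ⟨B, F.ver.map f ≫ e⟩) ∧
      ∀ ⦃B : K.Obj⦄ (l : F.ver.obj B ⟶ X), S ⟨B, l⟩ → ∃ f : B ⟶ P, VertIso (F.ver.map f ≫ e) l := by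
  -- Morphisms of the slice under the identity functor carry cells over the path `H.map id`, which
  -- equals `H` only propositionally; `hc` and `hcast` remove this discrepancy.
  have hc : ∀ {B C : K.Obj} {f : B ⟶ P} {g : C ⟶ P} {H H' : HPath K.Hor B C} (h : H' = H)
      (φ : K.Cell f g H' (.nul P)),
      L.post (CellGraph.cast rfl rfl (congrArg F.path h) rfl (F.cell φ)) e =
        L.post (F.cell (CellGraph.cast rfl rfl h rfl φ)) e := by
    intro B C f g H H' h φ
    subst h; rfl
  have hcast : ∀ {B C : K.Obj} {f : B ⟶ P} {g : C ⟶ P} {H H' : HPath K.Hor B C} (h : H' = H),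
      Function.Bijective (fun φ : K.Cell f g H' (.nul P) =>
        CellGraph.cast rfl rfl h rfl φ) := by
    intro B C f g H H' h
    subst h; exact Function.bijective_id
  constructor
  · rintro ⟨⟨hfull, hfaith⟩, hS, hE⟩
    refine ⟨fun B C f g H => ⟨fun φ ψ h => ?_, fun χ => ?_⟩, fun B f => hS ⟨B, f⟩, fun B l hl => ?_⟩
    · obtain ⟨φ, rfl⟩ := (hcast (HPath.map_id H)).2 φ
      obtain ⟨ψ, rfl⟩ := (hcast (HPath.map_id H)).2 ψ
      let m : AVDCSlice.Hom (F := AVDCFunctor.id K.toAVDCData) ⟨B, f⟩ ⟨C, g⟩ := ⟨H, φ⟩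
      let n : AVDCSlice.Hom (F := AVDCFunctor.id K.toAVDCData) ⟨B, f⟩ ⟨C, g⟩ := ⟨H, ψ⟩
      have : m = n := (sliceFunctor F e).map_injective (AVDCSlice.Hom.ext_cast rfl (((hc (HPath.map_id H) φ).trans h).trans
          (hc (HPath.map_id H) ψ).symm))
      rw [eq_of_heq (AVDCSlice.Hom.mk.inj this).2]
    · let m : AVDCSlice.Hom (F := F) ⟨B, F.ver.map f ≫ e⟩ ⟨C, F.ver.map g ≫ e⟩ := ⟨H, χ⟩
      let a : AVDCSlice (AVDCFunctor.id K.toAVDCData) P := ⟨B, f⟩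
      let b : AVDCSlice (AVDCFunctor.id K.toAVDCData) P := ⟨C, g⟩
      obtain ⟨⟨H', φ⟩, h⟩ := (sliceFunctor F e).map_surjective (X := a) (Y := b) m
      obtain rfl : H' = H := congrArg AVDCSlice.Hom.path h
      exact ⟨_, (hc (HPath.map_id H') φ).symm.trans (eq_of_heq (AVDCSlice.Hom.mk.inj h).2)⟩
    · let i := (S.lift (sliceFunctor F e) hS).objObjPreimageIso ⟨⟨B, l⟩, hl⟩
      obtain ⟨l', h, hl'⟩ := AVDCSlice.vertIso_of_iso (S.ι.mapIso i)
      -- The chosen preimage is made a variable so that the equalities forced by the isomorphism can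
      -- be substituted.
      generalize (S.lift (sliceFunctor F e) hS).objPreimage ⟨⟨B, l⟩, hl⟩ = a at h
      obtain ⟨B', f⟩ := a
      obtain rfl : B' = B := congrArg AVDCSlice.obj h
      obtain rfl : F.ver.map f ≫ e = l' := eq_of_heq (AVDCSlice.mk.inj h).2
      exact ⟨f, hl'⟩
  · rintro ⟨hb, hS, hE⟩
    have hfull : (sliceFunctor F e).Full := ⟨by
      rintro ⟨B, f⟩ ⟨C, g⟩ ⟨H, χ⟩
      obtain ⟨φ, hφ⟩ := (hb f g H).2 χ
      obtain ⟨φ, rfl⟩ := (hcast (HPath.map_id H)).2 φ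
      exact ⟨⟨H, φ⟩, AVDCSlice.Hom.ext_cast rfl ((hc (HPath.map_id H) φ).trans hφ)⟩⟩
    have hfaith : (sliceFunctor F e).Faithful := ⟨by
      rintro ⟨B, f⟩ ⟨C, g⟩ ⟨H, φ⟩ ⟨H', ψ⟩ h
      obtain rfl : H = H' := congrArg AVDCSlice.Hom.path h
      have h' := eq_of_heq (AVDCSlice.Hom.mk.inj h).2
      have h'' := (hb f g H).1 (((hc (HPath.map_id H) φ).symm.trans h').trans
        (hc (HPath.map_id H) ψ))
      rw [(hcast (HPath.map_id H)).1 h'']⟩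
    refine ⟨⟨hfull, hfaith⟩, fun a => hS a.mor, ?_⟩
    refine {
      faithful := Functor.Faithful.of_comp_iso (S.liftCompιIso (sliceFunctor F e) _)
      full := Functor.Full.of_comp_faithful_iso (S.liftCompιIso (sliceFunctor F e) _)
      essSurj := ⟨?_⟩ }
    rintro ⟨⟨B, l⟩, hl⟩
    obtain ⟨f, hf⟩ := hE l hl
    obtain ⟨i⟩ := AVDCSlice.nonempty_iso_of_vertIso hf
    exact ⟨⟨B, f⟩, ⟨S.isoMk i⟩⟩

/-- Morphisms with the same universal property have equivalent domains. -/
theorem IsUniversalRelative.vertEquiv {P Q : K.Obj} {S : ObjectProperty (AVDCSlice F X)}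
    {e : F.ver.obj P ⟶ X} {e' : F.ver.obj Q ⟶ X} (h : IsUniversalRelative F S e)
    (h' : IsUniversalRelative F S e') : VertEquiv P Q := by
  -- The image of `a ≫ b` followed by `e` is isomorphic to `e`, the image of the identity. Full
  -- faithfulness of `e ∘ F –` reflects this isomorphism, together with its inverse laws.
  have key : ∀ {P Q : K.Obj} {e : F.ver.obj P ⟶ X} {e' : F.ver.obj Q ⟶ X} {a : P ⟶ Q} {b : Q ⟶ P},
      IsUniversalRelative F S e → VertIso (F.ver.map a ≫ e') e → VertIso (F.ver.map b ≫ e) e' →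
        VertIso (a ≫ b) (𝟙 P) := by
    intro P Q e e' a b h ha hb
    have hm := ((isUniversalRelative_iff S e).1 h).1
    have hab := (hb.pre (F.ver.map a)).trans ha
    obtain ⟨α, β, hα, hβ⟩ : VertIso (F.ver.map (a ≫ b) ≫ e) (F.ver.map (𝟙 P) ≫ e) := by
      rw [F.ver.map_id, Category.id_comp, F.ver.map_comp, Category.assoc]
      exact hab
    obtain ⟨α, rfl⟩ := (hm (a ≫ b) (𝟙 P) (.nil P)).2 α
    obtain ⟨β, rfl⟩ := (hm (𝟙 P) (a ≫ b) (.nil P)).2 β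
    have hvid : ∀ f : P ⟶ P, L.post (F.cell (K.vid f)) e = L.vid (F.ver.map f ≫ e) := fun f => by
      rw [F.map_vid]; exact L.vid_comp_vid _ _
    have hcomp : ∀ {f g k : P ⟶ P} (α : K.Cell f g (.nil P) (.nul P))
        (β : K.Cell g k (.nil P) (.nul P)), L.post (F.cell (K.hcomp α β rfl)) e =
          L.hcomp (L.post (F.cell α) e) (L.post (F.cell β) e) rfl := fun α β => by
      rw [map_hcomp F α β rfl rfl]; exact post_hcomp _ _ _ _
    exact ⟨α, β, (hm _ _ _).1 (((hcomp α β).trans hα).trans (hvid _).symm),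
      (hm _ _ _).1 (((hcomp β α).trans hβ).trans (hvid _).symm)⟩
  have hu := (isUniversalRelative_iff S e).1 h
  have hu' := (isUniversalRelative_iff S e').1 h'
  have hid : ∀ {P : K.Obj} (e : F.ver.obj P ⟶ X), F.ver.map (𝟙 P) ≫ e = e := fun e => by
    rw [F.ver.map_id, Category.id_comp]
  -- As the image of an identity, `e` itself satisfies `S`, so essential surjectivity for `e'` gives
  -- `a`; symmetrically for `b`.
  obtain ⟨a, ha⟩ := hu'.2.2 e (by have := hu.2.1 (𝟙 P); rwa [hid] at this)
  obtain ⟨b, hb⟩ := hu.2.2 e' (by have := hu'.2.1 (𝟙 Q); rwa [hid] at this)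
  exact ⟨a, b, key h ha hb, key h' hb ha⟩

end Slice

end AVDC

/-! ### Yoneda embeddings versus internal homs -/

namespace AVDC

theorem IsInvertible.isCartesian_of_comp {K : AVDC.{u, v, w, x}} {A B C D : K.Obj}
    {J J' : K.Hor A B} {κ : K.Cell (𝟙 A) (𝟙 B) (.single J) (.one J')} (hκ : IsInvertible κ)
    {f : A ⟶ C} {g : B ⟶ D} {T : HTarget K.Hor C D} {ψ : K.Cell f g (.single J') T}
    (h : K.IsCartesian (.one J) (K.comp (.single κ) ψ (Category.id_comp f) (Category.id_comp g))) :
    K.IsCartesian (.one J') ψ := by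
  obtain ⟨κ', h₁, h₂⟩ := hκ
  have e := comp_comp (.single κ') κ ψ (Category.comp_id _) (Category.comp_id _)
    (Category.id_comp f) (Category.id_comp g) (Category.id_comp f) (Category.id_comp g)
    (Category.id_comp f) (Category.id_comp g)
  rw [h₂, hid_comp] at e
  rw [e]
  exact isCartesian_comp (IsInvertible.isCartesian ⟨κ, h₂, h₁⟩) h _ _

namespace Copairing

variable {K : AVDC.{u, v, w, x}} {L : AVDC.{u₁, v₁, w₁, x₁}}
  {F : AVDCFunctor K.toAVDCData L.toAVDCData} {I : L.Obj} {A : K.Obj} (D : Copairing F I A)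
  {P : K.Obj} {yA : A ⟶ P} {X : L.Obj} {y : I ⟶ X} {ev : F.ver.obj P ⟶ X}

/-- A morphism `F B ⟶ X` is small if it is isomorphic to one representing some `J♭`. -/
def IsSmall (y : I ⟶ X) {B : K.Obj} (f : F.ver.obj B ⟶ X) : Prop :=
  ∃ (J : K.Hor A B) (l : F.ver.obj B ⟶ X) (c : L.Cell y l (.single (D.adjunct J)) (.nul X)),
    L.IsCartesian (.one (D.adjunct J)) c ∧ VertIso f l

theorem unfold_injective {B : K.Obj} {J : K.Hor A B} {d : I ⟶ X} {m : F.ver.obj B ⟶ X}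
    {γ γ' : L.Cell d m (.single (D.adjunct J)) (.nul X)} (h : D.unfold γ = D.unfold γ') :
    γ = γ' :=
  ((D.pointwise J).1.1 d m (Category.id_comp d) (Category.id_comp m) _ (D.unfold γ)).unique rfl
    h.symm

/-- Two horizontal morphisms whose adjuncts are restrictions along the same morphisms are
isomorphic. -/
theorem exists_isInvertible_of_represents {B : K.Obj} {J J' : K.Hor A B} {d : I ⟶ X}
    {m : F.ver.obj B ⟶ X} {Γ : L.Cell d m (.cons D.hor (.single (F.hor J))) (.nul X)}
    {Γ' : L.Cell d m (.cons D.hor (.single (F.hor J'))) (.nul X)} (h : D.Represents Γ)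
    (h' : D.Represents Γ') (hm : F.ver.map (𝟙 B) ≫ m = m) :
    ∃ φ : K.Cell (𝟙 A) (𝟙 B) (.single J) (.one J'), IsInvertible φ ∧
      D.whisker (J := .one J') φ Γ' hm = Γ := by
  obtain ⟨φ, hφ, -⟩ := h' J hm Γ
  exact ⟨φ, Represents.isInvertible D h h' hm hφ, hφ⟩

/-- Naturality reduces `theta` at the cell induced by `yA` on the unit to its value `ξ` at the
vertical identity. This links full faithfulness of `yA` to cartesianness of `ξ`. -/
theorem theta_unit (ξ : L.Cell y (F.ver.map yA ≫ ev) (.single D.hor) (.nul X))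
    (U : AVDCData.HUnit K.toAVDCData A)
    (hm : F.ver.map (𝟙 A) ≫ F.ver.map yA ≫ ev = F.ver.map yA ≫ ev) :
    D.theta ξ (K.comp (.single U.cell) (K.vid yA) (Category.id_comp _) (Category.id_comp _)) rfl =
      D.whisker (J := .nul A) U.cell ξ hm := by
  rw [D.theta_comp_nul ξ U.cell (K.vid yA) _ _ rfl hm, D.theta_vid]

variable {D} in
-- Full faithfulness makes the cell from the unit to `P` cartesian, so its image under `theta` comes
-- from a cartesian cell `γ` on the adjunct of the unit. By `theta_unit` this `γ` is `ξ` composed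
-- with the isomorphism `κ` of that adjunct with `ι`.
theorem IsMatching.isCartesian_of_isFullyFaithful {J : K.Companion yA}
    {ξ : L.Cell y (F.ver.map yA ≫ ev) (.single D.hor) (.nul X)}
    {χ : L.Cell y ev (.single (D.adjunct J.hor)) (.nul X)} (h : D.IsMatching J ξ χ)
    (hF : PreservesRightRestrictions F) (hA : K.IsUnital A) (hyA : K.IsFullyFaithful yA) :
    L.IsCartesian (.one D.hor) ξ := by
  obtain ⟨U⟩ := hA
  have hm : F.ver.map (𝟙 A) ≫ F.ver.map yA ≫ ev = F.ver.map yA ≫ ev := by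
    rw [F.ver.map_id, Category.id_comp]
  have hc := isCartesian_comp U.cart hyA (Category.id_comp _) (Category.id_comp _)
  obtain ⟨γ, hγ, e⟩ := h.exists_isCartesian_unfold hF hc rfl
  obtain ⟨κ, hκ, e'⟩ := D.exists_adjunct_unit U
  have := D.unfold_injective ((e.trans (D.theta_unit ξ U hm)).trans (e' ξ hm).symm)
  rw [this] at hγ
  exact hκ.isCartesian_of_comp hγ

variable {D} in
-- The restriction `N` of `P` along `yA` on both sides exists, being a right restriction of the
-- companion. Its adjunct and that of the unit both represent restrictions of `X` along `y` and `ev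
-- ∘ F yA`, so the canonical cell from the unit to `N` is invertible.
theorem IsMatching.isFullyFaithful_of_isCartesian {J : K.Companion yA}
    {ξ : L.Cell y (F.ver.map yA ≫ ev) (.single D.hor) (.nul X)}
    {χ : L.Cell y ev (.single (D.adjunct J.hor)) (.nul X)} (h : D.IsMatching J ξ χ)
    (hK : K.HasRightRestrictions) (hF : PreservesRightRestrictions F) (hA : K.IsUnital A)
    (hξ : L.IsCartesian (.one D.hor) ξ) : K.IsFullyFaithful yA := by
  obtain ⟨U⟩ := hA
  have hm : F.ver.map (𝟙 A) ≫ F.ver.map yA ≫ ev = F.ver.map yA ≫ ev := by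
    rw [F.ver.map_id, Category.id_comp]
  obtain ⟨N, n, hn⟩ := hK J.hor yA
  have hc := isCartesian_comp hn J.cart (Category.id_comp _) (Category.comp_id _)
  obtain ⟨γ, hγ, e⟩ := h.exists_isCartesian_unfold hF hc rfl
  obtain ⟨κ, hκ, e'⟩ := D.exists_adjunct_unit U
  have hγ' := isCartesian_comp hκ.isCartesian hξ (Category.id_comp _) (Category.id_comp _)
  obtain ⟨i, hi, -⟩ := hc (𝟙 A) (𝟙 A) (Category.id_comp _) (Category.id_comp _) _
    (K.comp (.single U.cell) (K.vid yA) (Category.id_comp _) (Category.id_comp _))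
  have hi' : IsInvertible i := by
    refine Represents.isInvertible D (D.represents_unfold hK hF hγ') (D.represents_unfold hK hF hγ)
      hm ?_
    rw [e' ξ hm, ← D.theta_unit ξ U hm, e]
    refine (D.theta_comp ξ i _ (Category.id_comp _) (Category.id_comp _) rfl hm rfl).symm.trans ?_
    exact congrArg (fun z => D.theta ξ z rfl) hi
  have hcU := isCartesian_comp hi'.isCartesian hc (Category.id_comp _) (Category.id_comp _)
  have hcU' : K.IsCartesian (.one U.hor)
      (K.comp (.single U.cell) (K.vid yA) (Category.id_comp yA) (Category.id_comp yA)) := by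
    rw [← hi]; exact hcU
  -- Precomposing the cartesian cell on the unit with the cartesian inverse `η` recovers the
  -- vertical identity of `yA`.
  obtain ⟨η, hη, h₁, -⟩ := exists_unit_inverse U
  have hv := isCartesian_comp hη hcU' (Category.id_comp _) (Category.id_comp _)
  have e₁ := comp_comp (.single η) U.cell (K.vid yA) (Category.comp_id _) (Category.comp_id _)
    (Category.id_comp yA) (Category.id_comp yA) (Category.id_comp yA) (Category.id_comp yA)
    (Category.id_comp yA) (Category.id_comp yA)
  have e₂ := vid_vid_comp (𝟙 A) yA (Category.id_comp yA)
  rw [← h₁] at e₂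
  unfold IsFullyFaithful
  rw [← e₂.symm.trans e₁] at hv
  exact hv

/-- If `yA` is a Yoneda embedding and `ev` represents `(yA_*)♭`, then `ev` is universal relative to
the small morphisms and `ev ∘ F yA` represents `ι`. -/
theorem isUniversalRelative_of_isYonedaEmbedding (hK : K.HasRightRestrictions)
    (hF : PreservesRightRestrictions F) (hy : L.IsYonedaEmbedding y) (hA : K.IsUnital A)
    (J : K.Companion yA) (hyA : K.IsYonedaEmbedding yA)
    {χ : L.Cell y ev (.single (D.adjunct J.hor)) (.nul X)}
    (hχ : L.IsCartesian (.one (D.adjunct J.hor)) χ) :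
    IsUniversalRelative F (fun a => D.IsSmall y a.mor) ev ∧
      ∃ c : L.Cell y (F.ver.map yA ≫ ev) (.single D.hor) (.nul X),
        L.IsCartesian (.one D.hor) c := by
  obtain ⟨ξ, h⟩ := D.exists_isMatching J hχ
  -- The restriction of `P` along `yA` and `f` is obtained as the right restriction of the companion
  -- along `f`.
  have hres : ∀ {B : K.Obj} (f : B ⟶ P), ∃ (J' : K.Hor A B) (η : K.Cell yA f (.single J') (.nul P)),
      K.IsCartesian (.one J') η := by
    intro B f
    obtain ⟨J', r, hr⟩ := hK J.hor f
    exact ⟨J', _, isCartesian_comp hr J.cart (Category.id_comp _) (Category.comp_id _)⟩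
  refine ⟨(isUniversalRelative_iff _ _).2 ⟨fun B C f g H => ?_, fun B f => ?_, fun B l hl => ?_⟩,
    ξ, h.isCartesian_of_isFullyFaithful hF hA hyA.fullyFaithful⟩
  · obtain ⟨J', η, hη⟩ := hres f
    exact (h.bijective_hcomp_iff hK hF hy.dense hη g H).1
      ((Function.bijective_iff_existsUnique _).2 (hyA.dense f J' η hη g H))
  · obtain ⟨J', η, hη⟩ := hres f
    obtain ⟨γ, hγ, -⟩ := h.exists_isCartesian_unfold hF hη rfl
    exact ⟨J', _, γ, hγ, VertIso.refl _⟩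
  -- The Yoneda axiom writes `J'` as the restriction along some `f`; then `ev ∘ F f` and `l'` both
  -- represent `J'♭`, and density of `y` makes them isomorphic.
  · obtain ⟨J', l', c, hc, hl⟩ := hl
    obtain ⟨f, η, hη⟩ := hyA.yoneda J'
    obtain ⟨γ, hγ, -⟩ := h.exists_isCartesian_unfold hF hη rfl
    exact ⟨f, (hy.dense.vertIso hγ hc).trans hl.symm⟩

/-- If `ev` is universal relative to the small morphisms and `ev ∘ F yA` represents `ι`, then `yA`
is a Yoneda embedding and `ev` represents `(yA_*)♭`. -/
theorem isYonedaEmbedding_of_isUniversalRelative (hK : K.HasRightRestrictions)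
    (hF : PreservesRightRestrictions F) (hy : L.IsYonedaEmbedding y) (hA : K.IsUnital A)
    (J : K.Companion yA) (hev : IsUniversalRelative F (fun a => D.IsSmall y a.mor) ev)
    {ξ : L.Cell y (F.ver.map yA ≫ ev) (.single D.hor) (.nul X)}
    (hξ : L.IsCartesian (.one D.hor) ξ) :
    K.IsYonedaEmbedding yA ∧ ∃ c : L.Cell y ev (.single (D.adjunct J.hor)) (.nul X),
      L.IsCartesian (.one (D.adjunct J.hor)) c := by
  obtain ⟨hb, hS, hE⟩ := (isUniversalRelative_iff _ _).1 hev
  have hP := IsMatching.map_id_comp (F := F) ev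
  -- Smallness of `ev` itself: it represents the adjunct of some `J₀`, which will turn out to be
  -- isomorphic to the companion.
  obtain ⟨J₀, l, c, hc, hl⟩ := hS (𝟙 P)
  dsimp only at hl
  rw [hP] at hl
  obtain ⟨c', hc'⟩ := exists_isCartesian_of_vertIso hl.symm hc
  -- The companion represents the same cells as `J₀`, by three bijections: `ξ` is left Kan as `y` is
  -- dense, `ev ∘ F –` is full and faithful, and `J.cell` is cartesian.
  have hrep : D.Represents (D.theta ξ J.cell hP) := by
    intro H hm ψ
    obtain ⟨β, hβ, uβ⟩ := hy.dense _ _ ξ hξ ev (.single (F.hor H)) ψ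
    have h₁ : ∀ φ : K.Cell yA (𝟙 P) (.single H) (.nul P), D.theta ξ φ hP = ψ ↔
        L.comp (.single (F.cell φ)) (L.vid ev) rfl hP = β :=
      fun φ => ⟨fun e => uβ _ e, fun e => (congrArg (fun z => L.hcomp ξ z rfl) e).trans hβ⟩
    have h₂ : ∃! φ : K.Cell yA (𝟙 P) (.single H) (.nul P), D.theta ξ φ hP = ψ := by
      simp only [h₁]
      -- The target is generalised to `n` because `F` of the identity followed by `ev` equals `ev`
      -- only propositionally.
      have e : ∀ {n : F.ver.obj P ⟶ X} (hn : F.ver.map (𝟙 P) ≫ ev = n)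
          (β : L.Cell (F.ver.map yA ≫ ev) n (.single (F.hor H)) (.nul X)),
          ∃! φ : K.Cell yA (𝟙 P) (.single H) (.nul P),
            L.comp (.single (F.cell φ)) (L.vid ev) rfl hn = β := by
        intro n hn β
        subst hn
        exact (Function.bijective_iff_existsUnique _).1 (hb yA (𝟙 P) (.single H)) β
      exact e hP β
    have key : ∀ φ : K.Cell (𝟙 A) (𝟙 P) (.single H) (.one J.hor),
        D.theta ξ (K.comp (.single φ) J.cell (Category.id_comp _) (Category.comp_id _)) hP =
          D.whisker (J := .one J.hor) φ (D.theta ξ J.cell hP) hm :=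
      fun φ => D.theta_comp ξ φ J.cell _ _ _ _ _
    obtain ⟨φ, hφ, uφ⟩ := h₂
    obtain ⟨φ', rfl, -⟩ := J.cart (𝟙 A) (𝟙 P) (Category.id_comp _) (Category.comp_id _) _ φ
    refine ⟨φ', (key φ').symm.trans hφ, fun z hz => ?_⟩
    exact (J.cart (𝟙 A) (𝟙 P) (Category.id_comp _) (Category.comp_id _) _ _).unique
      (uφ _ ((key z).trans hz)) rfl
  obtain ⟨φ, hφ, eφ⟩ := D.exists_isInvertible_of_represents hrep (D.represents_unfold hK hF hc') hP
  -- The isomorphism of the companion with `J₀` is cartesian, hence a restriction along an identity;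
  -- restricting `c'` along it yields a `χ` matching `ξ`.
  obtain ⟨χ, hχ, eχ⟩ := D.exists_isCartesian_restriction hF hφ.isCartesian hc' hP
  have h : D.IsMatching J ξ χ := ⟨hχ, fun _ => eφ.symm.trans eχ.symm⟩
  refine ⟨⟨fun B f J' η hη C g H => ?_, fun B H => ?_,
    h.isFullyFaithful_of_isCartesian hK hF hA hξ⟩, χ, hχ⟩
  · exact (Function.bijective_iff_existsUnique _).1
      ((h.bijective_hcomp_iff hK hF hy.dense hη g H).2 (hb f g H))
  -- The morphism representing `H♭` is small, hence isomorphic to some `ev ∘ F f`. The restriction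
  -- `J'` of `P` along `yA` and `f` has its adjunct represented by the same morphism, so `H` is
  -- isomorphic to `J'`.
  · obtain ⟨l, c, hc⟩ := hy.yoneda (D.adjunct H)
    obtain ⟨f, hf⟩ := hE l ⟨H, l, c, hc, VertIso.refl l⟩
    obtain ⟨c', hc'⟩ := exists_isCartesian_of_vertIso hf.symm hc
    obtain ⟨J', r, hr⟩ := hK J.hor f
    have hη := isCartesian_comp hr J.cart (Category.id_comp _) (Category.comp_id _)
    obtain ⟨γ, hγ, -⟩ := h.exists_isCartesian_unfold hF hη rfl
    obtain ⟨ψ, hψ, -⟩ := D.exists_isInvertible_of_represents (D.represents_unfold hK hF hc')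
      (D.represents_unfold hK hF hγ) (by rw [F.ver.map_id, Category.id_comp])
    exact ⟨f, _, isCartesian_comp hψ.isCartesian hη (Category.id_comp _) (Category.id_comp _)⟩

end Copairing

/-- The copairing underlying a weak horizontal dual. -/
noncomputable def WeakHorizontalDual.toCopairing {K : AVDC.{u, v, w, x}} {M : K.Monoidal}
    {A : K.Obj} (D : WeakHorizontalDual M A) : Copairing D.functor M.unit A where
  hor := D.copairing
  adjunct := D.adjunct
  cocart := D.cocart
  pointwise := D.pointwise
  bijective := D.bijective

end AVDC

theorem mainTheorem1 (K : AVDC.{u, v, w, x}) (M : K.Monoidal) (hK : K.HasRightRestrictions)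
    {PI : K.Obj} (y : M.unit ⟶ PI) (hy : K.IsYonedaEmbedding y)
    {A : K.Obj} (hA : K.IsUnital A) (D : AVDC.WeakHorizontalDual M A)
    (hD : AVDC.PreservesRightRestrictions D.functor) :
    (∀ (P : K.Obj) (yA : A ⟶ P) (ev : D.functor.ver.obj P ⟶ PI) (yAStar : K.Companion yA),
      (K.IsYonedaEmbedding yA ∧
          ∃ c : K.Cell y ev (.single (D.adjunct yAStar.hor)) (.nul PI),
            K.IsCartesian (.one (D.adjunct yAStar.hor)) c) ↔
        (D.IsInternalHom y ev ∧
          ∃ c : K.Cell y (D.functor.ver.map yA ≫ ev) (.single D.copairing) (.nul PI),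
            K.IsCartesian (.one D.copairing) c)) ∧
    (∀ (PA Q : K.Obj) (yA : A ⟶ PA) (ev : D.functor.ver.obj Q ⟶ PI),
      K.IsYonedaEmbedding yA → Nonempty (K.Companion yA) → D.IsInternalHom y ev →
        AVDC.VertEquiv PA Q) := by
  refine ⟨fun P yA ev J => ⟨?_, ?_⟩, ?_⟩
  · rintro ⟨hyA, χ, hχ⟩
    exact D.toCopairing.isUniversalRelative_of_isYonedaEmbedding hK hD hy hA J hyA hχ
  · rintro ⟨hev, ξ, hξ⟩
    exact D.toCopairing.isYonedaEmbedding_of_isUniversalRelative hK hD hy hA J hev hξ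
  · rintro PA Q yA ev hyA ⟨J⟩ hev
    -- The Yoneda axiom of `y` supplies the evaluation `l` for `PA`; it then has the same universal
    -- property as `ev`.
    obtain ⟨l, χ, hχ⟩ := hy.yoneda (D.adjunct J.hor)
    have h := (D.toCopairing.isUniversalRelative_of_isYonedaEmbedding hK hD hy hA J hyA hχ).1
    exact AVDC.IsUniversalRelative.vertEquiv h hev
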